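/- **Setting.** Let $\mathfrak h\neq 0$ be a finite-dimensional, purely odd complex super-vector space with a non-degenerate super-symmetric pairing $(-,-)$, i.e. $(a,b)=-(b,a)$. Its dimension $d$ is then even and positive. Fix $\beta\in\mathbb C$ with $\beta^4=(-1)^{d/2}$. Put $(-,-)=\pi i\,(-,-)_{SF}$. Let $S=S(\mathfrak h)$ be the symmetric algebra of $\mathfrak h$ in super-vector spaces (the exterior algebra of the underlying space), a commutative and cocommutative Hopf super-algebra with $\Delta(x)=x\otimes 1+1\otimes x$ and antipode $x\mapsto -x$ for $x\in\mathfrak h$. For dual bases with $(a_i,b_j)_{SF}=\delta_{ij}$ let $C=\sum_i b_i\otimes a_i$, $\hat C=\sum_i b_ia_i\in S$, $\gamma=\exp(C)\in S\otimes S$, $\sigma=\exp(\tfrac12\hat C)\in S$. Let $\lambda:S\to\mathbb C$ be the linear form that vanishes outside the top degree $d$, with $\lambda(\hat C^{d/2})=2^{d/2}(d/2)!$, and let $\phi=\beta^2(\mathrm{id}\otimes(\lambda\circ\mu_S))\circ(\gamma^{-1}\otimes\mathrm{id}):S\to S$. The category $SF(\mathfrak h)=SF_0\oplus SF_1$ has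 as $SF_0$ the finite-dimensional $S$-modules in super-vector spaces, and as $SF_1$ the finite-dimensional super-vector spaces. The tensor product $X*Y$ is $X\otimes Y$ in sectors $00$ (diagonal $S$-action, in $SF_0$), $01$, $10$ (in $SF_1$), and $S\otimes X\otimes Y$ in sector $11$ (left regular action, in $SF_0$). The unit is $\mathbf 1=\mathbb C^{1|0}\in SF_0$ with trivial action. With Koszul signs everywhere, the associator $X*(Y*Z)\to(X*Y)*Z$ is trivial in sectors $000,001,100$. In sector $010$ it is the action of $\gamma$ on $X$ and $Z$. In sector $101$ it is the action of $\gamma$ on $S$ and $Y$. In the other sectors it is * $011$: $x\otimes g\otimes y\otimes z\mapsto\sum\pm g'\otimes S(g'').x\otimes y\otimes z$ (where $S(g'')$ is the antipode applied to $g''$), * $110$: $g\otimes x\otimes y\otimes z\mapsto\sum\pm g'\otimes x\otimes y\otimes g''.z$, * $111$: $x\otimes g\otimes y\otimes z\mapsto\pm\phi(g)\otimes x\otimes y\otimes z$. Let $\tau$ be the symmetric braiding and $\omega_Y$ the parity involution of super-vector spaces. The braiding $X*Y\to Y*X$ is $\tau\circ\gamma^{-1}$ in sector $00$, $\tau\circ(\sigma\otimes\mathrm{id})$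 in sector $01$, $\tau\circ(\mathrm{id}\otimes\sigma\omega_Y)$ in sector $10$, and $\beta\,\sigma^{-1}\otimes(\tau\circ(\mathrm{id}\otimes\omega_Y))$ in sector $11$. The ribbon twist $\theta_X$ is the action of $\sigma^{-2}$ on $SF_0$ and $\beta^{-1}\omega_X$ on $SF_1$. Consider (associative, unital) algebras $H=H_0\oplus H_1$, $H_i\in SF_i$, in $SF(\mathfrak h)$, with multiplication $\mu$, satisfying * (W1) $H_1\neq0$; * (W2) $\theta_H=\mathrm{id}_H$; * (W3) $H$ is commutative, i.e. $\mu\circ c_{H,H}=\mu$ for the braiding $c$; * (W4) there is a morphism $\kappa:H\to\mathbf 1$ such that $\kappa\circ\mu:H*H\to\mathbf 1$ is a non-degenerate pairing, i.e. it has a copairing $\mathbf 1\to H*H$ with both zig-zag identities; * (W5) $H$ is simple as a left module over itself. **Theorem.** If $\beta=1$, then sending $H$ to the annihilator $\{x\in\mathfrak h\mid x.H_0=0\}$ induces a bijection from isomorphism classes of algebras $H$ satisfying W1–W5 to Lagrangian subspaces $\mathfrak f\subset\mathfrak h$ (those with $\mathfrak f=\mathfrak f^\perp$). Moreover, for every such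 $H$ the class in the Grothendieck group of $SF(\mathfrak h)$ is $$[H]=2^{\frac d2-1}\big([\mathbf 1]+[\Pi\mathbf 1]\big)+[T],$$ where $\Pi\mathbf 1=\mathbb C^{0|1}\in SF_0$ with trivial action and $T=\mathbb C^{1|0}\in SF_1$. If $\beta\neq1$, no algebra in $SF(\mathfrak h)$ satisfies W1–W5. -/

import Mathlib

/-!  The ribbon category `SF(h)` of symplectic fermions, algebras in it, and its Grothendieck group.

Conventions.  All vector spaces are finite-dimensional and complex.  A super-vector space is a vector
space with a parity involution (`+1` on the even part, `-1` on the odd part); Koszul signs are used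
throughout.  The purely odd space `h` is represented by its underlying ordinary vector space `V`, and a
super-symmetric form on `h` by an alternating form on `V`. -/

open scoped TensorProduct

noncomputable section

namespace SF

universe u

/-! ### Super-vector spaces -/

/-- A finite-dimensional complex super-vector space, given by its parity involution `par`. -/
structure SuperSpace where
  carrier : Type u
  [acg : AddCommGroup carrier]
  [mod : Module ℂ carrier]
  [fin : FiniteDimensional ℂ carrier]
  par : carrier →ₗ[ℂ] carrier
  par_par : par ∘ₗ par = LinearMap.id

attribute [instance] SuperSpace.acg SuperSpace.mod SuperSpace.fin

namespace SuperSpace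

/-- The tensor product of super-vector spaces. -/
abbrev tensor (X Y : SuperSpace.{u}) : SuperSpace.{u} where
  carrier := X.carrier ⊗[ℂ] Y.carrier
  par := TensorProduct.map X.par Y.par
  par_par := by rw [← TensorProduct.map_comp, X.par_par, Y.par_par, TensorProduct.map_id]

/-- The direct sum of super-vector spaces. -/
abbrev sum (X Y : SuperSpace.{u}) : SuperSpace.{u} where
  carrier := X.carrier × Y.carrier
  par := X.par.prodMap Y.par
  par_par := by
    have h1 := fun u => LinearMap.congr_fun X.par_par u
    have h2 := fun u => LinearMap.congr_fun Y.par_par u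
    simp only [LinearMap.comp_apply, LinearMap.id_apply] at h1 h2
    ext <;> simp [h1, h2]

/-- The zero super-vector space. -/
abbrev zero : SuperSpace.{u} where
  carrier := PUnit.{u + 1}
  par := LinearMap.id
  par_par := rfl

/-- The super-vector space of dimension `1|0`. -/
abbrev evenLine : SuperSpace.{u} where
  carrier := ULift.{u} ℂ
  par := LinearMap.id
  par_par := rfl

/-- The super-vector space of dimension `0|1`. -/
abbrev oddLine : SuperSpace.{u} where
  carrier := ULift.{u} ℂ
  par := -LinearMap.id
  par_par := by ext; simp

/-- The symmetric braiding `x ⊗ y ↦ (-1)^(|x||y|) y ⊗ x` of super-vector spaces.  The factor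
`(1 + ω ⊗ 1 + 1 ⊗ ω - ω ⊗ ω) / 2`, with `ω` the parity, is the Koszul sign. -/
def swap (X Y : SuperSpace.{u}) : X.carrier ⊗[ℂ] Y.carrier →ₗ[ℂ] Y.carrier ⊗[ℂ] X.carrier :=
  (TensorProduct.comm ℂ X.carrier Y.carrier).toLinearMap ∘ₗ
    ((1 / 2 : ℂ) • (LinearMap.id + TensorProduct.map X.par LinearMap.id
      + TensorProduct.map LinearMap.id Y.par - TensorProduct.map X.par Y.par))

end SuperSpace

/-! ### Representations of `h`, and the Hopf algebra `S(h)` -/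

section

variable (V : Type u) [AddCommGroup V] [Module ℂ V]

/-- A finite-dimensional representation of `h` (an abelian Lie super-algebra, purely odd) in
super-vector spaces: the elements of `h` act by odd, pairwise anti-commuting endomorphisms. -/
structure Rep extends SuperSpace.{u} where
  act : V →ₗ[ℂ] Module.End ℂ carrier
  act_par : ∀ x, act x * par = -(par * act x)
  act_act : ∀ x y, act x * act y = -(act y * act x)

end

variable {V : Type u} [AddCommGroup V] [Module ℂ V]

theorem Rep.act_sq (X : Rep V) (x : V) : X.act x * X.act x = 0 := by
  have h := X.act_act x x
  have h2 : (2 : ℂ) • (X.act x * X.act x) = 0 := by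
    rw [two_smul]; nth_rewrite 1 [h]; exact neg_add_cancel _
  exact (smul_eq_zero.mp h2).resolve_left two_ne_zero

/-- The action on a representation of the symmetric algebra `S(h)` of the purely odd space `h`, which is
the exterior algebra of `V` and the universal enveloping algebra of `h`. -/
def Rep.actS (X : Rep V) : ExteriorAlgebra ℂ V →ₐ[ℂ] Module.End ℂ X.carrier :=
  ExteriorAlgebra.lift ℂ ⟨X.act, X.act_sq⟩

/-- The action of `S(h)` as a map `S(h) ⊗ X → X`. -/
def Rep.actMap (X : Rep V) : ExteriorAlgebra ℂ V ⊗[ℂ] X.carrier →ₗ[ℂ] X.carrier :=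
  TensorProduct.lift X.actS.toLinearMap

/-- A super-vector space with trivial action of `h`. -/
abbrev SuperSpace.triv (X : SuperSpace.{u}) : Rep V where
  toSuperSpace := X
  act := 0
  act_par := by simp
  act_act := by simp

/-- The direct sum of representations. -/
abbrev Rep.sum (X Y : Rep V) : Rep V where
  toSuperSpace := X.toSuperSpace.sum Y.toSuperSpace
  act :=
    { toFun := fun x => (X.act x).prodMap (Y.act x)
      map_add' := fun x y => by ext <;> simp
      map_smul' := fun c x => by ext <;> simp }
  act_par := fun x => by
    have h1 := fun u => LinearMap.congr_fun (X.act_par x) u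
    have h2 := fun u => LinearMap.congr_fun (Y.act_par x) u
    simp only [Module.End.mul_apply, LinearMap.neg_apply] at h1 h2
    ext <;> simp [h1, h2]
  act_act := fun x y => by
    have h1 := fun u => LinearMap.congr_fun (X.act_act x y) u
    have h2 := fun u => LinearMap.congr_fun (Y.act_act x y) u
    simp only [Module.End.mul_apply, LinearMap.neg_apply] at h1 h2
    ext <;> simp [h1, h2]

/-- The tensor product of representations: `x ∈ h` acts through the coproduct `x ⊗ 1 + 1 ⊗ x`, that is,
`x.(u ⊗ v) = x.u ⊗ v + (-1)^|u| u ⊗ x.v`. -/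
abbrev Rep.tensor (X Y : Rep V) : Rep V where
  toSuperSpace := X.toSuperSpace.tensor Y.toSuperSpace
  act :=
    { toFun := fun x => TensorProduct.map (X.act x) LinearMap.id + TensorProduct.map X.par (Y.act x)
      map_add' := fun x y => by
        simp only [map_add, TensorProduct.map_add_left, TensorProduct.map_add_right]; abel
      map_smul' := fun c x => by
        simp [TensorProduct.map_smul_left, TensorProduct.map_smul_right] }
  act_par := fun x => by
    have h1 := fun u => LinearMap.congr_fun (X.act_par x) u
    have h2 := fun u => LinearMap.congr_fun (Y.act_par x) u
    simp only [Module.End.mul_apply, LinearMap.neg_apply] at h1 h2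
    refine TensorProduct.ext' fun u v => ?_
    simp [h1, h2, TensorProduct.neg_tmul, TensorProduct.tmul_neg]
    abel
  act_act := fun x y => by
    have h1 := fun u => LinearMap.congr_fun (X.act_act x y) u
    have h2 := fun u => LinearMap.congr_fun (Y.act_act x y) u
    have h3 := fun u => LinearMap.congr_fun (X.act_par x) u
    have h4 := fun u => LinearMap.congr_fun (X.act_par y) u
    simp only [Module.End.mul_apply, LinearMap.neg_apply] at h1 h2 h3 h4
    refine TensorProduct.ext' fun u v => ?_
    simp [h1, h2, h3, h4, TensorProduct.neg_tmul, TensorProduct.tmul_neg]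
    abel

/-- The antipode of `S(h)`, the algebra automorphism with `x ↦ -x` for `x ∈ h`.  (As `S(h)` is
super-commutative, the antipode is multiplicative, and it agrees with the parity involution.) -/
def antipode : ExteriorAlgebra ℂ V →ₗ[ℂ] ExteriorAlgebra ℂ V :=
  (ExteriorAlgebra.map (-LinearMap.id : V →ₗ[ℂ] V)).toLinearMap

variable [FiniteDimensional ℂ V]

instance : FiniteDimensional ℂ (ExteriorAlgebra ℂ V) :=
  Module.Finite.of_basis (Module.finBasis ℂ V).ExteriorAlgebra

variable (V) in
/-- `S(h)` as a super-vector space with the left regular action. -/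
abbrev reg : Rep V where
  carrier := ExteriorAlgebra ℂ V
  par := (ExteriorAlgebra.map (-LinearMap.id : V →ₗ[ℂ] V)).toLinearMap
  par_par := by
    rw [← AlgHom.comp_toLinearMap, ExteriorAlgebra.map_comp_map]
    simp
  act := LinearMap.mul ℂ (ExteriorAlgebra ℂ V) ∘ₗ ExteriorAlgebra.ι ℂ
  act_par := fun x => by ext g; simp
  act_act := fun x y => by
    have h := ExteriorAlgebra.ι_add_mul_swap (R := ℂ) x y
    refine LinearMap.ext fun g => ?_
    simp only [Module.End.mul_apply, LinearMap.comp_apply, LinearMap.mul_apply', LinearMap.neg_apply,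
      ← mul_assoc]
    rw [eq_neg_of_add_eq_zero_left h, neg_mul]

variable (V) in
/-- `S(h) ⊗ W` for a super-vector space `W`, with `S(h)` acting by left multiplication on `S(h)`. -/
abbrev SuperSpace.free (W : SuperSpace.{u}) : Rep V where
  toSuperSpace := (reg V).toSuperSpace.tensor W
  act := LinearMap.rTensorHom W.carrier ∘ₗ (reg V).act
  act_par := fun x => by
    refine TensorProduct.ext' fun g w => ?_
    simp [TensorProduct.neg_tmul]
  act_act := fun x y => by
    have h1 := fun u => LinearMap.congr_fun ((reg V).act_act x y) u
    simp only [Module.End.mul_apply, LinearMap.neg_apply] at h1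
    refine TensorProduct.ext' fun g w => ?_
    simp only [Module.End.mul_apply, LinearMap.comp_apply, LinearMap.coe_rTensorHom,
      LinearMap.rTensor_tmul, LinearMap.neg_apply, ← TensorProduct.neg_tmul]
    exact congrArg (· ⊗ₜ[ℂ] w) (h1 g)

variable (V) in
/-- The coproduct of the Hopf algebra `S(h)` in super-vector spaces.  It is the algebra map with
`Δ(x) = x ⊗ 1 + 1 ⊗ x` for `x ∈ h`, so `Δ(g) = g.(1 ⊗ 1)` in the tensor square of the regular
representation. -/
def comul : ExteriorAlgebra ℂ V →ₗ[ℂ] ExteriorAlgebra ℂ V ⊗[ℂ] ExteriorAlgebra ℂ V :=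
  LinearMap.applyₗ ((1 : ExteriorAlgebra ℂ V) ⊗ₜ[ℂ] (1 : ExteriorAlgebra ℂ V)) ∘ₗ
    ((reg V).tensor (reg V)).actS.toLinearMap

/-- The map `S(h) ⊗ U → S(h) ⊗ U`, `g ⊗ u ↦ ∑ g' ⊗ g''.u`. -/
def coact (U : Rep V) :
    ExteriorAlgebra ℂ V ⊗[ℂ] U.carrier →ₗ[ℂ] ExteriorAlgebra ℂ V ⊗[ℂ] U.carrier :=
  LinearMap.lTensor (ExteriorAlgebra ℂ V) U.actMap ∘ₗ
    (TensorProduct.assoc ℂ (ExteriorAlgebra ℂ V) (ExteriorAlgebra ℂ V) U.carrier).toLinearMap ∘ₗ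
      LinearMap.rTensor U.carrier (comul V)

/-- The map `S(h) ⊗ U → S(h) ⊗ U`, `g ⊗ u ↦ ∑ g' ⊗ S(g'').u`, with `S` the antipode. -/
def coactAntipode (U : Rep V) :
    ExteriorAlgebra ℂ V ⊗[ℂ] U.carrier →ₗ[ℂ] ExteriorAlgebra ℂ V ⊗[ℂ] U.carrier :=
  LinearMap.lTensor (ExteriorAlgebra ℂ V) (U.actMap ∘ₗ LinearMap.rTensor U.carrier antipode) ∘ₗ
    (TensorProduct.assoc ℂ (ExteriorAlgebra ℂ V) (ExteriorAlgebra ℂ V) U.carrier).toLinearMap ∘ₗ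
      LinearMap.rTensor U.carrier (comul V)

/-! ### The symplectic form, the copairing and the cointegral -/

variable (V) in
/-- A non-degenerate super-symmetric pairing on the purely odd space `h`, that is, a non-degenerate
alternating form on `V`. -/
structure SymplecticForm where
  form : LinearMap.BilinForm ℂ V
  alt : form.IsAlt
  nondeg : form.Nondegenerate

namespace SymplecticForm

variable (B : SymplecticForm V)

/-- Lagrangian subspaces: those which equal their own orthogonal complement. -/
def IsLagrangian (f : Submodule ℂ V) : Prop :=
  ∀ x, x ∈ f ↔ ∀ y ∈ f, B.form x y = 0

/-- The rescaled pairing `(-,-)_SF`, normalised such that `(-,-) = π i (-,-)_SF`. -/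
def formSF : LinearMap.BilinForm ℂ V :=
  ((Real.pi : ℂ) * Complex.I)⁻¹ • B.form

theorem formSF_nondeg : B.formSF.Nondegenerate := by
  have hc : ((Real.pi : ℂ) * Complex.I)⁻¹ ≠ 0 := by simp [Real.pi_ne_zero]
  have h := B.nondeg
  refine ⟨fun x hx => h.1 x fun y => ?_, fun y hy => h.2 y fun x => ?_⟩
  · exact (mul_eq_zero.mp (hx y)).resolve_left hc
  · exact (mul_eq_zero.mp (hy x)).resolve_left hc

/-- The basis `b_i` of `h` in the copairing `C = ∑ b_i ⊗ a_i`. -/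
def b : Module.Basis (Fin (Module.finrank ℂ V)) ℂ V := Module.finBasis ℂ V

/-- The basis `a_i` of `h` in the copairing `C = ∑ b_i ⊗ a_i`; it is determined by
`(a_i, b_j)_SF = δ_ij`.  (The copairing does not depend on the choice of the basis `b_i`.) -/
def a : Module.Basis (Fin (Module.finrank ℂ V)) ℂ V :=
  LinearMap.BilinForm.dualBasis B.formSF B.formSF_nondeg b

theorem formSF_a_b (i j : Fin (Module.finrank ℂ V)) :
    B.formSF (B.a i) (b j) = if i = j then 1 else 0 := by
  rw [a, LinearMap.BilinForm.apply_dualBasis_left]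
  simp [eq_comm]

/-- The element `Ĉ = ∑ b_i a_i` of `S(h)`. -/
def hatC : ExteriorAlgebra ℂ V :=
  ∑ i, ExteriorAlgebra.ι ℂ (b i) * ExteriorAlgebra.ι ℂ (B.a i)

/-- The action of the copairing `C = ∑ b_i ⊗ a_i` on `X ⊗ Y`, with the Koszul sign:
`u ⊗ v ↦ ∑ (-1)^|u| b_i.u ⊗ a_i.v`. -/
def actC (X Y : Rep V) : Module.End ℂ (X.carrier ⊗[ℂ] Y.carrier) :=
  ∑ i, TensorProduct.map (X.act (b i) ∘ₗ X.par) (Y.act (B.a i))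

/-- The action of `exp(t C)` on `X ⊗ Y`.  Since `C ^ (d + 1) = 0`, with `d = dim h`, the exponential
series is a finite sum.  For `t = 1` this is the action of `γ = exp(C)`. -/
def expC (t : ℂ) (X Y : Rep V) : Module.End ℂ (X.carrier ⊗[ℂ] Y.carrier) :=
  ∑ k ∈ Finset.range (Module.finrank ℂ V + 1), (t ^ k / (Nat.factorial k : ℂ)) • B.actC X Y ^ k

/-- The element `exp(t Ĉ)` of `S(h)`; again `Ĉ ^ (d + 1) = 0`.  For `t = 1/2` this is `σ`. -/
def expHatC (t : ℂ) : ExteriorAlgebra ℂ V :=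
  ∑ k ∈ Finset.range (Module.finrank ℂ V + 1), (t ^ k / (Nat.factorial k : ℂ)) • B.hatC ^ k

variable (V) in
/-- A non-zero linear form on `S(h)` which vanishes outside of the top degree `d = dim h`, where it
takes `x_1 ⋯ x_d` to the determinant of the `x_j` in a fixed basis. -/
def topForm : ExteriorAlgebra ℂ V →ₗ[ℂ] ℂ :=
  ExteriorAlgebra.liftAlternating
    (Pi.single (M := fun k => V [⋀^Fin k]→ₗ[ℂ] ℂ) (Module.finrank ℂ V) (b (V := V)).det)

/-- The cointegral `λ` on `S(h)`: it is non-zero only in the top degree, and it is normalised such that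
`λ(Ĉ ^ (d/2)) = 2 ^ (d/2) (d/2)!`. -/
def cointegral : ExteriorAlgebra ℂ V →ₗ[ℂ] ℂ :=
  ((2 : ℂ) ^ (Module.finrank ℂ V / 2) * (Nat.factorial (Module.finrank ℂ V / 2) : ℂ)
    / topForm V (B.hatC ^ (Module.finrank ℂ V / 2))) • topForm V

/-- The map `φ = β² (id ⊗ (λ ∘ μ_S)) ∘ (γ⁻¹ ⊗ id) : S(h) → S(h)`, that is,
`φ(g) = β² (id ⊗ λ)(γ⁻¹.(1 ⊗ g))`. -/
def phi (β : ℂ) : ExteriorAlgebra ℂ V →ₗ[ℂ] ExteriorAlgebra ℂ V :=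
  β ^ 2 • ((TensorProduct.rid ℂ (ExteriorAlgebra ℂ V)).toLinearMap ∘ₗ
    LinearMap.lTensor (ExteriorAlgebra ℂ V) B.cointegral ∘ₗ
      B.expC (-1) (reg V) (reg V) ∘ₗ TensorProduct.mk ℂ (ExteriorAlgebra ℂ V) (ExteriorAlgebra ℂ V) 1)

end SymplecticForm

/-! ### Associator and braiding, sector by sector

The tensor product of sectors is `X ⊗ Y` for the sectors `00`, `01`, `10`, and `S(h) ⊗ (X ⊗ Y)` for the
sector `11`.  The associators go from `X * (Y * Z)` to `(X * Y) * Z`.  They are trivial in the sectors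
`000`, `001` and `100`. -/

section sectors

variable (B : SymplecticForm V) (β : ℂ)

/-- The symmetric associator of vector spaces, `X ⊗ (Y ⊗ Z) → (X ⊗ Y) ⊗ Z`. -/
abbrev vassoc (X Y Z : Type u) [AddCommGroup X] [Module ℂ X] [AddCommGroup Y] [Module ℂ Y]
    [AddCommGroup Z] [Module ℂ Z] : X ⊗[ℂ] (Y ⊗[ℂ] Z) →ₗ[ℂ] (X ⊗[ℂ] Y) ⊗[ℂ] Z :=
  (TensorProduct.assoc ℂ X Y Z).symm.toLinearMap

/-- The symmetric associator of vector spaces in the other direction. -/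
abbrev vassoc' (X Y Z : Type u) [AddCommGroup X] [Module ℂ X] [AddCommGroup Y] [Module ℂ Y]
    [AddCommGroup Z] [Module ℂ Z] : (X ⊗[ℂ] Y) ⊗[ℂ] Z →ₗ[ℂ] X ⊗[ℂ] (Y ⊗[ℂ] Z) :=
  (TensorProduct.assoc ℂ X Y Z).toLinearMap

/-- Sector `010`: `γ` acts on the first and the third factor. -/
def assoc010 (X : Rep V) (Y : SuperSpace.{u}) (Z : Rep V) :
    X.carrier ⊗[ℂ] (Y.carrier ⊗[ℂ] Z.carrier) →ₗ[ℂ] (X.carrier ⊗[ℂ] Y.carrier) ⊗[ℂ] Z.carrier :=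
  vassoc X.carrier Y.carrier Z.carrier ∘ₗ
  LinearMap.lTensor X.carrier (SuperSpace.swap Z.toSuperSpace Y) ∘ₗ
  vassoc' X.carrier Z.carrier Y.carrier ∘ₗ
  LinearMap.rTensor Y.carrier (B.expC 1 X Z) ∘ₗ
  vassoc X.carrier Z.carrier Y.carrier ∘ₗ
  LinearMap.lTensor X.carrier (SuperSpace.swap Y Z.toSuperSpace)

/-- Sector `011`: `x ⊗ g ⊗ y ⊗ z ↦ ∑ ± g' ⊗ S(g'').x ⊗ y ⊗ z`. -/
def assoc011 (X : Rep V) (Y Z : SuperSpace.{u}) :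
    X.carrier ⊗[ℂ] (ExteriorAlgebra ℂ V ⊗[ℂ] (Y.carrier ⊗[ℂ] Z.carrier)) →ₗ[ℂ]
      ExteriorAlgebra ℂ V ⊗[ℂ] ((X.carrier ⊗[ℂ] Y.carrier) ⊗[ℂ] Z.carrier) :=
  LinearMap.lTensor (ExteriorAlgebra ℂ V) (vassoc X.carrier Y.carrier Z.carrier) ∘ₗ
  vassoc' (ExteriorAlgebra ℂ V) X.carrier (Y.carrier ⊗[ℂ] Z.carrier) ∘ₗ
  LinearMap.rTensor (Y.carrier ⊗[ℂ] Z.carrier)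
    (coactAntipode X ∘ₗ SuperSpace.swap X.toSuperSpace (reg V).toSuperSpace) ∘ₗ
  vassoc X.carrier (ExteriorAlgebra ℂ V) (Y.carrier ⊗[ℂ] Z.carrier)

/-- Sector `101`: `γ` acts on `S(h)` and on the middle factor. -/
def assoc101 (X : SuperSpace.{u}) (Y : Rep V) (Z : SuperSpace.{u}) :
    ExteriorAlgebra ℂ V ⊗[ℂ] (X.carrier ⊗[ℂ] (Y.carrier ⊗[ℂ] Z.carrier)) →ₗ[ℂ]
      ExteriorAlgebra ℂ V ⊗[ℂ] ((X.carrier ⊗[ℂ] Y.carrier) ⊗[ℂ] Z.carrier) :=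
  LinearMap.lTensor (ExteriorAlgebra ℂ V)
    (LinearMap.rTensor Z.carrier (SuperSpace.swap Y.toSuperSpace X) ∘ₗ
      vassoc Y.carrier X.carrier Z.carrier) ∘ₗ
  vassoc' (ExteriorAlgebra ℂ V) Y.carrier (X.carrier ⊗[ℂ] Z.carrier) ∘ₗ
  LinearMap.rTensor (X.carrier ⊗[ℂ] Z.carrier) (B.expC 1 (reg V) Y) ∘ₗ
  vassoc (ExteriorAlgebra ℂ V) Y.carrier (X.carrier ⊗[ℂ] Z.carrier) ∘ₗ
  LinearMap.lTensor (ExteriorAlgebra ℂ V)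
    (vassoc' Y.carrier X.carrier Z.carrier ∘ₗ
      LinearMap.rTensor Z.carrier (SuperSpace.swap X Y.toSuperSpace) ∘ₗ
      vassoc X.carrier Y.carrier Z.carrier)

/-- Sector `110`: `g ⊗ x ⊗ y ⊗ z ↦ ∑ ± g' ⊗ x ⊗ y ⊗ g''.z`. -/
def assoc110 (X Y : SuperSpace.{u}) (Z : Rep V) :
    ExteriorAlgebra ℂ V ⊗[ℂ] (X.carrier ⊗[ℂ] (Y.carrier ⊗[ℂ] Z.carrier)) →ₗ[ℂ]
      (ExteriorAlgebra ℂ V ⊗[ℂ] (X.carrier ⊗[ℂ] Y.carrier)) ⊗[ℂ] Z.carrier :=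
  vassoc (ExteriorAlgebra ℂ V) (X.carrier ⊗[ℂ] Y.carrier) Z.carrier ∘ₗ
  LinearMap.lTensor (ExteriorAlgebra ℂ V) (SuperSpace.swap Z.toSuperSpace (X.tensor Y)) ∘ₗ
  vassoc' (ExteriorAlgebra ℂ V) Z.carrier (X.carrier ⊗[ℂ] Y.carrier) ∘ₗ
  LinearMap.rTensor (X.carrier ⊗[ℂ] Y.carrier) (coact Z) ∘ₗ
  vassoc (ExteriorAlgebra ℂ V) Z.carrier (X.carrier ⊗[ℂ] Y.carrier) ∘ₗ
  LinearMap.lTensor (ExteriorAlgebra ℂ V)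
    (SuperSpace.swap (X.tensor Y) Z.toSuperSpace ∘ₗ vassoc X.carrier Y.carrier Z.carrier)

/-- Sector `111`: `x ⊗ g ⊗ y ⊗ z ↦ ± φ(g) ⊗ x ⊗ y ⊗ z`. -/
def assoc111 (X Y Z : SuperSpace.{u}) :
    X.carrier ⊗[ℂ] (ExteriorAlgebra ℂ V ⊗[ℂ] (Y.carrier ⊗[ℂ] Z.carrier)) →ₗ[ℂ]
      (ExteriorAlgebra ℂ V ⊗[ℂ] (X.carrier ⊗[ℂ] Y.carrier)) ⊗[ℂ] Z.carrier :=
  vassoc (ExteriorAlgebra ℂ V) (X.carrier ⊗[ℂ] Y.carrier) Z.carrier ∘ₗ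
  LinearMap.lTensor (ExteriorAlgebra ℂ V) (vassoc X.carrier Y.carrier Z.carrier) ∘ₗ
  vassoc' (ExteriorAlgebra ℂ V) X.carrier (Y.carrier ⊗[ℂ] Z.carrier) ∘ₗ
  LinearMap.rTensor (Y.carrier ⊗[ℂ] Z.carrier)
    (LinearMap.rTensor X.carrier (B.phi β) ∘ₗ SuperSpace.swap X (reg V).toSuperSpace) ∘ₗ
  vassoc X.carrier (ExteriorAlgebra ℂ V) (Y.carrier ⊗[ℂ] Z.carrier)

/-- The braiding in sector `00`: the action of `γ⁻¹`, followed by the symmetric braiding. -/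
def braid00 (X Y : Rep V) : X.carrier ⊗[ℂ] Y.carrier →ₗ[ℂ] Y.carrier ⊗[ℂ] X.carrier :=
  SuperSpace.swap X.toSuperSpace Y.toSuperSpace ∘ₗ B.expC (-1) X Y

/-- The braiding in sector `01`: the action of `σ` on `X`, followed by the symmetric braiding. -/
def braid01 (X : Rep V) (Y : SuperSpace.{u}) :
    X.carrier ⊗[ℂ] Y.carrier →ₗ[ℂ] Y.carrier ⊗[ℂ] X.carrier :=
  SuperSpace.swap X.toSuperSpace Y ∘ₗ
    LinearMap.rTensor Y.carrier (X.actS (B.expHatC (1 / 2)))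

/-- The braiding in sector `10`: the parity involution of `Y` and the action of `σ` on `Y`, followed by
the symmetric braiding. -/
def braid10 (X : SuperSpace.{u}) (Y : Rep V) :
    X.carrier ⊗[ℂ] Y.carrier →ₗ[ℂ] Y.carrier ⊗[ℂ] X.carrier :=
  SuperSpace.swap X Y.toSuperSpace ∘ₗ
    LinearMap.lTensor X.carrier (Y.actS (B.expHatC (1 / 2)) ∘ₗ Y.par)

/-- The braiding in sector `11`: multiplication by `β` and by `σ⁻¹` on `S(h)`, the parity involution of
`Y`, and the symmetric braiding of `X` and `Y`. -/
def braid11 (X Y : SuperSpace.{u}) :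
    ExteriorAlgebra ℂ V ⊗[ℂ] (X.carrier ⊗[ℂ] Y.carrier) →ₗ[ℂ]
      ExteriorAlgebra ℂ V ⊗[ℂ] (Y.carrier ⊗[ℂ] X.carrier) :=
  β • TensorProduct.map (LinearMap.mulLeft ℂ (B.expHatC (-1 / 2)))
    (SuperSpace.swap X Y ∘ₗ LinearMap.lTensor X.carrier Y.par)

end sectors

/-! ### The category `SF(h)` -/

variable (V) in
/-- An object of `SF(h) = SF_0(h) ⊕ SF_1(h)`, where `SF_0(h)` are the representations of `h` in
super-vector spaces and `SF_1(h)` are super-vector spaces. -/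
structure Obj where
  s0 : Rep V
  s1 : SuperSpace.{u}

/-- A pair of linear maps between the underlying spaces of two objects. -/
@[ext]
structure GMap (X Y : Obj V) where
  f0 : X.s0.carrier →ₗ[ℂ] Y.s0.carrier
  f1 : X.s1.carrier →ₗ[ℂ] Y.s1.carrier

/-- Morphisms of `SF(h)`: both components are parity-even, and the first is `h`-equivariant. -/
structure GMap.IsMor {X Y : Obj V} (f : GMap X Y) : Prop where
  even0 : f.f0 ∘ₗ X.s0.par = Y.s0.par ∘ₗ f.f0
  even1 : f.f1 ∘ₗ X.s1.par = Y.s1.par ∘ₗ f.f1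
  equivariant : ∀ x : V, f.f0 ∘ₗ X.s0.act x = Y.s0.act x ∘ₗ f.f0

/-- Identity morphisms. -/
def GMap.id (X : Obj V) : GMap X X := ⟨LinearMap.id, LinearMap.id⟩

/-- Composition, `g.comp f = g ∘ f`. -/
def GMap.comp {X Y Z : Obj V} (g : GMap Y Z) (f : GMap X Y) : GMap X Z :=
  ⟨g.f0 ∘ₗ f.f0, g.f1 ∘ₗ f.f1⟩

/-- The tensor product `X * Y` of `SF(h)`. -/
abbrev Obj.tensor (X Y : Obj V) : Obj V where
  s0 := (X.s0.tensor Y.s0).sum ((X.s1.tensor Y.s1).free V)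
  s1 := (X.s0.toSuperSpace.tensor Y.s1).sum (X.s1.tensor Y.s0.toSuperSpace)

/-- The tensor product `f * g` of morphisms of `SF(h)`. -/
def GMap.tensor {X X' Y Y' : Obj V} (f : GMap X X') (g : GMap Y Y') :
    GMap (X.tensor Y) (X'.tensor Y') where
  f0 := (TensorProduct.map f.f0 g.f0).prodMap
    (LinearMap.lTensor (ExteriorAlgebra ℂ V) (TensorProduct.map f.f1 g.f1))
  f1 := (TensorProduct.map f.f0 g.f1).prodMap (TensorProduct.map f.f1 g.f0)

theorem GMap.tensor_id (X Y : Obj V) :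
    (GMap.id X).tensor (GMap.id Y) = GMap.id (X.tensor Y) := by
  ext x <;> simp [GMap.tensor, GMap.id]

theorem GMap.tensor_comp {X X' X'' Y Y' Y'' : Obj V} (f : GMap X X') (f' : GMap X' X'')
    (g : GMap Y Y') (g' : GMap Y' Y'') :
    (f'.comp f).tensor (g'.comp g) = (f'.tensor g').comp (f.tensor g) := by
  unfold GMap.tensor GMap.comp
  simp only [TensorProduct.map_comp, LinearMap.lTensor_comp, GMap.mk.injEq]
  exact ⟨rfl, rfl⟩

theorem GMap.IsMor.id (X : Obj V) : (GMap.id X).IsMor := ⟨rfl, rfl, fun _ => rfl⟩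

theorem GMap.IsMor.comp {X Y Z : Obj V} {g : GMap Y Z} {f : GMap X Y} (hg : g.IsMor)
    (hf : f.IsMor) : (g.comp f).IsMor where
  even0 := by
    change g.f0 ∘ₗ (f.f0 ∘ₗ _) = _
    rw [hf.even0, ← LinearMap.comp_assoc, hg.even0]; rfl
  even1 := by
    change g.f1 ∘ₗ (f.f1 ∘ₗ _) = _
    rw [hf.even1, ← LinearMap.comp_assoc, hg.even1]; rfl
  equivariant := fun x => by
    change g.f0 ∘ₗ (f.f0 ∘ₗ _) = _
    rw [hf.equivariant, ← LinearMap.comp_assoc, hg.equivariant]; rfl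

variable (V) in
/-- The object of `SF_0(h)` given by a super-vector space with trivial action. -/
abbrev Obj.inl (X : SuperSpace.{u}) : Obj V := ⟨X.triv, SuperSpace.zero⟩

variable (V) in
/-- The object of `SF_1(h)` given by a super-vector space. -/
abbrev Obj.inr (X : SuperSpace.{u}) : Obj V := ⟨SuperSpace.zero.triv, X⟩

variable (V) in
/-- The tensor unit `1`, the trivial representation on `ℂ^{1|0}` in `SF_0(h)`. -/
abbrev Obj.one : Obj V := Obj.inl V SuperSpace.evenLine

variable (V) in
/-- The simple object `Π1`, the trivial representation on `ℂ^{0|1}` in `SF_0(h)`. -/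
abbrev Obj.piOne : Obj V := Obj.inl V SuperSpace.oddLine

variable (V) in
/-- The simple object `T = ℂ^{1|0}` of `SF_1(h)`. -/
abbrev Obj.T : Obj V := Obj.inr V SuperSpace.evenLine

/-- The left unit constraint `1 * X → X`. -/
def leftUnitor (X : Obj V) : GMap ((Obj.one V).tensor X) X where
  f0 := (TensorProduct.lid ℂ X.s0.carrier).toLinearMap ∘ₗ
    LinearMap.rTensor X.s0.carrier ULift.moduleEquiv.toLinearMap ∘ₗ LinearMap.fst ℂ _ _
  f1 := (TensorProduct.lid ℂ X.s1.carrier).toLinearMap ∘ₗ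
    LinearMap.rTensor X.s1.carrier ULift.moduleEquiv.toLinearMap ∘ₗ LinearMap.fst ℂ _ _

/-- The right unit constraint `X * 1 → X`. -/
def rightUnitor (X : Obj V) : GMap (X.tensor (Obj.one V)) X where
  f0 := (TensorProduct.rid ℂ X.s0.carrier).toLinearMap ∘ₗ
    LinearMap.lTensor X.s0.carrier ULift.moduleEquiv.toLinearMap ∘ₗ LinearMap.fst ℂ _ _
  f1 := (TensorProduct.rid ℂ X.s1.carrier).toLinearMap ∘ₗ
    LinearMap.lTensor X.s1.carrier ULift.moduleEquiv.toLinearMap ∘ₗ LinearMap.snd ℂ _ _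

section structureMaps

variable (B : SymplecticForm V) (β : ℂ)

/-- The associator `X * (Y * Z) → (X * Y) * Z` of `SF(h)`: the sum of its eight sector components. -/
def associator (X Y Z : Obj V) :
    GMap (X.tensor (Y.tensor Z)) ((X.tensor Y).tensor Z) where
  f0 :=
    LinearMap.inl ℂ _ _ ∘ₗ LinearMap.rTensor Z.s0.carrier (LinearMap.inl ℂ _ _) ∘ₗ
      vassoc X.s0.carrier Y.s0.carrier Z.s0.carrier ∘ₗ
        LinearMap.lTensor X.s0.carrier (LinearMap.fst ℂ _ _) ∘ₗ LinearMap.fst ℂ _ _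
    + LinearMap.inr ℂ _ _ ∘ₗ
      LinearMap.lTensor (ExteriorAlgebra ℂ V)
        (LinearMap.rTensor Z.s1.carrier (LinearMap.inl ℂ _ _)) ∘ₗ
        assoc011 X.s0 Y.s1 Z.s1 ∘ₗ
          LinearMap.lTensor X.s0.carrier (LinearMap.snd ℂ _ _) ∘ₗ LinearMap.fst ℂ _ _
    + LinearMap.inr ℂ _ _ ∘ₗ
      LinearMap.lTensor (ExteriorAlgebra ℂ V)
        (LinearMap.rTensor Z.s1.carrier (LinearMap.inr ℂ _ _)) ∘ₗ
        assoc101 B X.s1 Y.s0 Z.s1 ∘ₗ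
          LinearMap.lTensor (ExteriorAlgebra ℂ V)
            (LinearMap.lTensor X.s1.carrier (LinearMap.fst ℂ _ _)) ∘ₗ LinearMap.snd ℂ _ _
    + LinearMap.inl ℂ _ _ ∘ₗ LinearMap.rTensor Z.s0.carrier (LinearMap.inr ℂ _ _) ∘ₗ
      assoc110 X.s1 Y.s1 Z.s0 ∘ₗ
        LinearMap.lTensor (ExteriorAlgebra ℂ V)
          (LinearMap.lTensor X.s1.carrier (LinearMap.snd ℂ _ _)) ∘ₗ LinearMap.snd ℂ _ _
  f1 :=
    LinearMap.inl ℂ _ _ ∘ₗ LinearMap.rTensor Z.s1.carrier (LinearMap.inl ℂ _ _) ∘ₗ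
      vassoc X.s0.carrier Y.s0.carrier Z.s1.carrier ∘ₗ
        LinearMap.lTensor X.s0.carrier (LinearMap.fst ℂ _ _) ∘ₗ LinearMap.fst ℂ _ _
    + LinearMap.inr ℂ _ _ ∘ₗ LinearMap.rTensor Z.s0.carrier (LinearMap.inl ℂ _ _) ∘ₗ
      assoc010 B X.s0 Y.s1 Z.s0 ∘ₗ
        LinearMap.lTensor X.s0.carrier (LinearMap.snd ℂ _ _) ∘ₗ LinearMap.fst ℂ _ _
    + LinearMap.inr ℂ _ _ ∘ₗ LinearMap.rTensor Z.s0.carrier (LinearMap.inr ℂ _ _) ∘ₗ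
      vassoc X.s1.carrier Y.s0.carrier Z.s0.carrier ∘ₗ
        LinearMap.lTensor X.s1.carrier (LinearMap.fst ℂ _ _) ∘ₗ LinearMap.snd ℂ _ _
    + LinearMap.inl ℂ _ _ ∘ₗ LinearMap.rTensor Z.s1.carrier (LinearMap.inr ℂ _ _) ∘ₗ
      assoc111 B β X.s1 Y.s1 Z.s1 ∘ₗ
        LinearMap.lTensor X.s1.carrier (LinearMap.snd ℂ _ _) ∘ₗ LinearMap.snd ℂ _ _

/-- The braiding `X * Y → Y * X` of `SF(h)`. -/
def braiding (X Y : Obj V) : GMap (X.tensor Y) (Y.tensor X) where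
  f0 := (braid00 B X.s0 Y.s0).prodMap (braid11 B β X.s1 Y.s1)
  f1 := (braid10 B X.s1 Y.s0 ∘ₗ LinearMap.snd ℂ _ _).prod
    (braid01 B X.s0 Y.s1 ∘ₗ LinearMap.fst ℂ _ _)

/-- The ribbon twist `X → X` of `SF(h)`: the action of `σ⁻²` on `SF_0(h)`, and `β⁻¹` times the parity
involution on `SF_1(h)`. -/
def twist (X : Obj V) : GMap X X where
  f0 := X.s0.actS (B.expHatC (-1))
  f1 := β⁻¹ • X.s1.par

/-! ### Algebras in `SF(h)` -/

/-- A (unital, associative) algebra in `SF(h)`. -/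
structure Alg where
  obj : Obj V
  mul : GMap (obj.tensor obj) obj
  mul_mor : mul.IsMor
  unit : GMap (Obj.one V) obj
  unit_mor : unit.IsMor
  mul_assoc : mul.comp ((GMap.id obj).tensor mul)
    = (mul.comp (mul.tensor (GMap.id obj))).comp (associator B β obj obj obj)
  mul_unit : mul.comp ((GMap.id obj).tensor unit) = rightUnitor obj
  unit_mul : mul.comp (unit.tensor (GMap.id obj)) = leftUnitor obj

variable {B β}

/-- Isomorphism of algebras: an invertible morphism compatible with multiplication and unit. -/
def Alg.Iso (H K : Alg B β) : Prop :=
  ∃ (f : GMap H.obj K.obj) (g : GMap K.obj H.obj), f.IsMor ∧ g.IsMor ∧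
    g.comp f = GMap.id H.obj ∧ f.comp g = GMap.id K.obj ∧
    f.comp H.mul = K.mul.comp (f.tensor f) ∧ f.comp H.unit = K.unit

theorem Alg.iso_refl (H : Alg B β) : H.Iso H :=
  ⟨GMap.id _, GMap.id _, GMap.IsMor.id _, GMap.IsMor.id _, rfl, rfl,
    by rw [GMap.tensor_id]; rfl, rfl⟩

theorem Alg.Iso.symm {H K : Alg B β} : H.Iso K → K.Iso H := by
  rintro ⟨f, g, hf, hg, hgf, hfg, hm, hu⟩
  refine ⟨g, f, hg, hf, hfg, hgf, ?_, ?_⟩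
  · calc g.comp K.mul = g.comp (K.mul.comp ((f.comp g).tensor (f.comp g))) := by
          rw [hfg, GMap.tensor_id]; rfl
      _ = g.comp ((K.mul.comp (f.tensor f)).comp (g.tensor g)) := by
          rw [GMap.tensor_comp]; rfl
      _ = (g.comp f).comp (H.mul.comp (g.tensor g)) := by rw [← hm]; rfl
      _ = H.mul.comp (g.tensor g) := by rw [hgf]; rfl
  · calc g.comp K.unit = (g.comp f).comp H.unit := by rw [← hu]; rfl
      _ = H.unit := by rw [hgf]; rfl

theorem Alg.Iso.trans {H K L : Alg B β} : H.Iso K → K.Iso L → H.Iso L := by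
  rintro ⟨f, g, hf, hg, hgf, hfg, hm, hu⟩ ⟨f', g', hf', hg', hgf', hfg', hm', hu'⟩
  refine ⟨f'.comp f, g.comp g', hf'.comp hf, hg.comp hg', ?_, ?_, ?_, ?_⟩
  · calc (g.comp g').comp (f'.comp f) = g.comp ((g'.comp f').comp f) := rfl
      _ = GMap.id _ := by rw [hgf']; exact hgf
  · calc (f'.comp f).comp (g.comp g') = f'.comp ((f.comp g).comp g') := rfl
      _ = GMap.id _ := by rw [hfg]; exact hfg'
  · calc (f'.comp f).comp H.mul = f'.comp (K.mul.comp (f.tensor f)) := by rw [← hm]; rfl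
      _ = (f'.comp K.mul).comp (f.tensor f) := rfl
      _ = L.mul.comp ((f'.comp f).tensor (f'.comp f)) := by
          rw [hm', GMap.tensor_comp]; rfl
  · calc (f'.comp f).comp H.unit = f'.comp K.unit := by rw [← hu]; rfl
      _ = L.unit := hu'

variable (B β) in
/-- A pairing `p : X * X → 1` is non-degenerate if there is a copairing `c : 1 → X * X` such that
`(p * id) ∘ α ∘ (id * c) = id = (id * p) ∘ α⁻¹ ∘ (c * id)`, up to the unit constraints. -/
def IsNondegeneratePairing (X : Obj V) (p : GMap (X.tensor X) (Obj.one V)) : Prop :=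
  p.IsMor ∧ ∃ c : GMap (Obj.one V) (X.tensor X), c.IsMor ∧
    (leftUnitor X).comp ((p.tensor (GMap.id X)).comp
      ((associator B β X X X).comp ((GMap.id X).tensor c))) = rightUnitor X ∧
    ∃ αinv : GMap ((X.tensor X).tensor X) (X.tensor (X.tensor X)),
      αinv.comp (associator B β X X X) = GMap.id _ ∧
      (associator B β X X X).comp αinv = GMap.id _ ∧
      (rightUnitor X).comp (((GMap.id X).tensor p).comp
        (αinv.comp (c.tensor (GMap.id X)))) = leftUnitor X

/-- `(N0, N1)` is a submodule of `H`, seen as a left module over itself: a subobject in `SF(h)` such that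
the multiplication maps `H * N` to `N`. -/
structure Alg.IsSubmodule (H : Alg B β) (N0 : Submodule ℂ H.obj.s0.carrier)
    (N1 : Submodule ℂ H.obj.s1.carrier) : Prop where
  par0 : ∀ n ∈ N0, H.obj.s0.par n ∈ N0
  par1 : ∀ n ∈ N1, H.obj.s1.par n ∈ N1
  act : ∀ (x : V), ∀ n ∈ N0, H.obj.s0.act x n ∈ N0
  mul00 : ∀ l, ∀ n ∈ N0, H.mul.f0 (l ⊗ₜ[ℂ] n, 0) ∈ N0
  mul11 : ∀ g e, ∀ n ∈ N1, H.mul.f0 (0, g ⊗ₜ[ℂ] (e ⊗ₜ[ℂ] n)) ∈ N0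
  mul01 : ∀ l, ∀ n ∈ N1, H.mul.f1 (l ⊗ₜ[ℂ] n, 0) ∈ N1
  mul10 : ∀ e, ∀ n ∈ N0, H.mul.f1 (0, e ⊗ₜ[ℂ] n) ∈ N1

/-- `H` is simple as a left module over itself. -/
def Alg.IsSimple (H : Alg B β) : Prop :=
  (Nontrivial H.obj.s0.carrier ∨ Nontrivial H.obj.s1.carrier) ∧
    ∀ N0 N1, H.IsSubmodule N0 N1 → (N0 = ⊥ ∧ N1 = ⊥) ∨ (N0 = ⊤ ∧ N1 = ⊤)

/-- The five conditions: non-zero twisted part, trivial twist, commutative, Frobenius, and simple as a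
left module over itself. -/
structure Alg.IsGood (H : Alg B β) : Prop where
  twisted : Nontrivial H.obj.s1.carrier
  trivial_twist : twist B β H.obj = GMap.id H.obj
  commutative : H.mul.comp (braiding B β H.obj H.obj) = H.mul
  frobenius : ∃ κ : GMap H.obj (Obj.one V), κ.IsMor ∧
    IsNondegeneratePairing B β H.obj (κ.comp H.mul)
  simple : H.IsSimple

variable (B β) in
/-- Isomorphism of algebras satisfying the five conditions, as an equivalence relation. -/
def goodSetoid : Setoid {H : Alg B β // H.IsGood} where
  r H K := H.1.Iso K.1
  iseqv :=
    { refl := fun H => H.1.iso_refl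
      symm := Alg.Iso.symm
      trans := Alg.Iso.trans }

end structureMaps

/-- The annihilator in `h` of a representation. -/
def Rep.ann (X : Rep V) : Submodule ℂ V := LinearMap.ker X.act

/-! ### The Grothendieck group -/

/-- A short exact sequence `0 → X → Y → Z → 0` in `SF(h)`. -/
structure IsShortExact {X Y Z : Obj V} (f : GMap X Y) (g : GMap Y Z) : Prop where
  mor_f : f.IsMor
  mor_g : g.IsMor
  inj0 : Function.Injective f.f0
  inj1 : Function.Injective f.f1
  exact0 : Function.Exact f.f0 g.f0
  exact1 : Function.Exact f.f1 g.f1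
  surj0 : Function.Surjective g.f0
  surj1 : Function.Surjective g.f1

variable (V) in
/-- The Grothendieck group of `SF(h)`: generated by the objects, with a relation `[Y] = [X] + [Z]` for
each short exact sequence `0 → X → Y → Z → 0`. -/
abbrev K0 : Type (u + 1) :=
  FreeAbelianGroup (Obj V) ⧸ AddSubgroup.closure {r : FreeAbelianGroup (Obj V) |
    ∃ (X Y Z : Obj V) (f : GMap X Y) (g : GMap Y Z), IsShortExact f g ∧
      r = FreeAbelianGroup.of Y - FreeAbelianGroup.of X - FreeAbelianGroup.of Z}

/-- The class of an object in the Grothendieck group. -/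
def Obj.cls (X : Obj V) : K0 V := QuotientAddGroup.mk (FreeAbelianGroup.of X)

end SF

end

set_option linter.unusedSectionVars false
set_option linter.unusedSimpArgs false

noncomputable section
namespace SF
universe u

/-! ### The exterior algebra: parity, contractions, products of vectors -/

section exterior

variable {W : Type*} [AddCommGroup W] [Module ℂ W]

local notation "Λ" => ExteriorAlgebra ℂ W
local notation "ι" => ExteriorAlgebra.ι ℂ
local notation "ε" => ExteriorAlgebra.algebraMapInv

/-! Rigidity. Triviality of the twist says that parity acts on `H_1` as the scalar `β`, so `β = ±1`,
and that `exp(-Ĉ)`, hence the nilpotent `Ĉ` itself, acts trivially on `H_0`. Commutativity in the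
mixed sectors then makes the left and right actions of `H_0` on `H_1` agree and ignore parity.
Conjugating sector 00 by the parity of one factor turns `exp(-C)` into `exp(C)`; as `C` is
nilpotent, it is killed after acting on `H_1`, and the operators of `H_0` on `H_1` commute
(`m01_comm_and`). Every `H_0`-stable subspace of `H_1` is the twisted part of a submodule
(`isSubmodule`), so by simplicity an eigenspace of any such operator is everything. Thus `H_1 = ℂ
t`, `H_0` acts on it through a character `χ`, and `H_0 = S.(t t)` (`exists_split`). If `β = -1`,
commutativity in sector 11 gives `t t = -t t`, so `H_0 = 0`, which is impossible for a unital
algebra with `H_1 ≠ 0` (`beta_eq_one`).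

Now let `β = 1`. All of `H` is encoded in the linear form `F(g) = χ(g.(t t))` on `S`. Associativity
in sector 111 reads `F ∘ φ = F`. The map `φ` is a Fourier transform: up to sign it exchanges
multiplication by `w` and contraction with `(w,-)_SF` (`phi_ι_mul`, `phi_contract`). Hence `F`
vanishes on products with, and on contractions by, the annihilator `f` of `H_0`. By simplicity the
kernel of `χ` contains no non-zero `h`-stable subspace stable under parity, and with the vanishing
of `C` this shows that `f` is Lagrangian (`isLagrangian_ann`). For a given `f` the conditions on `F`
leave a one-dimensional space of linear forms (`Adapted.eq_zero`), and rescaling `t` moves between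
its non-zero elements. Since `F` determines `H` (`Split.isom`), algebras with the same annihilator
are isomorphic.

Existence. For a Lagrangian `f` take `H_0` to be the exterior algebra of `f`, with `v` acting by
contraction with the restriction of `(v,-)_SF`, and `H_1 = ℂ t` with `t t = s` a top-degree element;
`H_0` acts on `H_1` by the augmentation and the Frobenius form is the top form. The axioms are
isolated in `Datum`; the delicate one, invariance of `F` under `φ`, follows from the uniqueness of
`F`, because `φ` fixes the product of a complementary isotropic basis (`phi_wedge`). The copairing
needs `φ` to exchange `1` and the top element of `S`; this and the evenness of `s` hold because
`(-1)^(d/2) = β^4 = 1` makes `dim f` even.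

The class. A representation is filtered by invariant lines, so its class is determined by its
dimension and the trace of parity (`Rep.exists_cls_eq`). For the exterior algebra of `f ≠ 0` the
dimension is `2^(d/2)` and the trace vanishes. -/

theorem ext_induction {P : Λ → Prop} (h1 : P 1) (hs : ∀ (c : ℂ) x, P x → P (c • x))
    (ha : ∀ x y, P x → P y → P (x + y)) (hm : ∀ (v : W) x, P x → P (ι v * x)) (g : Λ) : P g :=
  CliffordAlgebra.left_induction (P := P) (0 : QuadraticForm ℂ W)
    (fun r => by rw [Algebra.algebraMap_eq_smul_one]; exact hs r 1 h1)
    (fun x y hx hy => ha x y hx hy) (fun x v hx => hm v x hx) g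

/-- The parity involution of the exterior algebra. -/
def invol : Λ →ₐ[ℂ] Λ := ExteriorAlgebra.map (-LinearMap.id : W →ₗ[ℂ] W)

@[simp] theorem invol_ι (v : W) : invol (ι v) = -ι v := by simp [invol]

theorem invol_ι_mul (v : W) (g : Λ) : invol (ι v * g) = -(ι v * invol g) := by simp

@[simp] theorem invol_invol (g : Λ) : invol (invol g) = g := by
  have : (invol.comp invol : Λ →ₐ[ℂ] Λ) = AlgHom.id ℂ _ := by ext v; simp
  exact DFunLike.congr_fun this g

@[simp] theorem counit_ι (v : W) : ε (ι v) = (0 : ℂ) := by simp [ExteriorAlgebra.algebraMapInv]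

theorem counit_ι_mul (v : W) (g : Λ) : ε (ι v * g) = (0 : ℂ) := by simp

@[simp] theorem counit_invol (g : Λ) : ε (invol g) = (ε g : ℂ) := by
  have : (ε : Λ →ₐ[ℂ] ℂ).comp invol = ε := by ext v; simp
  exact DFunLike.congr_fun this g

theorem ι_mul_ι (v w : W) : ι v * ι w = -(ι w * ι v) :=
  eq_neg_of_add_eq_zero_left (ExteriorAlgebra.ι_add_mul_swap v w)

theorem ι_mul_ι_mul (v w : W) (g : Λ) : ι v * (ι w * g) = -(ι w * (ι v * g)) := by
  rw [← mul_assoc, ι_mul_ι, neg_mul, mul_assoc]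

theorem ι_mul_self_mul (v : W) (g : Λ) : ι v * (ι v * g) = 0 := by
  rw [← mul_assoc, ExteriorAlgebra.ι_sq_zero, zero_mul]

theorem mul_ι (g : Λ) (v : W) : g * ι v = ι v * invol g := by
  induction g using ext_induction with
  | h1 => simp
  | hs c x hx => simp [hx]
  | ha x y hx hy => simp [hx, hy, mul_add, add_mul]
  | hm w x hx => rw [mul_assoc, hx, invol_ι_mul, mul_neg, ι_mul_ι_mul]

/-- Contraction with a linear form, an odd derivation of the exterior algebra. -/
def contract : Module.Dual ℂ W →ₗ[ℂ] Λ →ₗ[ℂ] Λ :=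
  CliffordAlgebra.contractLeft (Q := (0 : QuadraticForm ℂ W))

variable (θ η : Module.Dual ℂ W)

@[simp] theorem contract_one : contract θ (1 : Λ) = 0 := CliffordAlgebra.contractLeft_one _ θ

theorem contract_ι_mul (v : W) (g : Λ) : contract θ (ι v * g) = θ v • g - ι v * contract θ g :=
  CliffordAlgebra.contractLeft_ι_mul θ v g

@[simp] theorem contract_ι (v : W) : contract θ (ι v) = algebraMap ℂ _ (θ v) :=
  CliffordAlgebra.contractLeft_ι _ θ v

theorem contract_contract (g : Λ) : contract θ (contract θ g) = 0 :=
  CliffordAlgebra.contractLeft_contractLeft θ g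

theorem contract_comm (g : Λ) : contract θ (contract η g) = -contract η (contract θ g) :=
  CliffordAlgebra.contractLeft_comm θ η g

theorem contract_invol (g : Λ) : contract θ (invol g) = -invol (contract θ g) := by
  induction g using ext_induction with
  | h1 => simp
  | hs c x hx => simp [hx]
  | ha x y hx hy => simp [hx, hy]; abel
  | hm w x hx => simp [contract_ι_mul, hx]

theorem contract_mul (g h : Λ) :
    contract θ (g * h) = contract θ g * h + invol g * contract θ h := by
  induction g using ext_induction with
  | h1 => simp
  | hs c x hx => simp [hx]
  | ha x y hx hy => simp only [add_mul, map_add, hx, hy]; abel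
  | hm w x hx =>
    simp only [mul_assoc, contract_ι_mul, hx, map_mul, invol_ι, mul_add, sub_mul, smul_mul_assoc, neg_mul]
    abel

/-- Left multiplication on `x` factors through the augmentation, since its ideal is generated by
vectors, all of which kill `x`. Applied to top-degree elements. -/
theorem mul_eq_counit_smul {x : Λ} (hx : ∀ v : W, ι v * x = 0) (g : Λ) : g * x = (ε g : ℂ) • x := by
  induction g using ext_induction with
  | h1 => simp
  | hs c y hy => simp [hy, mul_smul]
  | ha y z hy hz => simp [add_mul, hy, hz, add_smul]
  | hm w y hy => rw [mul_assoc, hy, mul_smul_comm, hx, counit_ι_mul]; simp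

theorem mul_eq_counit_smul' {x : Λ} (hx : ∀ v : W, x * ι v = 0) (g : Λ) : x * g = (ε g : ℂ) • x := by
  induction g using ext_induction with
  | h1 => simp
  | hs c y hy => simp [hy, mul_smul]
  | ha y z hy hz => simp [mul_add, hy, hz, add_smul]
  | hm w y hy => rw [← mul_assoc, hx, counit_ι_mul]; simp

/-- The product `x (k - 1) ⋯ x 0` in the exterior algebra. -/
def wedge (x : ℕ → W) : ℕ → Λ
  | 0 => 1
  | k + 1 => ι (x k) * wedge x k

@[simp] theorem wedge_zero (x : ℕ → W) : wedge x 0 = 1 := rfl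

theorem wedge_succ (x : ℕ → W) (k : ℕ) : wedge x (k + 1) = ι (x k) * wedge x k := rfl

theorem invol_wedge (x : ℕ → W) (k : ℕ) : invol (wedge x k) = (-1 : ℂ) ^ k • wedge x k := by
  induction k with
  | zero => simp
  | succ k ih => rw [wedge_succ, invol_ι_mul, ih, pow_succ]; simp

theorem contract_wedge {θ : Module.Dual ℂ W} {x : ℕ → W} {k : ℕ} (h : ∀ j < k, θ (x j) = 0) :
    contract θ (wedge x k) = 0 := by
  induction k with
  | zero => simp
  | succ k ih =>
    rw [wedge_succ, contract_ι_mul, h k (by omega), ih fun j hj => h j (by omega)]; simp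

theorem wedge_mul_ι_of_lt {x : ℕ → W} {k j : ℕ} (h : j < k) : wedge x k * ι (x j) = 0 := by
  induction k with
  | zero => omega
  | succ k ih =>
    rcases eq_or_ne j k with rfl | hj
    · rw [wedge_succ, mul_assoc, mul_ι, ι_mul_self_mul]
    · rw [wedge_succ, mul_assoc, ih (by omega), mul_zero]

theorem wedge_mul_ι {x : ℕ → W} {k : ℕ} {v : W} (h : v ∈ Submodule.span ℂ (x '' Set.Iio k)) :
    wedge x k * ι v = 0 := by
  induction h using Submodule.span_induction with
  | mem v hv => obtain ⟨j, hj, rfl⟩ := hv; exact wedge_mul_ι_of_lt hj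
  | zero => simp
  | add v w _ _ hv hw => rw [map_add, mul_add, hv, hw, add_zero]
  | smul c v _ hv => rw [map_smul, mul_smul_comm, hv, smul_zero]

theorem ι_mul_wedge {x : ℕ → W} {k : ℕ} {v : W} (h : v ∈ Submodule.span ℂ (x '' Set.Iio k)) :
    ι v * wedge x k = 0 := by
  have := mul_ι (invol (wedge x k)) v
  rw [invol_invol, invol_wedge, smul_mul_assoc, wedge_mul_ι h, smul_zero] at this
  exact this.symm

theorem wedge_ne_zero {x : ℕ → W} {θ : ℕ → Module.Dual ℂ W} {n : ℕ}
    (h : ∀ i < n, ∀ j < n, θ i (x j) = if i = j then 1 else 0) : wedge x n ≠ 0 := by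
  induction n with
  | zero => simp
  | succ n ih =>
    intro h0
    have h1 := congrArg (contract (θ n)) h0
    rw [wedge_succ, contract_ι_mul, h n (by omega) n (by omega), contract_wedge, map_zero] at h1
    · exact ih (fun i hi j hj => h i (by omega) j (by omega)) (by simpa using h1)
    · intro j hj; rw [h n (by omega) j (by omega), if_neg (by omega)]

/-- Contracting with the form dual to the last vector peels that vector off the product: the
contraction kills both `g` and the remaining vectors. -/
theorem eq_zero_of_wedge_mul {x : ℕ → W} {θ : ℕ → Module.Dual ℂ W} {n : ℕ}
    (h : ∀ i < n, ∀ j < n, θ i (x j) = if i = j then 1 else 0) {g : Λ}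
    (hg : ∀ i < n, contract (θ i) g = 0) (h0 : wedge x n * g = 0) : g = 0 := by
  induction n with
  | zero => simpa using h0
  | succ n ih =>
    refine ih (fun i hi j hj => h i (by omega) j (by omega)) (fun i hi => hg i (by omega)) ?_
    have h1 := congrArg (contract (θ n)) h0
    rw [wedge_succ, mul_assoc, contract_ι_mul, h n (by omega) n (by omega), contract_mul,
      contract_wedge, hg n (by omega), map_zero] at h1
    · simpa using h1
    · intro j hj; rw [h n (by omega) j (by omega), if_neg (by omega)]

/-- A nonempty finite family of anticommuting, square-zero operators has a common kernel vector in
every non-zero invariant subspace. -/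
theorem exists_common_kernel {M I : Type*} [AddCommGroup M] [Module ℂ M] (N : I → M →ₗ[ℂ] M)
    (hN : ∀ i x, N i (N i x) = 0) (hc : ∀ i j x, N i (N j x) = -N j (N i x)) (J : Submodule ℂ M)
    (hJ : ∀ i, ∀ x ∈ J, N i x ∈ J) (h0 : J ≠ ⊥) (s : Finset I) :
    ∃ x ∈ J, x ≠ 0 ∧ ∀ i ∈ s, N i x = 0 := by
  classical
  induction s using Finset.induction_on with
  | empty =>
    obtain ⟨x, hx, h⟩ := J.ne_bot_iff.mp h0
    exact ⟨x, hx, h, by simp⟩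
  | insert i s _ ih =>
    obtain ⟨x, hx, h, hs⟩ := ih
    by_cases hi : N i x = 0
    · exact ⟨x, hx, h, by simpa [hi] using hs⟩
    -- If `N i` does not kill `x`, then `N i x` replaces it: it is killed by `N i` and, by
    -- anticommutation, still by the earlier operators.
    · refine ⟨N i x, hJ i x hx, hi, fun j hj => ?_⟩
      rcases Finset.mem_insert.mp hj with rfl | hj
      · exact hN _ _
      · rw [hc, hs j hj]; simp

theorem exists_dual_family (W : Type*) [AddCommGroup W] [Module ℂ W] [FiniteDimensional ℂ W] :
    ∃ (x : ℕ → W) (θ : ℕ → Module.Dual ℂ W),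
      (∀ i < Module.finrank ℂ W, ∀ j < Module.finrank ℂ W, θ i (x j) = if i = j then 1 else 0) ∧
      Submodule.span ℂ (x '' Set.Iio (Module.finrank ℂ W)) = ⊤ := by
  let b := Module.finBasis ℂ W
  refine ⟨fun k => if h : k < Module.finrank ℂ W then b ⟨k, h⟩ else 0,
    fun k => if h : k < Module.finrank ℂ W then b.coord ⟨k, h⟩ else 0, ?_, ?_⟩
  · intro i hi j hj
    simp [hi, hj, Module.Basis.coord_apply, Finsupp.single_apply, eq_comm]
  · rw [eq_top_iff, ← b.span_eq, Submodule.span_le]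
    rintro _ ⟨i, rfl⟩
    exact Submodule.subset_span ⟨i, i.2, by simp⟩

/-- Subtracting the constant term leaves an element killed by all contractions and also by
multiplication with the top product, which only sees the constant term. -/
theorem eq_algebraMap_of_contract_eq_zero [FiniteDimensional ℂ W] {g : Λ}
    (hg : ∀ θ : Module.Dual ℂ W, contract θ g = 0) : g = algebraMap ℂ _ (ε g) := by
  obtain ⟨x, θ, h, hx⟩ := exists_dual_family W
  rw [← sub_eq_zero]
  refine eq_zero_of_wedge_mul h (fun i _ => ?_) ?_
  · rw [map_sub, hg, Algebra.algebraMap_eq_smul_one, map_smul, contract_one, smul_zero, sub_zero]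
  · rw [mul_sub, mul_eq_counit_smul' (fun v => wedge_mul_ι (hx ▸ Submodule.mem_top)),
      Algebra.algebraMap_eq_smul_one, mul_smul_comm, mul_one, sub_self]

/-- The exterior algebra has no proper non-zero subspaces stable under multiplication by vectors and
contraction with linear forms. -/
theorem eq_bot_or_eq_top [FiniteDimensional ℂ W] (J : Submodule ℂ Λ)
    (hm : ∀ v : W, ∀ x ∈ J, ι v * x ∈ J) (hc : ∀ θ : Module.Dual ℂ W, ∀ x ∈ J, contract θ x ∈ J) :
    J = ⊥ ∨ J = ⊤ := by
  rw [or_iff_not_imp_left]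
  intro h0
  let c := Module.finBasis ℂ (Module.Dual ℂ W)
  obtain ⟨x, hx, hx0, h⟩ := exists_common_kernel (fun i => contract (c i))
    (fun i => contract_contract _) (fun i j => contract_comm _ _) J (fun i => hc _) h0 Finset.univ
  have hθ : ∀ θ : Module.Dual ℂ W, contract θ x = 0 := fun θ => by
    rw [← c.sum_repr θ]
    simp only [map_sum, map_smul, LinearMap.sum_apply, LinearMap.smul_apply]
    exact Finset.sum_eq_zero fun i hi => by rw [h i hi, smul_zero]
  -- The common kernel of all contractions consists of scalars, so `J` contains a non-zero scalar,
  -- hence `1`, which generates everything under multiplication by vectors.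
  have h1 := eq_algebraMap_of_contract_eq_zero hθ
  have hε : (ε x : ℂ) ≠ 0 := fun h2 => hx0 (by rw [h1, h2, map_zero])
  have h1J : (1 : Λ) ∈ J := by
    have := J.smul_mem (ε x : ℂ)⁻¹ hx
    rwa [h1, Algebra.algebraMap_eq_smul_one, map_smul, map_one, smul_smul, smul_eq_mul, mul_one,
      inv_mul_cancel₀ hε, one_smul] at this
  rw [eq_top_iff]
  rintro g -
  induction g using ext_induction with
  | h1 => exact h1J
  | hs c x hx => exact J.smul_mem c hx
  | ha x y hx hy => exact J.add_mem hx hy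
  | hm w x hx => exact hm w x hx

end exterior

/-! ### The top form -/

section topForm

open SymplecticForm (topForm)

variable {W : Type u} [AddCommGroup W] [Module ℂ W]

theorem contract_mem_pow (θ : Module.Dual ℂ W) (k : ℕ) :
    ∀ g ∈ LinearMap.range (ExteriorAlgebra.ι ℂ (M := W)) ^ (k + 1),
      contract θ g ∈ LinearMap.range (ExteriorAlgebra.ι ℂ (M := W)) ^ k := by
  induction k with
  | zero =>
    intro g hg
    rw [zero_add, pow_one] at hg
    obtain ⟨v, rfl⟩ := hg
    rw [contract_ι, pow_zero]
    exact Submodule.mem_one.mpr ⟨_, rfl⟩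
  | succ k ih =>
    intro g hg
    rw [pow_succ'] at hg
    induction hg using Submodule.mul_induction_on' with
    | mem_mul_mem m hm n hn =>
      obtain ⟨v, rfl⟩ := hm
      rw [contract_ι_mul]
      refine Submodule.sub_mem _ (Submodule.smul_mem _ _ hn) ?_
      rw [pow_succ']
      exact Submodule.mul_mem_mul ⟨v, rfl⟩ (ih n hn)
    | add x _ y _ hx hy => rw [map_add]; exact Submodule.add_mem _ hx hy

theorem topForm_ιMulti [FiniteDimensional ℂ W] (k : ℕ) (v : Fin k → W) (hk : k ≠ Module.finrank ℂ W) :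
    topForm W (ExteriorAlgebra.ιMulti ℂ k v) = 0 := by
  rw [topForm, ExteriorAlgebra.liftAlternating_apply_ιMulti, Pi.single_eq_of_ne hk]; rfl

/-- Contraction lowers the degree by one, so it could reach degree `d` only from degree `d + 1`,
where every product of vectors vanishes by linear dependence. -/
theorem topForm_contract [FiniteDimensional ℂ W] (θ : Module.Dual ℂ W) (g : ExteriorAlgebra ℂ W) :
    topForm W (contract θ g) = 0 := by
  have hg : g ∈ Submodule.span ℂ (Set.range fun x : Σ n, (Fin n → W) =>
    ExteriorAlgebra.ιMulti ℂ x.1 x.2) := by rw [ExteriorAlgebra.ιMulti_span]; trivial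
  induction hg using Submodule.span_induction with
  | mem g hg =>
    obtain ⟨⟨n, v⟩, rfl⟩ := hg
    dsimp only
    rcases n with _ | n
    · simp
    by_cases hn : n = Module.finrank ℂ W
    · rw [AlternatingMap.map_linearDependent]
      · simp
      · intro h
        have := h.fintype_card_le_finrank
        simp at this; omega
    have h1 : contract θ (ExteriorAlgebra.ιMulti ℂ (n + 1) v) ∈
        LinearMap.range (ExteriorAlgebra.ι ℂ (M := W)) ^ n :=
      contract_mem_pow θ n _ (ExteriorAlgebra.ιMulti_range ℂ (n + 1) ⟨v, rfl⟩)
    rw [← ExteriorAlgebra.exteriorPower, ← ExteriorAlgebra.ιMulti_span_fixedDegree] at h1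
    generalize contract θ (ExteriorAlgebra.ιMulti ℂ (n + 1) v) = g at h1
    induction h1 using Submodule.span_induction with
    | mem g hg => obtain ⟨w, rfl⟩ := hg; exact topForm_ιMulti n w hn
    | zero => simp
    | add x y _ _ hx hy => rw [map_add, hx, hy, add_zero]
    | smul c x _ hx => rw [map_smul, hx, smul_zero]
  | zero => simp
  | add x y _ _ hx hy => rw [map_add, map_add, hx, hy, add_zero]
  | smul c x _ hx => rw [map_smul, map_smul, hx, smul_zero]

theorem topForm_ne_zero (W : Type u) [AddCommGroup W] [Module ℂ W] [FiniteDimensional ℂ W] :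
    topForm W ≠ 0 := by
  intro h
  have := LinearMap.congr_fun h (ExteriorAlgebra.ιMulti ℂ _ (SymplecticForm.b (V := W)))
  rw [topForm, ExteriorAlgebra.liftAlternating_apply_ιMulti, Pi.single_eq_same,
    Module.Basis.det_self] at this
  exact one_ne_zero this

end topForm

/-! ### Truncated exponentials -/

section nilpotent

/-- The truncated exponential `∑ t^k N^k / k!`, over `k < m`. -/
def truncExp {R : Type*} [Ring R] [Algebra ℂ R] (m : ℕ) (t : ℂ) (N : R) : R :=
  ∑ k ∈ Finset.range m, (t ^ k / (Nat.factorial k : ℂ)) • N ^ k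

variable {R : Type*} [Ring R] [Algebra ℂ R]

/-- Each square-zero term can be used at most once in a monomial, so a product of more factors than
terms vanishes. -/
theorem sum_pow_card_add_one {I : Type*} (s : Finset I) (x : I → R)
    (hc : ∀ i ∈ s, ∀ j ∈ s, x i * x j = x j * x i) (h0 : ∀ i ∈ s, x i * x i = 0) :
    (∑ i ∈ s, x i) ^ (s.card + 1) = 0 := by
  classical
  induction s using Finset.induction_on with
  | empty => simp
  | insert i s hi ih =>
    have ih := ih (fun i hi j hj => hc i (by simp [hi]) j (by simp [hj])) (fun i hi => h0 i (by simp [hi]))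
    have hcm : Commute (x i) (∑ j ∈ s, x j) := by
      refine Commute.sum_right _ _ _ fun j hj => hc i (by simp) j (by simp [hj])
    rw [Finset.sum_insert hi, Finset.card_insert_of_notMem hi, hcm.add_pow]
    refine Finset.sum_eq_zero fun k hk => ?_
    by_cases hk2 : 2 ≤ k
    · rw [pow_eq_zero_of_le hk2 (by rw [pow_two]; exact h0 i (by simp))]; simp
    · rw [pow_eq_zero_of_le (by omega) ih]; simp

/-- The truncated exponential has the form `1 + N U` with `U` commuting with `N`. -/
theorem truncExp_eq (m : ℕ) (t : ℂ) (N : R) :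
    ∃ P : R, Commute N P ∧ truncExp (m + 2) t N = 1 + t • N + N * N * P := by
  refine ⟨∑ k ∈ Finset.range m, (t ^ (k + 2) / (Nat.factorial (k + 2) : ℂ)) • N ^ k, ?_, ?_⟩
  · exact Commute.sum_right _ _ _ fun k _ => (Commute.pow_right rfl k).smul_right _
  · rw [truncExp, Finset.sum_range_succ', Finset.sum_range_succ', Finset.mul_sum]
    rw [add_assoc, add_comm]
    congr 1
    · simp [add_comm]
    exact Finset.sum_congr rfl fun k _ => by
      rw [mul_smul_comm, ← pow_two, ← pow_add, add_comm 2 k]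

theorem isUnit_truncExp (m : ℕ) (t : ℂ) {N : R} (hN : IsNilpotent N) :
    IsUnit (truncExp (m + 2) t N) := by
  obtain ⟨P, hP, h⟩ := truncExp_eq m t N
  rw [h, add_assoc]
  refine IsNilpotent.isUnit_one_add ?_
  have : t • N + N * N * P = N * (t • 1 + N * P) := by
    rw [mul_add, mul_smul_comm, mul_one, mul_assoc]
  rw [this]
  refine Commute.isNilpotent_mul_right ?_ hN
  exact ((Commute.one_right N).smul_right t).add_right ((Commute.refl N).mul_right hP)

theorem truncExp_of_mul_eq_zero {M M' : Type*} [AddCommGroup M] [Module ℂ M] [AddCommGroup M']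
    [Module ℂ M'] {m : ℕ} (hm : 0 < m) (t : ℂ) {N : Module.End ℂ M} {F : M →ₗ[ℂ] M'}
    (h : F ∘ₗ N = 0) : F ∘ₗ truncExp m t N = F := by
  obtain ⟨m, rfl⟩ : ∃ k, m = k + 1 := ⟨m - 1, by omega⟩
  refine LinearMap.ext fun x => ?_
  rw [truncExp, Finset.sum_range_succ', LinearMap.comp_apply, LinearMap.add_apply, map_add,
    LinearMap.sum_apply, map_sum, Finset.sum_eq_zero]
  · simp
  · intro k _
    rw [LinearMap.smul_apply, map_smul, pow_succ' N, Module.End.mul_apply, ← LinearMap.comp_apply, h]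
    simp

theorem truncExp_apply_of_eq_zero {M : Type*} [AddCommGroup M] [Module ℂ M] {m : ℕ} (hm : 0 < m)
    (t : ℂ) {N : Module.End ℂ M} {x : M} (h : N x = 0) : truncExp m t N x = x := by
  obtain ⟨m, rfl⟩ : ∃ k, m = k + 1 := ⟨m - 1, by omega⟩
  rw [truncExp, Finset.sum_range_succ', LinearMap.add_apply, LinearMap.sum_apply,
    Finset.sum_eq_zero]
  · simp
  · intro k _
    rw [LinearMap.smul_apply, pow_succ N, Module.End.mul_apply, h, map_zero, smul_zero]

/-- If a linear map takes the same value after `exp(t N)` and after `exp(t' N)`, with `N` nilpotent and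
`t ≠ t'`, then it vanishes on the image of `N`. -/
theorem comp_eq_zero_of_truncExp {M M' : Type*} [AddCommGroup M] [Module ℂ M] [AddCommGroup M']
    [Module ℂ M'] (m : ℕ) {t t' : ℂ} (ht : t ≠ t') {N : Module.End ℂ M} (hN : IsNilpotent N)
    {F : M →ₗ[ℂ] M'} (h : F ∘ₗ truncExp (m + 2) t N = F ∘ₗ truncExp (m + 2) t' N) :
    F ∘ₗ N = 0 := by
  obtain ⟨P, hP, h1⟩ := truncExp_eq m t N
  obtain ⟨P', hP', h2⟩ := truncExp_eq m t' N
  -- The two exponentials differ by `N` times an invertible operator, namely the non-zero scalar `t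
  -- - t'` plus a nilpotent; cancelling it leaves `F ∘ N = 0`.
  have hd : truncExp (m + 2) t N - truncExp (m + 2) t' N = N * ((t - t') • 1 + N * (P - P')) := by
    rw [h1, h2, mul_add, mul_smul_comm, mul_one, sub_smul, mul_sub, mul_sub, ← mul_assoc, ← mul_assoc]
    abel
  have hn : IsNilpotent (N * (P - P')) :=
    Commute.isNilpotent_mul_right (hP.sub_right hP') hN
  have hu : IsUnit ((t - t') • (1 : Module.End ℂ M) + N * (P - P')) := by
    have : ((t - t') • (1 : Module.End ℂ M) + N * (P - P'))
        = (t - t') • (1 + (t - t')⁻¹ • (N * (P - P'))) := by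
      rw [smul_add, smul_smul, mul_inv_cancel₀ (sub_ne_zero.mpr ht), one_smul]
    rw [this]
    rw [Algebra.smul_def]
    exact ((IsUnit.mk0 _ (sub_ne_zero.mpr ht)).map (algebraMap ℂ (Module.End ℂ M))).mul
      (hn.smul _).isUnit_one_add
  obtain ⟨u, hu⟩ := hu
  have h3 : (F ∘ₗ N) ∘ₗ (u : Module.End ℂ M) = 0 := by
    rw [hu, LinearMap.comp_assoc, ← Module.End.mul_eq_comp N, ← hd, LinearMap.comp_sub, h, sub_self]
  calc F ∘ₗ N = ((F ∘ₗ N) ∘ₗ (u : Module.End ℂ M)) ∘ₗ ((u⁻¹ : (Module.End ℂ M)ˣ) : Module.End ℂ M) := by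
        rw [LinearMap.comp_assoc, ← Module.End.mul_eq_comp (u : Module.End ℂ M), u.mul_inv]; rfl
    _ = 0 := by rw [h3, LinearMap.zero_comp]

end nilpotent

/-! ### Lagrangian subspaces and symplectic bases -/

section symplectic

variable {V : Type u} [AddCommGroup V] [Module ℂ V] [FiniteDimensional ℂ V] (B : SymplecticForm V)

namespace SymplecticForm

theorem formSF_self (v : V) : B.formSF v v = 0 := by simp [formSF, B.alt v]

theorem formSF_neg (v w : V) : -B.formSF v w = B.formSF w v := by
  simp only [formSF, LinearMap.smul_apply, ← LinearMap.BilinForm.IsAlt.neg_eq B.alt v w, smul_neg]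

theorem form_eq_zero_iff (v w : V) : B.form v w = 0 ↔ B.formSF v w = 0 := by
  simp [formSF, Real.pi_ne_zero]

theorem isLagrangian_iff (f : Submodule ℂ V) :
    B.IsLagrangian f ↔ ∀ x, x ∈ f ↔ ∀ y ∈ f, B.formSF x y = 0 := by
  simp only [IsLagrangian, form_eq_zero_iff]

theorem eq_of_formSF {v w : V} (h : ∀ x, B.formSF v x = B.formSF w x) : v = w := by
  rw [← sub_eq_zero]
  exact B.formSF_nondeg.1 _ fun x => by rw [map_sub, LinearMap.sub_apply, h, sub_self]

theorem exists_formSF_eq (θ : Module.Dual ℂ V) : ∃ v, ∀ x, B.formSF v x = θ x :=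
  ⟨(LinearMap.BilinForm.toDual B.formSF B.formSF_nondeg).symm θ, fun x =>
    LinearMap.BilinForm.apply_toDual_symm_apply (hB := B.formSF_nondeg) θ x⟩

theorem sum_formSF_b_smul_a (w : V) : ∑ i, B.formSF w (b i) • B.a i = w := by
  have h : B.formSF (∑ i, B.formSF w (b i) • B.a i) = B.formSF w :=
    (b (V := V)).ext fun j => by simp [formSF_a_b]
  exact B.eq_of_formSF fun x => by rw [h]

theorem sum_formSF_a_smul_b (w : V) : ∑ i, B.formSF (B.a i) w • b i = w := by
  have h : ∀ i, B.formSF (B.a i) w = b.repr w i := fun i => by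
    conv_lhs => rw [← (b (V := V)).sum_repr w, map_sum]
    simp [formSF_a_b]
  simp only [h]
  exact b.sum_repr w

/-- An isotropic subspace of maximal dimension works: a vector orthogonal to it but outside could be
adjoined, since it is orthogonal to itself. -/
theorem exists_isLagrangian : ∃ f : Submodule ℂ V, B.IsLagrangian f := by
  classical
  let S : Set ℕ := {k | ∃ f : Submodule ℂ V, (∀ x ∈ f, ∀ y ∈ f, B.formSF x y = 0) ∧
    Module.finrank ℂ f = k}
  have hS : S.Nonempty := ⟨0, ⊥, by simp, by simp⟩
  have hb : BddAbove S := ⟨Module.finrank ℂ V, by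
    rintro _ ⟨f, -, rfl⟩; exact Submodule.finrank_le f⟩
  obtain ⟨f, hf, hk⟩ := Nat.sSup_mem hS hb
  refine ⟨f, (B.isLagrangian_iff f).mpr fun x => ⟨fun hx y hy => hf x hx y hy, fun hx => ?_⟩⟩
  by_contra hxf
  have hlt : f < f ⊔ Submodule.span ℂ {x} := by
    rw [left_lt_sup]
    intro h
    exact hxf (h (Submodule.mem_span_singleton_self x))
  have h1 := Submodule.finrank_lt_finrank_of_lt hlt
  have h2 : Module.finrank ℂ (f ⊔ Submodule.span ℂ {x} : Submodule ℂ V) ∈ S := by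
    refine ⟨_, fun y hy z hz => ?_, rfl⟩
    obtain ⟨y, hy1, _, hy', rfl⟩ := Submodule.mem_sup.mp hy
    obtain ⟨z, hz1, _, hz', rfl⟩ := Submodule.mem_sup.mp hz
    obtain ⟨c, rfl⟩ := Submodule.mem_span_singleton.mp hy'
    obtain ⟨c', rfl⟩ := Submodule.mem_span_singleton.mp hz'
    have h3 : B.formSF y x = 0 := by rw [← formSF_neg, hx y hy1, neg_zero]
    simp [hf y hy1 z hz1, hx z hz1, h3, B.formSF_self]
  have := le_csSup hb h2
  omega

/-- A symplectic basis, indexed by the natural numbers below `n`, adapted to a Lagrangian subspace. -/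
structure Adapted (f : Submodule ℂ V) (n : ℕ) (e g : ℕ → V) : Prop where
  finrank_eq : Module.finrank ℂ V = 2 * n
  finrank_f : Module.finrank ℂ f = n
  mem : ∀ i, e i ∈ f
  span_e : Submodule.span ℂ (e '' Set.Iio n) = f
  span_top : Submodule.span ℂ (e '' Set.Iio n) ⊔ Submodule.span ℂ (g '' Set.Iio n) = ⊤
  ee : ∀ i j, B.formSF (e i) (e j) = 0
  gg : ∀ i j, B.formSF (g i) (g j) = 0
  eg : ∀ i < n, ∀ j < n, B.formSF (e i) (g j) = if i = j then 1 else 0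

variable {B}

/-- Vectors dual to a basis of `f` exist by non-degeneracy. They are corrected inside `f`, which
does not disturb duality, until they are orthogonal to each other. -/
theorem IsLagrangian.exists_adapted {f : Submodule ℂ V} (hf : B.IsLagrangian f) :
    ∃ n e g, B.Adapted f n e g := by
  rw [isLagrangian_iff] at hf
  have hff : ∀ x ∈ f, ∀ y ∈ f, B.formSF x y = 0 := fun x hx => (hf x).mp hx
  set n := Module.finrank ℂ f with hn
  let c := Module.finBasis ℂ f
  let e : ℕ → V := fun k => if h : k < n then c ⟨k, h⟩ else 0
  have he : ∀ i, e i ∈ f := fun i => by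
    simp only [e]; split_ifs
    · exact Subtype.mem _
    · exact f.zero_mem
  have hspan : Submodule.span ℂ (e '' Set.Iio n) = f := by
    apply le_antisymm
    · rw [Submodule.span_le]; rintro _ ⟨i, -, rfl⟩; exact he i
    · intro x hx
      have h1 : x = ∑ i, c.repr ⟨x, hx⟩ i • (c i : V) := by
        have := congrArg Subtype.val (c.sum_repr ⟨x, hx⟩)
        rw [AddSubmonoidClass.coe_finsetSum] at this
        exact this.symm
      rw [h1]
      refine Submodule.sum_mem _ fun i _ => Submodule.smul_mem _ _ (Submodule.subset_span ?_)
      exact ⟨i, i.2, dif_pos i.2⟩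
  have hg0 : ∀ j, ∃ w : V, ∀ i < n, B.formSF (e i) w = if i = j then 1 else 0 := by
    intro j
    by_cases hj : j < n
    · obtain ⟨θ, hθ⟩ := LinearMap.exists_extend (c.coord ⟨j, hj⟩)
      obtain ⟨v, hv⟩ := B.exists_formSF_eq θ
      refine ⟨-v, fun i hi => ?_⟩
      have h1 := LinearMap.congr_fun hθ (c ⟨i, hi⟩)
      rw [map_neg, formSF_neg, hv]
      simp only [e, hi, dif_pos]
      simp only [LinearMap.comp_apply, Submodule.subtype_apply] at h1
      rw [h1]
      simp [Finsupp.single_apply]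
    · refine ⟨0, fun i hi => ?_⟩
      rw [if_neg (by omega), map_zero]
  choose w hw using hg0
  -- The factor `1/2` splits the correction evenly: each of `g i` and `g j` removes half of the skew
  -- pairing of `w i` with `w j`. The value is `0` beyond `n`, so that the `g j` are orthogonal for
  -- all indices.
  let g : ℕ → V := fun j => if j < n then w j - (1 / 2 : ℂ) • ∑ k ∈ Finset.range n, B.formSF (w j) (w k) • e k
    else 0
  have hew : ∀ i < n, ∀ x : ℕ → V, (∀ k < n, B.formSF (e i) (x k) = 0) → ∀ c : ℕ → ℂ,
      B.formSF (e i) (∑ k ∈ Finset.range n, c k • x k) = 0 := by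
    intro i hi x hx c
    rw [map_sum]
    exact Finset.sum_eq_zero fun k hk => by
      rw [map_smul, hx k (Finset.mem_range.mp hk), smul_zero]
  have heg : ∀ i < n, ∀ j < n, B.formSF (e i) (g j) = if i = j then 1 else 0 := by
    intro i hi j hj
    simp only [g, hj, if_true]
    rw [map_sub, map_smul, hw j i hi, hew i hi e (fun k _ => hff _ (he i) _ (he k)), smul_zero, sub_zero]
  have hgg : ∀ i j, B.formSF (g i) (g j) = 0 := by
    intro i j
    by_cases hi : i < n
    swap
    · simp [g, hi]
    by_cases hj : j < n
    swap
    · simp [g, hj]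
    have h1 : ∀ i < n, ∀ j < n,
        B.formSF (∑ k ∈ Finset.range n, B.formSF (w i) (w k) • e k) (w j) = B.formSF (w i) (w j) := by
      intro i hi j hj
      rw [map_sum, LinearMap.sum_apply, Finset.sum_eq_single j]
      · simp [hw j j hj]
      · intro k hk hkj
        simp [hw j k (Finset.mem_range.mp hk), hkj]
      · intro h; exact absurd (Finset.mem_range.mpr hj) h
    have h2 : B.formSF (∑ k ∈ Finset.range n, B.formSF (w i) (w k) • e k)
        (∑ k ∈ Finset.range n, B.formSF (w j) (w k) • e k) = 0 :=
      hff _ (Submodule.sum_mem _ fun k _ => f.smul_mem _ (he k)) _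
        (Submodule.sum_mem _ fun k _ => f.smul_mem _ (he k))
    have h3 := h1 j hj i hi
    rw [← formSF_neg] at h3
    simp only [g, hi, hj, if_true, map_sub, LinearMap.sub_apply, map_smul, LinearMap.smul_apply, h2,
      h1 i hi j hj, smul_eq_mul]
    rw [← B.formSF_neg (w j) (w i)] at *
    linear_combination (1 / 2 : ℂ) * h3
  refine ⟨n, e, g, ?_, rfl, he, hspan, ?_, fun i j => hff _ (he i) _ (he j), hgg, heg⟩
  -- Here `f` is its own orthogonal complement, so the dimension formula for complements reads `d -
  -- n = n`.
  · have h1 := LinearMap.BilinForm.finrank_orthogonal B.formSF_nondeg f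
    have h2 : B.formSF.orthogonal f = f := by
      ext x
      rw [LinearMap.BilinForm.mem_orthogonal_iff, hf x]
      refine forall₂_congr fun y _ => ?_
      change B.formSF y x = 0 ↔ _
      rw [← formSF_neg, neg_eq_zero]
    rw [h2] at h1
    have := Submodule.finrank_le f
    omega
  · rw [hspan, eq_top_iff]
    rintro v -
    have h1 : v - ∑ k ∈ Finset.range n, B.formSF (e k) v • g k ∈ f := by
      rw [hf]
      intro y hy
      rw [← formSF_neg, neg_eq_zero]
      rw [← hspan] at hy
      induction hy using Submodule.span_induction with
      | mem y hy =>
        obtain ⟨i, hi, rfl⟩ := hy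
        rw [map_sub, map_sum, Finset.sum_eq_single i]
        · simp [heg i hi i hi]
        · intro k hk hki
          simp [heg i hi k (Finset.mem_range.mp hk), hki.symm]
        · intro h; exact absurd (Finset.mem_range.mpr hi) h
      | zero => simp
      | add x y _ _ hx hy => rw [map_add, LinearMap.add_apply, hx, hy, add_zero]
      | smul c x _ hx => rw [map_smul, LinearMap.smul_apply, hx, smul_zero]
    rw [← sub_add_cancel v (∑ k ∈ Finset.range n, B.formSF (e k) v • g k)]
    refine Submodule.add_mem_sup h1 (Submodule.sum_mem _ fun k hk => ?_)
    exact Submodule.smul_mem _ _ (Submodule.subset_span ⟨k, Finset.mem_range.mp hk, rfl⟩)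

end SymplecticForm
end symplectic

/-! ### The map `φ` -/

section commutator

variable {R : Type*} [Ring R] [Algebra ℂ R]

theorem mul_pow_of_commutator {P N D : R} (h : P * N = N * P + D) (hD : Commute D N) (k : ℕ) :
    P * N ^ (k + 1) = N ^ (k + 1) * P + ((k + 1 : ℕ) : ℂ) • (D * N ^ k) := by
  induction k with
  | zero => simp [h]
  | succ k ih =>
    rw [pow_succ, ← mul_assoc, ih, add_mul, mul_assoc _ P N, h, mul_add, smul_mul_assoc, mul_assoc D,
      ← pow_succ, ← mul_assoc, ← (hD.pow_right (k + 1)).eq, ← pow_succ, add_assoc]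
    push_cast
    rw [add_smul ((k : ℂ) + 1), one_smul, add_comm (D * _)]

/-- The rule `[P, exp(tN)] = t D exp(tN)` for a commutator `D` that commutes with `N`. It holds
exactly for the truncation because the missing last term `D N^m` vanishes. -/
theorem mul_truncExp_of_commutator {P N D : R} (h : P * N = N * P + D) (hD : Commute D N) {m : ℕ}
    (hN : N ^ (m + 1) = 0) (t : ℂ) :
    P * truncExp (m + 1) t N = truncExp (m + 1) t N * P + t • (D * truncExp (m + 1) t N) := by
  -- Commuting `P` past `N^(m+1) = 0` leaves `(m+1) D N^m = 0`.
  have h0 : D * N ^ m = 0 := by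
    have := mul_pow_of_commutator h hD m
    rw [hN, mul_zero, zero_mul, zero_add] at this
    exact (smul_eq_zero.mp this.symm).resolve_left (Nat.cast_ne_zero.mpr (by omega))
  have h1 : D * truncExp (m + 1) t N = D * truncExp m t N := by
    simp only [truncExp]
    rw [Finset.sum_range_succ, mul_add, mul_smul_comm, h0, smul_zero, add_zero]
  have h2 : P * truncExp (m + 1) t N - truncExp (m + 1) t N * P = t • (D * truncExp m t N) := by
    simp only [truncExp, Finset.mul_sum, Finset.sum_mul]
    rw [← Finset.sum_sub_distrib, Finset.sum_range_succ']
    simp only [pow_zero, mul_smul_comm, smul_mul_assoc, mul_one, one_mul, sub_self, add_zero,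
      Finset.smul_sum, mul_pow_of_commutator h hD]
    refine Finset.sum_congr rfl fun k _ => ?_
    rw [smul_add, add_sub_cancel_left, smul_smul, smul_smul]
    congr 1
    rw [Nat.factorial_succ, pow_succ]
    push_cast
    have h3 : (Nat.factorial k : ℂ) ≠ 0 := Nat.cast_ne_zero.mpr (Nat.factorial_ne_zero k)
    have h4 : (k : ℂ) + 1 ≠ 0 := Nat.cast_add_one_ne_zero k
    field_simp
  rw [h1, ← h2, add_sub_cancel]

theorem add_pow_of_sq_zero {y z : R} (hc : Commute y z) (hy : y * y = 0) (m : ℕ) :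
    (y + z) ^ (m + 1) = z ^ (m + 1) + ((m + 1 : ℕ) : ℂ) • (y * z ^ m) := by
  induction m with
  | zero => simp [add_comm]
  | succ m ih =>
    rw [pow_succ, ih, mul_add, add_mul, add_mul, smul_mul_assoc, smul_mul_assoc, mul_assoc y _ y,
      ← (hc.pow_right m).eq, ← mul_assoc y y, hy, zero_mul, smul_zero, add_zero,
      ← (hc.pow_right (m + 1)).eq, ← pow_succ z (m + 1), mul_assoc y _ z, ← pow_succ]
    push_cast
    rw [add_smul ((m : ℂ) + 1), one_smul]
    abel

end commutator

/-- A linear form which vanishes on all contractions with a dual family, and on the multiples of the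
corresponding product, is zero. -/
theorem eq_zero_of_comp_contract {W : Type*} [AddCommGroup W] [Module ℂ W] {x : ℕ → W}
    {θ : ℕ → Module.Dual ℂ W} {n : ℕ}
    (h : ∀ i < n, ∀ j < n, θ i (x j) = if i = j then 1 else 0) {F : ExteriorAlgebra ℂ W →ₗ[ℂ] ℂ}
    (hF : ∀ i < n, ∀ y, F (contract (θ i) y) = 0) (h0 : ∀ y, F (wedge x n * y) = 0) : F = 0 := by
  have key : ∀ k, k ≤ n → ∀ y, F (wedge x (n - k) * y) = 0 := by
    intro k
    induction k with
    | zero => simpa using h0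
    | succ k ih =>
      intro hk y
      obtain ⟨m, hm⟩ : ∃ m, n - k = m + 1 := ⟨n - k - 1, by omega⟩
      have ih := ih (by omega)
      rw [hm] at ih
      rw [show n - (k + 1) = m by omega]
      -- This contraction equals `wedge x m * y` up to a multiple of `wedge x (m+1)`, which `F`
      -- already kills; so `F` also kills the multiples of the shorter product.
      have h1 := hF m (by omega) (ExteriorAlgebra.ι ℂ (x m) * (wedge x m * y))
      have h2 : contract (θ m) (wedge x m) = 0 := contract_wedge fun j hj => by
        rw [h m (by omega) j (by omega), if_neg (by omega)]
      rw [contract_ι_mul, h m (by omega) m (by omega), if_pos rfl, one_smul, map_sub, contract_mul, h2,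
        zero_mul, zero_add, invol_wedge, smul_mul_assoc, mul_smul_comm, map_smul, ← mul_assoc,
        ← wedge_succ, ih, smul_zero, sub_zero] at h1
      exact h1
  refine LinearMap.ext fun y => ?_
  have := key n le_rfl y
  rwa [Nat.sub_self, wedge_zero, one_mul] at this

section phi

variable {V : Type u} [AddCommGroup V] [Module ℂ V]

theorem Rep.act_act_apply (X : Rep V) (v w : V) (x : X.carrier) :
    X.act v (X.act w x) = -X.act w (X.act v x) := LinearMap.congr_fun (X.act_act v w) x

theorem Rep.act_par_apply (X : Rep V) (v : V) (x : X.carrier) :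
    X.act v (X.par x) = -X.par (X.act v x) := LinearMap.congr_fun (X.act_par v) x

theorem Rep.par_act_apply (X : Rep V) (v : V) (x : X.carrier) :
    X.par (X.act v x) = -X.act v (X.par x) := by rw [X.act_par_apply, neg_neg]

theorem Rep.act_self_apply (X : Rep V) (v : V) (x : X.carrier) : X.act v (X.act v x) = 0 :=
  LinearMap.congr_fun (X.act_sq v) x

theorem SuperSpace.par_par_apply (X : SuperSpace.{u}) (x : X.carrier) : X.par (X.par x) = x :=
  LinearMap.congr_fun X.par_par x

variable [FiniteDimensional ℂ V]

namespace SymplecticForm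

local notation "ι" => ExteriorAlgebra.ι ℂ

variable (B : SymplecticForm V)

theorem actC_tmul (X Y : Rep V) (x : X.carrier) (y : Y.carrier) :
    B.actC X Y (x ⊗ₜ y) = ∑ i, X.act (b i) (X.par x) ⊗ₜ[ℂ] Y.act (B.a i) y := by
  simp [actC, LinearMap.sum_apply]

/-- The action of `C` on the tensor square of the regular representation. -/
def regC : Module.End ℂ (ExteriorAlgebra ℂ V ⊗[ℂ] ExteriorAlgebra ℂ V) := B.actC (reg V) (reg V)

/-- The action of `exp(t C)` on the tensor square of the regular representation. -/
def regExpC (t : ℂ) : Module.End ℂ (ExteriorAlgebra ℂ V ⊗[ℂ] ExteriorAlgebra ℂ V) :=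
  truncExp (Module.finrank ℂ V + 1) t B.regC

theorem regC_tmul (x y : ExteriorAlgebra ℂ V) : B.regC (x ⊗ₜ[ℂ] y) =
    ∑ i, (ι (b i) * invol x) ⊗ₜ[ℂ] (ι (B.a i) * y) := B.actC_tmul (reg V) (reg V) x y

theorem expC_eq (t : ℂ) (X Y : Rep V) :
    B.expC t X Y = truncExp (Module.finrank ℂ V + 1) t (B.actC X Y) := rfl

theorem expHatC_eq (t : ℂ) : B.expHatC t = truncExp (Module.finrank ℂ V + 1) t B.hatC := rfl

theorem actC_pow (X Y : Rep V) : B.actC X Y ^ (Module.finrank ℂ V + 1) = 0 := by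
  have := sum_pow_card_add_one (R := Module.End ℂ (X.carrier ⊗[ℂ] Y.carrier)) Finset.univ
    (fun i => TensorProduct.map (X.act (b i) ∘ₗ X.par) (Y.act (B.a i))) ?_ ?_
  · rwa [Finset.card_univ, Fintype.card_fin] at this
  · intro i _ j _
    refine TensorProduct.ext' fun x y => ?_
    simp only [Module.End.mul_apply, TensorProduct.map_tmul, LinearMap.comp_apply, X.par_act_apply,
      X.par_par_apply, map_neg]
    rw [Y.act_act_apply (B.a i), X.act_act_apply (b i), TensorProduct.tmul_neg, neg_neg,
      TensorProduct.neg_tmul]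
  · intro i _
    refine TensorProduct.ext' fun x y => ?_
    simp [Y.act_self_apply]

theorem ι_mul_ι_commute (v w : V) (g : ExteriorAlgebra ℂ V) : Commute (ι v * ι w) g := by
  change _ = _
  rw [← mul_assoc g, mul_ι g, mul_assoc (ι v) (invol g), mul_ι (invol g), invol_invol, mul_assoc]

theorem ι_mul_ι_sq (v w : V) : (ι v * ι w) * (ι v * ι w) = 0 := by
  rw [mul_assoc, ι_mul_ι_mul w, ExteriorAlgebra.ι_sq_zero, mul_zero, neg_zero, mul_zero]

theorem hatC_pow : B.hatC ^ (Module.finrank ℂ V + 1) = 0 := by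
  have := sum_pow_card_add_one Finset.univ (fun i => ι (b (V := V) i) * ι (B.a i))
    (fun i _ j _ => (ι_mul_ι_commute _ _ _).eq) (fun i _ => ι_mul_ι_sq _ _)
  rwa [Finset.card_univ, Fintype.card_fin] at this

theorem regC_pow : B.regC ^ (Module.finrank ℂ V + 1) = 0 := B.actC_pow (reg V) (reg V)

/-- Contraction in the first factor against `exp(t C)`. -/
theorem contract_expC (w : V) (t : ℂ) (z : ExteriorAlgebra ℂ V ⊗[ℂ] ExteriorAlgebra ℂ V) :
    TensorProduct.map (contract (B.formSF w)) LinearMap.id (B.regExpC t z) =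
      B.regExpC t (TensorProduct.map (contract (B.formSF w)) LinearMap.id z) +
      t • TensorProduct.map invol.toLinearMap (LinearMap.mulLeft ℂ (ι w))
        (B.regExpC t z) := by
  refine LinearMap.congr_fun (mul_truncExp_of_commutator
    (R := Module.End ℂ (ExteriorAlgebra ℂ V ⊗[ℂ] ExteriorAlgebra ℂ V))
    (P := TensorProduct.map (contract (B.formSF w)) LinearMap.id)
    (D := TensorProduct.map invol.toLinearMap (LinearMap.mulLeft ℂ (ι w)))
    (N := B.regC) ?_ ?_ B.regC_pow t) z
  -- The commutator of the contraction with `C` comes from contracting the first legs `b i`; the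
  -- identity `∑ (w, b i) a i = w` then puts `w` into the second factor.
  · refine TensorProduct.ext' fun x y => ?_
    simp only [Module.End.mul_apply, LinearMap.add_apply, TensorProduct.map_tmul, regC_tmul, map_sum,
      LinearMap.id_apply, contract_ι_mul, contract_invol]
    simp only [mul_neg, sub_neg_eq_add, TensorProduct.add_tmul, Finset.sum_add_distrib]
    rw [add_comm]
    congr 1
    simp only [TensorProduct.smul_tmul, ← TensorProduct.tmul_sum, AlgHom.toLinearMap_apply]
    congr 1
    conv_rhs => rw [← B.sum_formSF_b_smul_a w]
    simp [Finset.sum_mul]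
  · refine TensorProduct.ext' fun x y => ?_
    simp only [Module.End.mul_apply, TensorProduct.map_tmul, regC_tmul, map_sum,
      LinearMap.mulLeft_apply, AlgHom.toLinearMap_apply]
    refine Finset.sum_congr rfl fun i _ => ?_
    rw [ι_mul_ι_mul w, TensorProduct.tmul_neg, invol_ι_mul, TensorProduct.neg_tmul, neg_neg]

/-- Contraction in the second factor against `exp(t C)`. -/
theorem contract_expC' (w : V) (t : ℂ) (z : ExteriorAlgebra ℂ V ⊗[ℂ] ExteriorAlgebra ℂ V) :
    TensorProduct.map invol.toLinearMap (contract (B.formSF w)) (B.regExpC t z) =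
      B.regExpC t (TensorProduct.map invol.toLinearMap (contract (B.formSF w)) z) +
      t • TensorProduct.map (LinearMap.mulLeft ℂ (ι w)) LinearMap.id
        (B.regExpC t z) := by
  refine LinearMap.congr_fun (mul_truncExp_of_commutator
    (R := Module.End ℂ (ExteriorAlgebra ℂ V ⊗[ℂ] ExteriorAlgebra ℂ V))
    (P := TensorProduct.map invol.toLinearMap (contract (B.formSF w)))
    (D := TensorProduct.map (LinearMap.mulLeft ℂ (ι w)) LinearMap.id)
    (N := B.regC) ?_ ?_ B.regC_pow t) z
  · refine TensorProduct.ext' fun x y => ?_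
    simp only [Module.End.mul_apply, LinearMap.add_apply, TensorProduct.map_tmul, regC_tmul, map_sum,
      LinearMap.id_apply, contract_ι_mul, AlgHom.toLinearMap_apply, invol_ι_mul,
      invol_invol, LinearMap.mulLeft_apply]
    simp only [TensorProduct.tmul_sub, TensorProduct.neg_tmul, Finset.sum_sub_distrib, neg_sub,
      sub_neg_eq_add]
    rw [Finset.sum_add_distrib, add_comm]
    congr 1
    conv_rhs => rw [← B.sum_formSF_a_smul_b w]
    simp [Finset.sum_mul, TensorProduct.sum_tmul, TensorProduct.smul_tmul', ← B.formSF_neg w,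
      TensorProduct.neg_tmul]
  · refine TensorProduct.ext' fun x y => ?_
    simp only [Module.End.mul_apply, TensorProduct.map_tmul, regC_tmul, map_sum,
      LinearMap.mulLeft_apply, LinearMap.id_apply]
    refine Finset.sum_congr rfl fun i _ => ?_
    rw [ι_mul_ι_mul w, invol_ι_mul, mul_neg]


variable {B} in
-- The copairing may be computed in any symplectic basis: expand the first leg `b i` in the `e k`
-- and `g k`, and resum the coefficients into the second leg.
theorem sum_b_a {f : Submodule ℂ V} {n : ℕ} {e g : ℕ → V} (h : B.Adapted f n e g)
    {N : Type*} [AddCommGroup N] [Module ℂ N] (m : V →ₗ[ℂ] V →ₗ[ℂ] N) :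
    ∑ i, m (b i) (B.a i) = ∑ k ∈ Finset.range n, (m (g k) (e k) - m (e k) (g k)) := by
  have hv : ∀ v : V, v = ∑ k ∈ Finset.range n, (B.formSF (e k) v • g k - B.formSF (g k) v • e k) := by
    have hlin : (LinearMap.id : V →ₗ[ℂ] V) = ∑ k ∈ Finset.range n,
        ((B.formSF (e k)).smulRight (g k) - (B.formSF (g k)).smulRight (e k)) := by
      have hge : ∀ i < n, ∀ j < n, B.formSF (g i) (e j) = if i = j then -1 else 0 := by
        intro i hi j hj
        rw [← formSF_neg, h.eg j hj i hi]
        rcases eq_or_ne i j with rfl | hij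
        · simp
        · rw [if_neg hij, if_neg hij.symm, neg_zero]
      refine LinearMap.ext_on (s := e '' Set.Iio n ∪ g '' Set.Iio n) ?_ ?_
      · rw [Submodule.span_union, h.span_top]
      · rintro _ (⟨j, hj, rfl⟩ | ⟨j, hj, rfl⟩)
        · simp only [LinearMap.sum_apply]
          rw [Finset.sum_eq_single j]
          · simp [h.ee, hge j hj j hj]
          · intro k hk hkj
            simp [h.ee, hge k (Finset.mem_range.mp hk) j hj, hkj]
          · intro hh; exact absurd (Finset.mem_range.mpr hj) hh
        · simp only [LinearMap.sum_apply]
          rw [Finset.sum_eq_single j]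
          · simp [h.gg, h.eg j hj j hj]
          · intro k hk hkj
            simp [h.gg, h.eg k (Finset.mem_range.mp hk) j hj, hkj]
          · intro hh; exact absurd (Finset.mem_range.mpr hj) hh
    intro v
    simpa [LinearMap.sum_apply] using LinearMap.congr_fun hlin v
  have h1 : ∀ i, m (b i) (B.a i) = ∑ k ∈ Finset.range n,
      (m (g k) (B.formSF (e k) (b i) • B.a i) - m (e k) (B.formSF (g k) (b i) • B.a i)) := by
    intro i
    conv_lhs => rw [hv (b i)]
    simp [LinearMap.sum_apply]
  simp_rw [h1]
  rw [Finset.sum_comm]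
  refine Finset.sum_congr rfl fun k _ => ?_
  rw [Finset.sum_sub_distrib, ← map_sum, ← map_sum, sum_formSF_b_smul_a, sum_formSF_b_smul_a]

/-- The product `g j e j g (j + 1) e (j + 1) ⋯` of `m` pairs. -/
def pairs (e g : ℕ → V) : ℕ → ℕ → ExteriorAlgebra ℂ V
  | _, 0 => 1
  | j, m + 1 => ι (g j) * ι (e j) * pairs e g (j + 1) m

theorem sum_pow_eq_pairs (e g : ℕ → V) (m : ℕ) : ∀ j,
    (∑ k ∈ Finset.range m, ι (g (j + k)) * ι (e (j + k))) ^ m = (Nat.factorial m : ℂ) • pairs e g j m := by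
  induction m with
  | zero => intro j; simp [pairs]
  | succ m ih =>
    intro j
    have h0 := sum_pow_card_add_one (Finset.range m) (fun k => ι (g (j + 1 + k)) * ι (e (j + 1 + k)))
      (fun i _ j _ => (ι_mul_ι_commute _ _ _).eq) (fun i _ => ι_mul_ι_sq _ _)
    rw [Finset.card_range] at h0
    have h1 : ∑ k ∈ Finset.range m, ι (g (j + (k + 1))) * ι (e (j + (k + 1))) =
        ∑ k ∈ Finset.range m, ι (g (j + 1 + k)) * ι (e (j + 1 + k)) :=
      Finset.sum_congr rfl fun k _ => by rw [show j + (k + 1) = j + 1 + k by ring]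
    rw [Finset.sum_range_succ', add_comm, h1, add_zero]
    rw [add_pow_of_sq_zero (ι_mul_ι_commute _ _ _) (ι_mul_ι_sq _ _), h0, ih (j + 1), zero_add,
      mul_smul_comm, smul_smul, Nat.factorial_succ, Nat.cast_mul, pairs]

variable {f : Submodule ℂ V} {n : ℕ} {e g : ℕ → V}

theorem contract_pairs (θ : Module.Dual ℂ V) (m : ℕ) : ∀ j,
    (∀ k, j ≤ k → k < j + m → θ (e k) = 0 ∧ θ (g k) = 0) → contract θ (pairs e g j m) = 0 := by
  induction m with
  | zero => intro j _; simp [pairs]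
  | succ m ih =>
    intro j h
    rw [pairs, mul_assoc, contract_ι_mul, contract_ι_mul, (h j le_rfl (by omega)).1,
      (h j le_rfl (by omega)).2, ih (j + 1) fun k hk hk' => h k (by omega) (by omega)]
    simp

/-- The members of the pairs, in the opposite order, as a single sequence. -/
def interleave (n : ℕ) (e g : ℕ → V) (k : ℕ) : V :=
  if k % 2 = 0 then e (n - 1 - k / 2) else g (n - 1 - k / 2)

/-- Two descriptions of one top-degree element: `pairs` arises from powers of `Ĉ`, while `wedge` has
the lemmas on annihilation by vectors. -/
theorem pairs_eq_wedge (m : ℕ) : ∀ j, j + m = n → pairs e g j m = wedge (interleave n e g) (2 * m) := by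
  induction m with
  | zero => intro j _; rfl
  | succ m ih =>
    intro j hj
    have h1 : interleave n e g (2 * m) = e j := by
      rw [interleave, if_pos (by omega)]; congr 1; omega
    have h2 : interleave n e g (2 * m + 1) = g j := by
      rw [interleave, if_neg (by omega)]; congr 1; omega
    rw [pairs, ih (j + 1) (by omega), show 2 * (m + 1) = 2 * m + 1 + 1 by ring, wedge_succ, wedge_succ,
      h1, h2, mul_assoc]

/-- The product of all pairs of a symplectic basis. -/
def top (n : ℕ) (e g : ℕ → V) : ExteriorAlgebra ℂ V := pairs e g 0 n

variable {B}

namespace Adapted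

theorem ge (h : B.Adapted f n e g) {i j : ℕ} (hi : i < n) (hj : j < n) :
    B.formSF (g i) (e j) = if i = j then -1 else 0 := by
  rw [← formSF_neg, h.eg j hj i hi]
  rcases eq_or_ne i j with rfl | hij
  · simp
  · rw [if_neg hij, if_neg hij.symm, neg_zero]

theorem span_interleave (h : B.Adapted f n e g) :
    Submodule.span ℂ (interleave n e g '' Set.Iio (2 * n)) = ⊤ := by
  rw [eq_top_iff, ← h.span_top, sup_le_iff, Submodule.span_le, Submodule.span_le]
  constructor
  · rintro _ ⟨i, hi : i < n, rfl⟩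
    refine Submodule.subset_span ⟨2 * (n - 1 - i), Set.mem_Iio.mpr (by omega), ?_⟩
    rw [interleave, if_pos (by omega)]; congr 1; omega
  · rintro _ ⟨i, hi : i < n, rfl⟩
    refine Submodule.subset_span ⟨2 * (n - 1 - i) + 1, Set.mem_Iio.mpr (by omega), ?_⟩
    rw [interleave, if_neg (by omega)]; congr 1; omega

theorem ι_mul_top (h : B.Adapted f n e g) (v : V) : ι v * top n e g = 0 := by
  rw [top, pairs_eq_wedge n 0 (zero_add n)]
  exact ι_mul_wedge (h.span_interleave ▸ Submodule.mem_top)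

theorem top_mul_ι (h : B.Adapted f n e g) (v : V) : top n e g * ι v = 0 := by
  rw [top, pairs_eq_wedge n 0 (zero_add n)]
  exact wedge_mul_ι (h.span_interleave ▸ Submodule.mem_top)

theorem invol_top (n : ℕ) (e g : ℕ → V) : invol (top n e g) = top n e g := by
  rw [top, pairs_eq_wedge n 0 (zero_add n), invol_wedge, pow_mul]; simp

theorem hatC_eq (h : B.Adapted f n e g) :
    B.hatC = (2 : ℂ) • ∑ k ∈ Finset.range n, ι (g k) * ι (e k) := by
  have := B.sum_b_a h ((LinearMap.mul ℂ (ExteriorAlgebra ℂ V)).compl₁₂ ι ι)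
  simp only [LinearMap.compl₁₂_apply, LinearMap.mul_apply'] at this
  rw [hatC, this, Finset.smul_sum]
  exact Finset.sum_congr rfl fun k _ => by rw [ι_mul_ι (e k), sub_neg_eq_add, two_smul]

theorem hatC_pow (h : B.Adapted f n e g) :
    B.hatC ^ n = ((2 : ℂ) ^ n * (Nat.factorial n : ℂ)) • top n e g := by
  have := sum_pow_eq_pairs e g n 0
  simp only [zero_add] at this
  rw [h.hatC_eq, smul_pow, this, smul_smul, top]

/-- Otherwise the top form would vanish on all contractions and on all multiples of the top product,
hence be zero. -/
theorem topForm_top (h : B.Adapted f n e g) : topForm V (top n e g) ≠ 0 := by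
  intro h0
  refine topForm_ne_zero V ?_
  refine eq_zero_of_comp_contract (x := interleave n e g) (n := 2 * n)
    (θ := fun k => if k % 2 = 0 then -B.formSF (g (n - 1 - k / 2)) else B.formSF (e (n - 1 - k / 2)))
    ?_ (fun i _ y => topForm_contract _ y) fun y => ?_
  · intro i hi j hj
    rcases Nat.mod_two_eq_zero_or_one i with hi2 | hi2 <;>
    rcases Nat.mod_two_eq_zero_or_one j with hj2 | hj2
    · simp only [interleave, hi2, hj2, if_true, LinearMap.neg_apply, formSF_neg]
      rw [h.eg _ (by omega) _ (by omega)]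
      exact if_congr (by omega) rfl rfl
    · simp [interleave, hi2, hj2, h.gg]; omega
    · simp [interleave, hi2, hj2, h.ee]; omega
    · simp only [interleave, hi2, hj2, one_ne_zero, if_false]
      rw [h.eg _ (by omega) _ (by omega)]
      exact if_congr (by omega) rfl rfl
  · rw [← pairs_eq_wedge n 0 (zero_add n), ← top, mul_eq_counit_smul' h.top_mul_ι, map_smul, h0,
      smul_zero]

/-- The normalisation of the cointegral cancels the factor `2^n n!` with which the top product
occurs in `Ĉ^n`. -/
theorem cointegral_top (h : B.Adapted f n e g) : B.cointegral (top n e g) = 1 := by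
  have h1 : Module.finrank ℂ V / 2 = n := by rw [h.finrank_eq]; omega
  rw [cointegral, h1, h.hatC_pow, LinearMap.smul_apply, map_smul, smul_eq_mul, smul_eq_mul]
  have h2 := h.topForm_top
  have h3 : (Nat.factorial n : ℂ) ≠ 0 := Nat.cast_ne_zero.mpr (Nat.factorial_ne_zero n)
  field_simp

end Adapted

/-- Integration of the second factor against the cointegral. -/
def integ : ExteriorAlgebra ℂ V ⊗[ℂ] ExteriorAlgebra ℂ V →ₗ[ℂ] ExteriorAlgebra ℂ V :=
  (TensorProduct.rid ℂ (ExteriorAlgebra ℂ V)).toLinearMap ∘ₗ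
    LinearMap.lTensor (ExteriorAlgebra ℂ V) B.cointegral

variable (B)

theorem integ_tmul (x y : ExteriorAlgebra ℂ V) : B.integ (x ⊗ₜ[ℂ] y) = B.cointegral y • x := by
  simp [integ]

theorem phi_apply (β : ℂ) (x : ExteriorAlgebra ℂ V) :
    B.phi β x = β ^ 2 • B.integ (B.regExpC (-1) (1 ⊗ₜ[ℂ] x)) := rfl

theorem integ_map (P : ExteriorAlgebra ℂ V →ₗ[ℂ] ExteriorAlgebra ℂ V) (z) :
    B.integ (TensorProduct.map P LinearMap.id z) = P (B.integ z) := by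
  induction z using TensorProduct.induction_on with
  | zero => simp
  | tmul x y => simp [integ_tmul]
  | add x y hx hy => rw [map_add, map_add, hx, hy, map_add, map_add]

theorem cointegral_contract (θ : Module.Dual ℂ V) (x : ExteriorAlgebra ℂ V) :
    B.cointegral (contract θ x) = 0 := by
  rw [cointegral, LinearMap.smul_apply, topForm_contract, smul_zero]

variable (β : ℂ)

/-- Contract the first factor of `exp(-C)(1 ⊗ x)`. Contraction kills the `1`, so only the commutator
with `exp(-C)` survives, and it multiplies the second factor by `w`. -/
theorem phi_ι_mul (w : V) (x : ExteriorAlgebra ℂ V) :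
    B.phi β (ι w * x) = -contract (B.formSF w) (B.phi β x) := by
  have h1 := B.contract_expC w (-1) (1 ⊗ₜ[ℂ] x)
  have h2 : Commute (TensorProduct.map invol.toLinearMap (LinearMap.mulLeft ℂ (ι w))) B.regC := by
    refine TensorProduct.ext' fun x y => ?_
    simp only [Module.End.mul_apply, TensorProduct.map_tmul, regC_tmul, map_sum,
      LinearMap.mulLeft_apply, AlgHom.toLinearMap_apply]
    refine Finset.sum_congr rfl fun i _ => ?_
    rw [ι_mul_ι_mul w, TensorProduct.tmul_neg, invol_ι_mul, TensorProduct.neg_tmul, neg_neg]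
  have h3 : TensorProduct.map invol.toLinearMap (LinearMap.mulLeft ℂ (ι w)) (B.regExpC (-1) (1 ⊗ₜ[ℂ] x)) =
      B.regExpC (-1) (1 ⊗ₜ[ℂ] (ι w * x)) := by
    have h4 : Commute (TensorProduct.map invol.toLinearMap (LinearMap.mulLeft ℂ (ι w)))
        (B.regExpC (-1)) :=
      Commute.sum_right _ _ _ fun k _ => (h2.pow_right k).smul_right _
    have h5 := LinearMap.congr_fun h4.eq (1 ⊗ₜ[ℂ] x)
    simpa only [Module.End.mul_apply, TensorProduct.map_tmul, AlgHom.toLinearMap_apply, map_one,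
      LinearMap.mulLeft_apply] using h5
  rw [TensorProduct.map_tmul, contract_one, TensorProduct.zero_tmul, map_zero, zero_add, h3] at h1
  rw [phi_apply, phi_apply, map_smul, ← integ_map, h1, map_smul]
  simp

/-- Contract the second factor of `exp(-C)(1 ⊗ x)` instead. The cointegral kills the contraction, so
the two remaining terms of the commutator formula must cancel. -/
theorem phi_contract (w : V) (x : ExteriorAlgebra ℂ V) :
    B.phi β (contract (B.formSF w) x) = ι w * B.phi β x := by
  have h1 := congrArg B.integ (B.contract_expC' w (-1) (1 ⊗ₜ[ℂ] x))
  have h2 : ∀ z, B.integ (TensorProduct.map invol.toLinearMap (contract (B.formSF w)) z) = 0 := by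
    intro z
    induction z using TensorProduct.induction_on with
    | zero => simp
    | tmul x y => rw [TensorProduct.map_tmul, integ_tmul, cointegral_contract, zero_smul]
    | add x y hx hy => rw [map_add, map_add, hx, hy, add_zero]
  rw [h2, map_add, map_smul, integ_map, neg_one_smul, TensorProduct.map_tmul, eq_comm,
    add_neg_eq_zero] at h1
  rw [phi_apply, phi_apply, mul_smul_comm]
  simpa using congrArg (β ^ 2 • ·) h1

variable {B} {β}

namespace Adapted

/-- On `1 ⊗ top` the element `C` acts as zero, so only the constant term of the exponential
contributes. -/
theorem phi_top (h : B.Adapted f n e g) : B.phi β (top n e g) = β ^ 2 • 1 := by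
  have : B.regC (1 ⊗ₜ[ℂ] top n e g) = 0 := by
    rw [regC_tmul]
    exact Finset.sum_eq_zero fun i _ => by rw [h.ι_mul_top, TensorProduct.tmul_zero]
  rw [phi_apply, regExpC, truncExp_apply_of_eq_zero (by omega) _ this, integ_tmul, h.cointegral_top,
    one_smul]

variable (hβ : β ^ 2 = 1)
include hβ

/-- This interpolates between `φ(top) = 1` at `k = 0` and `φ(wedge g n) = wedge g n` at `m = 0`.
Contraction with `(g k,-)` removes `e k` from its pair and leaves `g k`, while on the side of `φ` it
multiplies by `g k`. -/
theorem phi_wedge_mul_pairs (h : B.Adapted f n e g) (k : ℕ) : ∀ m, k + m = n →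
    B.phi β (wedge g k * pairs e g k m) = wedge g k := by
  induction k with
  | zero =>
    intro m hm
    obtain rfl : m = n := by omega
    rw [wedge_zero, one_mul, ← top, h.phi_top, hβ, one_smul]
  | succ k ih =>
    intro m hm
    have h1 : contract (B.formSF (g k)) (wedge g k * pairs e g (k + 1) m) = 0 := by
      rw [contract_mul, contract_wedge fun j _ => h.gg _ _, contract_pairs _ _ _ fun j hj hj' =>
        ⟨by rw [h.ge (by omega) (by omega), if_neg (by omega)], h.gg _ _⟩]
      simp
    have h2 : contract (B.formSF (g k)) (wedge g k * pairs e g k (m + 1)) =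
        wedge g (k + 1) * pairs e g (k + 1) m := by
      rw [pairs, ← mul_assoc, ← (ι_mul_ι_commute (g k) (e k) (wedge g k)).eq, mul_assoc, mul_assoc,
        contract_ι_mul, contract_ι_mul, h1, h.gg, h.ge (by omega) (by omega), if_pos rfl, wedge_succ,
        mul_assoc]
      simp
    rw [← h2, phi_contract, ih (m + 1) (by omega), wedge_succ]

theorem phi_wedge (h : B.Adapted f n e g) : B.phi β (wedge g n) = wedge g n := by
  have := phi_wedge_mul_pairs hβ h n 0 rfl
  rwa [pairs, mul_one] at this

/-- Applying the two exchange rules in turn gives `φ(φ(x)) = invol x * u` with `u = φ(φ(1))`. Taking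
`x = top` shows that `φ(1)` is a multiple of `top`, hence that `u` is a scalar; the fixed vector
`wedge g n`, of parity `(-1)^n`, determines that scalar. -/
theorem phi_phi (h : B.Adapted f n e g) (x : ExteriorAlgebra ℂ V) :
    B.phi β (B.phi β x) = (-1 : ℂ) ^ n • invol x ∧ B.phi β 1 = (-1 : ℂ) ^ n • top n e g := by
  have h1 : ∀ x, B.phi β (B.phi β x) = invol x * B.phi β (B.phi β 1) := by
    intro x
    induction x using ext_induction with
    | h1 => simp
    | hs c x hx => simp only [map_smul, hx, smul_mul_assoc]
    | ha x y hx hy => simp only [map_add, hx, hy, add_mul]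
    | hm v x hx => rw [phi_ι_mul, map_neg, phi_contract, hx, invol_ι_mul, neg_mul, mul_assoc]
  set u := B.phi β (B.phi β 1) with hu
  have h2 : B.phi β 1 = (ExteriorAlgebra.algebraMapInv u : ℂ) • top n e g := by
    have := h1 (top n e g)
    rwa [h.phi_top, hβ, one_smul, invol_top, mul_eq_counit_smul' h.top_mul_ι] at this
  have h3 : u = (ExteriorAlgebra.algebraMapInv u : ℂ) • 1 := by
    conv_lhs => rw [hu, h2, map_smul, h.phi_top, hβ, one_smul]
  have h4 := h1 (wedge g n)
  rw [h.phi_wedge hβ, h.phi_wedge hβ, h3, invol_wedge, mul_smul_comm, mul_one, smul_smul] at h4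
  have h5 : wedge g n ≠ 0 := wedge_ne_zero h.eg
  have h6 : (ExteriorAlgebra.algebraMapInv u : ℂ) * (-1) ^ n = 1 := by
    by_contra hne
    exact h5 ((smul_eq_zero.mp (by rw [sub_smul, ← h4, one_smul, sub_self] :
      ((ExteriorAlgebra.algebraMapInv u : ℂ) * (-1) ^ n - 1) • wedge g n = 0)).resolve_left
        (sub_ne_zero.mpr hne))
  have h7 : (ExteriorAlgebra.algebraMapInv u : ℂ) = (-1) ^ n := by
    have h8 : ((-1 : ℂ) ^ n) * (-1) ^ n = 1 := by rw [← mul_pow]; simp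
    linear_combination (-1 : ℂ) ^ n * h6 - (ExteriorAlgebra.algebraMapInv u : ℂ) * h8
  exact ⟨by rw [h1, h3, h7, mul_smul_comm, mul_one], by rw [h2, h7]⟩

theorem phi_one (h : B.Adapted f n e g) : B.phi β 1 = (-1 : ℂ) ^ n • top n e g :=
  (phi_phi hβ h 1).2

end Adapted

/-- Up to sign the square of `φ` is the parity involution. -/
theorem phi_bijective (hβ : β ^ 2 = 1) : Function.Bijective (B.phi β) := by
  obtain ⟨f, hf⟩ := B.exists_isLagrangian
  obtain ⟨n, e, g, h⟩ := hf.exists_adapted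
  have h1 := fun x => (Adapted.phi_phi hβ h x).1
  have h2 : ((-1 : ℂ) ^ n) * (-1) ^ n = 1 := by rw [← mul_pow]; simp
  constructor
  · intro x y hxy
    have h3 := h1 x
    rw [hxy, h1 y] at h3
    have h4 := congrArg (fun z => invol ((-1 : ℂ) ^ n • z)) h3
    simpa [smul_smul, h2] using h4.symm
  · intro x
    refine ⟨B.phi β ((-1 : ℂ) ^ n • invol x), ?_⟩
    rw [h1, map_smul, invol_invol, smul_smul, h2, one_smul]

/-- A linear form on `S(h)` which vanishes on the multiples of the elements of a Lagrangian subspace `f`,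
and on the contractions with them, is determined by its value on the product of a complementary basis. -/
theorem Adapted.eq_zero (h : B.Adapted f n e g) {F : ExteriorAlgebra ℂ V →ₗ[ℂ] ℂ}
    (h1 : ∀ w ∈ f, ∀ x, F (ι w * x) = 0) (h2 : ∀ w ∈ f, ∀ x, F (contract (B.formSF w) x) = 0)
    (h0 : F (wedge g n) = 0) : F = 0 := by
  refine eq_zero_of_comp_contract (x := g) (θ := fun k => B.formSF (e k)) h.eg
    (fun i _ y => h2 _ (h.mem i) y) fun y => ?_
  have h3 : ∀ v, ∀ y, F (wedge g n * (ι v * y)) = 0 := by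
    intro v y
    have hv : v ∈ Submodule.span ℂ (e '' Set.Iio n) ⊔ Submodule.span ℂ (g '' Set.Iio n) :=
      h.span_top ▸ Submodule.mem_top
    obtain ⟨v1, hv1, v2, hv2, rfl⟩ := Submodule.mem_sup.mp hv
    rw [h.span_e] at hv1
    -- The complementary part of `v` is absorbed by the product of the `g k`; the part in `f` moves
    -- to the front, where `F` kills it.
    rw [← mul_assoc, map_add, mul_add, wedge_mul_ι hv2, add_zero, mul_ι, mul_assoc]
    exact h1 _ hv1 _
  induction y using ext_induction with
  | h1 => rw [mul_one, h0]
  | hs c x hx => rw [mul_smul_comm, map_smul, hx, smul_zero]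
  | ha x y hx hy => rw [mul_add, map_add, hx, hy, add_zero]
  | hm v x hx => exact h3 v x

end SymplecticForm
end phi

section components

variable {V : Type u} [AddCommGroup V] [Module ℂ V] [FiniteDimensional ℂ V]
variable {B : SymplecticForm V} {β : ℂ} (H : Alg B β)

/-! ### Evaluation of the structure maps on homogeneous elements -/

theorem SuperSpace.swap_tmul (X Y : SuperSpace.{u}) (x : X.carrier) (y : Y.carrier) :
    SuperSpace.swap X Y (x ⊗ₜ y) = (1 / 2 : ℂ) • (y ⊗ₜ[ℂ] x + y ⊗ₜ[ℂ] X.par x + Y.par y ⊗ₜ[ℂ] x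
      - Y.par y ⊗ₜ[ℂ] X.par x) := by
  simp [SuperSpace.swap]

theorem SuperSpace.swap_even_left (X Y : SuperSpace.{u}) {x : X.carrier} (hx : X.par x = x)
    (y : Y.carrier) : SuperSpace.swap X Y (x ⊗ₜ y) = y ⊗ₜ[ℂ] x := by
  rw [swap_tmul, hx, add_sub_cancel_right, ← two_smul ℂ, smul_smul]; norm_num

theorem SuperSpace.swap_even_right (X Y : SuperSpace.{u}) (x : X.carrier) {y : Y.carrier}
    (hy : Y.par y = y) : SuperSpace.swap X Y (x ⊗ₜ y) = y ⊗ₜ[ℂ] x := by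
  rw [swap_tmul, hy, add_assoc, add_comm (y ⊗ₜ[ℂ] X.par x), ← add_assoc, add_sub_cancel_right,
    ← two_smul ℂ, smul_smul]; norm_num

theorem comul_one : comul V 1 = 1 ⊗ₜ[ℂ] 1 := by
  simp [comul]

theorem coact_one (U : Rep V) (x : U.carrier) : coact U (1 ⊗ₜ x) = 1 ⊗ₜ[ℂ] x := by
  simp [coact, comul_one, Rep.actMap]

theorem coactAntipode_one (U : Rep V) (x : U.carrier) : coactAntipode U (1 ⊗ₜ x) = 1 ⊗ₜ[ℂ] x := by
  simp [coactAntipode, comul_one, Rep.actMap, antipode]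

theorem Rep.actS_ι (X : Rep V) (v : V) : X.actS (ExteriorAlgebra.ι ℂ v) = X.act v :=
  ExteriorAlgebra.lift_ι_apply _ _ _ _

theorem Rep.actS_ι_mul (X : Rep V) (v : V) (g : ExteriorAlgebra ℂ V) (x : X.carrier) :
    X.actS (ExteriorAlgebra.ι ℂ v * g) x = X.act v (X.actS g x) := by
  rw [map_mul, X.actS_ι]; rfl

theorem Rep.par_actS (X : Rep V) (g : ExteriorAlgebra ℂ V) (x : X.carrier) :
    X.par (X.actS g x) = X.actS (invol g) (X.par x) := by
  induction g using ext_induction with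
  | h1 => simp
  | hs c g hg => simp [hg]
  | ha g h hg hh => simp [hg, hh]
  | hm v g hg => rw [X.actS_ι_mul, X.par_act_apply, hg, invol_ι_mul, map_neg, LinearMap.neg_apply,
      X.actS_ι_mul]

namespace Alg

/-- The component `H_0 ⊗ H_0 → H_0` of the multiplication. -/
def m00 : H.obj.s0.carrier ⊗[ℂ] H.obj.s0.carrier →ₗ[ℂ] H.obj.s0.carrier :=
  H.mul.f0 ∘ₗ LinearMap.inl ℂ _ _

/-- The component `H_0 ⊗ H_1 → H_1` of the multiplication. -/
def m01 : H.obj.s0.carrier ⊗[ℂ] H.obj.s1.carrier →ₗ[ℂ] H.obj.s1.carrier :=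
  H.mul.f1 ∘ₗ LinearMap.inl ℂ _ _

/-- The component `H_1 ⊗ H_0 → H_1` of the multiplication. -/
def m10 : H.obj.s1.carrier ⊗[ℂ] H.obj.s0.carrier →ₗ[ℂ] H.obj.s1.carrier :=
  H.mul.f1 ∘ₗ LinearMap.inr ℂ _ _

/-- The component `S ⊗ H_1 ⊗ H_1 → H_0` of the multiplication. -/
def m11 : ExteriorAlgebra ℂ V ⊗[ℂ] (H.obj.s1.carrier ⊗[ℂ] H.obj.s1.carrier) →ₗ[ℂ]
    H.obj.s0.carrier :=
  H.mul.f0 ∘ₗ LinearMap.inr ℂ _ _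

theorem m00_apply (z) : H.mul.f0 (z, 0) = H.m00 z := rfl
theorem m01_apply (z) : H.mul.f1 (z, 0) = H.m01 z := rfl
theorem m10_apply (z) : H.mul.f1 (0, z) = H.m10 z := rfl
theorem m11_apply (z) : H.mul.f0 (0, z) = H.m11 z := rfl

theorem assoc_f0 (z) : H.mul.f0 (((GMap.id H.obj).tensor H.mul).f0 z) =
    H.mul.f0 ((H.mul.tensor (GMap.id H.obj)).f0 ((associator B β H.obj H.obj H.obj).f0 z)) :=
  LinearMap.congr_fun (congrArg GMap.f0 H.mul_assoc) z

theorem assoc_f1 (z) : H.mul.f1 (((GMap.id H.obj).tensor H.mul).f1 z) =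
    H.mul.f1 ((H.mul.tensor (GMap.id H.obj)).f1 ((associator B β H.obj H.obj H.obj).f1 z)) :=
  LinearMap.congr_fun (congrArg GMap.f1 H.mul_assoc) z

theorem m01_m01 (a b : H.obj.s0.carrier) (y : H.obj.s1.carrier) :
    H.m01 (a ⊗ₜ H.m01 (b ⊗ₜ y)) = H.m01 (H.m00 (a ⊗ₜ b) ⊗ₜ y) := by
  have := H.assoc_f1 (a ⊗ₜ (b ⊗ₜ y, 0), 0)
  simpa [GMap.tensor, GMap.id, associator, m01, m00] using this

/-- Associativity in sector 011 at `g = 1`, where the coaction is trivial. General `g` is recovered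
from equivariance of the multiplication. -/
theorem m00_m11 (a : H.obj.s0.carrier) (y z : H.obj.s1.carrier) :
    H.m00 (a ⊗ₜ H.m11 (1 ⊗ₜ (y ⊗ₜ z))) = H.m11 (1 ⊗ₜ (H.m01 (a ⊗ₜ y) ⊗ₜ z)) := by
  have := H.assoc_f0 (a ⊗ₜ (0, 1 ⊗ₜ (y ⊗ₜ z)), 0)
  have h1 : assoc011 H.obj.s0 H.obj.s1 H.obj.s1 (a ⊗ₜ (1 ⊗ₜ (y ⊗ₜ z))) =
      1 ⊗ₜ[ℂ] ((a ⊗ₜ[ℂ] y) ⊗ₜ[ℂ] z) := by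
    have h2 := SuperSpace.swap_even_right H.obj.s0.toSuperSpace (reg V).toSuperSpace a (y := 1)
      (map_one invol)
    simp [assoc011, h2, coactAntipode_one]
  simpa [GMap.tensor, GMap.id, associator, m01, m00, m11, h1] using this

theorem m11_m10 (a : H.obj.s0.carrier) {y z : H.obj.s1.carrier} 
    (hyz : TensorProduct.map H.obj.s1.par H.obj.s1.par (y ⊗ₜ z) = y ⊗ₜ z) :
    H.m11 (1 ⊗ₜ (y ⊗ₜ H.m10 (z ⊗ₜ a))) = H.m00 (H.m11 (1 ⊗ₜ (y ⊗ₜ z)) ⊗ₜ a) := by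
  have := H.assoc_f0 (0, 1 ⊗ₜ (y ⊗ₜ (0, z ⊗ₜ a)))
  have h1 : assoc110 H.obj.s1 H.obj.s1 H.obj.s0 (1 ⊗ₜ (y ⊗ₜ (z ⊗ₜ a))) =
      (1 ⊗ₜ[ℂ] (y ⊗ₜ[ℂ] z)) ⊗ₜ[ℂ] a := by
    have h2 := SuperSpace.swap_even_left (H.obj.s1.tensor H.obj.s1) H.obj.s0.toSuperSpace hyz a
    have h3 := SuperSpace.swap_even_right H.obj.s0.toSuperSpace (H.obj.s1.tensor H.obj.s1) a hyz
    simp [assoc110, h2, h3, coact_one]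
  simpa [GMap.tensor, GMap.id, associator, m10, m00, m11, h1] using this

/-- Sector 111, the only one in which `φ` enters. The hypothesis `hg` absorbs the Koszul sign of
moving `x` past `g`, so that the lemma serves even and odd `H_1` alike. -/
theorem m10_m11 {x : H.obj.s1.carrier} {g g' : ExteriorAlgebra ℂ V} (y z : H.obj.s1.carrier)
    (hg : SuperSpace.swap H.obj.s1 (reg V).toSuperSpace (x ⊗ₜ g) = g' ⊗ₜ x) :
    H.m10 (x ⊗ₜ H.m11 (g ⊗ₜ (y ⊗ₜ z))) = H.m01 (H.m11 (B.phi β g' ⊗ₜ (x ⊗ₜ y)) ⊗ₜ z) := by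
  have := H.assoc_f1 (0, x ⊗ₜ (0, g ⊗ₜ (y ⊗ₜ z)))
  have h1 : assoc111 B β H.obj.s1 H.obj.s1 H.obj.s1 (x ⊗ₜ (g ⊗ₜ (y ⊗ₜ z))) =
      (B.phi β g' ⊗ₜ[ℂ] (x ⊗ₜ[ℂ] y)) ⊗ₜ[ℂ] z := by
    simp [assoc111, hg]
  simpa [GMap.tensor, GMap.id, associator, m10, m01, m11, h1] using this

theorem act_m00 (v : V) (a b : H.obj.s0.carrier) : H.obj.s0.act v (H.m00 (a ⊗ₜ b)) =
    H.m00 (H.obj.s0.act v a ⊗ₜ b) + H.m00 (H.obj.s0.par a ⊗ₜ H.obj.s0.act v b) := by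
  have := LinearMap.congr_fun (H.mul_mor.equivariant v) (a ⊗ₜ b, 0)
  simp only [LinearMap.comp_apply] at this
  rw [m00, ← map_add]
  simpa using this.symm

theorem par_m11 (g : ExteriorAlgebra ℂ V) (y z : H.obj.s1.carrier) :
    H.obj.s0.par (H.m11 (g ⊗ₜ (y ⊗ₜ z))) =
      H.m11 (invol g ⊗ₜ (H.obj.s1.par y ⊗ₜ H.obj.s1.par z)) := by
  have := LinearMap.congr_fun H.mul_mor.even0 (0, g ⊗ₜ (y ⊗ₜ z))
  simpa [m11, invol] using this.symm

theorem act_m11 (v : V) (g : ExteriorAlgebra ℂ V) (z : H.obj.s1.carrier ⊗[ℂ] H.obj.s1.carrier) :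
    H.obj.s0.act v (H.m11 (g ⊗ₜ z)) = H.m11 ((ExteriorAlgebra.ι ℂ v * g) ⊗ₜ z) := by
  have := LinearMap.congr_fun (H.mul_mor.equivariant v) (0, g ⊗ₜ z)
  simpa [m11] using this.symm

theorem actS_m11 (g h : ExteriorAlgebra ℂ V) (z : H.obj.s1.carrier ⊗[ℂ] H.obj.s1.carrier) :
    H.obj.s0.actS g (H.m11 (h ⊗ₜ z)) = H.m11 ((g * h) ⊗ₜ z) := by
  induction g using ext_induction with
  | h1 => simp
  | hs c g hg => simp [hg, ← TensorProduct.smul_tmul']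
  | ha g h hg hh => simp [hg, hh, add_mul, TensorProduct.add_tmul]
  | hm v g hg => rw [Rep.actS_ι_mul, hg, act_m11, _root_.mul_assoc]

/-- The unit element of `H_0`. -/
def one : H.obj.s0.carrier := H.unit.f0 (ULift.up 1)

theorem m00_one (a : H.obj.s0.carrier) : H.m00 (a ⊗ₜ H.one) = a := by
  have := LinearMap.congr_fun (congrArg GMap.f0 H.mul_unit) (a ⊗ₜ ULift.up 1, 0)
  simpa [GMap.comp, GMap.tensor, GMap.id, rightUnitor, m00, one] using this

theorem one_m00 (a : H.obj.s0.carrier) : H.m00 (H.one ⊗ₜ a) = a := by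
  have := LinearMap.congr_fun (congrArg GMap.f0 H.unit_mul) (ULift.up 1 ⊗ₜ a, 0)
  simpa [GMap.comp, GMap.tensor, GMap.id, leftUnitor, m00, one] using this

theorem one_m01 (y : H.obj.s1.carrier) : H.m01 (H.one ⊗ₜ y) = y := by
  have := LinearMap.congr_fun (congrArg GMap.f1 H.unit_mul) (ULift.up 1 ⊗ₜ y, 0)
  simpa [GMap.comp, GMap.tensor, GMap.id, leftUnitor, m01, one] using this

end Alg
end components

section good

variable {V : Type u} [AddCommGroup V] [Module ℂ V] [FiniteDimensional ℂ V]

local notation "ι" => ExteriorAlgebra.ι ℂ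

/-! ### The structure of the algebras satisfying the five conditions -/

theorem map_truncExp {R R' : Type*} [Ring R] [Algebra ℂ R] [Ring R'] [Algebra ℂ R'] (F : R →ₐ[ℂ] R')
    (m : ℕ) (t : ℂ) (N : R) : F (truncExp m t N) = truncExp m t (F N) := by
  simp [truncExp]

theorem truncExp_zero {R : Type*} [Ring R] [Algebra ℂ R] (m : ℕ) (N : R) :
    truncExp (m + 1) 0 N = 1 := by
  rw [truncExp, Finset.sum_range_succ', Finset.sum_eq_zero]
  · simp
  · intro k _; simp

/-- The first leg of `C` is odd, so `C` anticommutes with the parity of the first factor, and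
conjugation by it reverses the sign of `t`. -/
theorem SymplecticForm.expC_par (B : SymplecticForm V) (t : ℂ) (X Y : Rep V) :
    B.expC t X Y ∘ₗ TensorProduct.map X.par LinearMap.id =
      TensorProduct.map X.par LinearMap.id ∘ₗ B.expC (-t) X Y := by
  have h1 : B.actC X Y * TensorProduct.map X.par LinearMap.id =
      (-1 : ℂ) • (TensorProduct.map X.par LinearMap.id * B.actC X Y) := by
    refine TensorProduct.ext' fun x y => ?_
    simp [SymplecticForm.actC_tmul, Rep.act_par_apply, X.par_par_apply, TensorProduct.neg_tmul]
  have h2 : ∀ k, B.actC X Y ^ k * TensorProduct.map X.par LinearMap.id =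
      (-1 : ℂ) ^ k • (TensorProduct.map X.par LinearMap.id * B.actC X Y ^ k) := by
    intro k
    induction k with
    | zero => simp
    | succ k ih =>
      rw [pow_succ, mul_assoc, h1, mul_smul_comm, ← mul_assoc, ih, pow_succ' (-1 : ℂ), mul_smul,
        smul_mul_assoc, mul_assoc]
  change B.expC t X Y * TensorProduct.map X.par LinearMap.id =
      TensorProduct.map X.par LinearMap.id * B.expC (-t) X Y
  simp only [SymplecticForm.expC, Finset.sum_mul, Finset.mul_sum, smul_mul_assoc, h2, mul_smul_comm,
    smul_smul]
  refine Finset.sum_congr rfl fun k _ => ?_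
  congr 1
  rw [neg_pow t]; ring

variable {B : SymplecticForm V} {β : ℂ} {H : Alg B β}

namespace Alg.IsGood

theorem par_eq (hH : H.IsGood) (y : H.obj.s1.carrier) : H.obj.s1.par y = β • y := by
  have h1 : β⁻¹ • H.obj.s1.par y = y :=
    LinearMap.congr_fun (congrArg GMap.f1 hH.trivial_twist) y
  -- For `β = 0` the convention `0⁻¹ = 0` makes the twist zero on `H_1`, so that every `y` vanishes.
  rcases eq_or_ne β 0 with rfl | hβ
  · rw [inv_zero, zero_smul] at h1
    rw [← h1, map_zero, smul_zero]
  · rw [← h1, smul_smul, mul_inv_cancel₀ hβ, one_smul, h1]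

theorem beta_sq (hH : H.IsGood) : β = 1 ∨ β = -1 := by
  have := hH.twisted
  obtain ⟨y, hy⟩ := exists_ne (0 : H.obj.s1.carrier)
  have h1 := H.obj.s1.par_par_apply y
  rw [hH.par_eq, hH.par_eq, smul_smul] at h1
  have h2 : (β * β - 1) • y = 0 := by rw [sub_smul, h1, one_smul, sub_self]
  exact mul_self_eq_one_iff.mp (sub_eq_zero.mp ((smul_eq_zero.mp h2).resolve_right hy))

/-- The twist is `exp(-Ĉ)`; agreeing with `exp(0)`, it forces the nilpotent operator `Ĉ` to vanish.
-/
theorem actS_hatC [Nontrivial V] (hH : H.IsGood) : H.obj.s0.actS B.hatC = 0 := by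
  have h1 : H.obj.s0.actS (B.expHatC (-1)) = LinearMap.id := congrArg GMap.f0 hH.trivial_twist
  rw [SymplecticForm.expHatC_eq, map_truncExp] at h1
  -- Since `d ≥ 1`, the truncation at `d + 1` terms has the form `m + 2` and so contains the linear
  -- term.
  obtain ⟨m, hm⟩ : ∃ m, Module.finrank ℂ V = m + 1 :=
    ⟨Module.finrank ℂ V - 1, by have := Module.finrank_pos (R := ℂ) (M := V); omega⟩
  have hn : IsNilpotent (H.obj.s0.actS B.hatC) :=
    ⟨Module.finrank ℂ V + 1, by rw [← map_pow, B.hatC_pow, map_zero]⟩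
  rw [hm] at h1
  have := comp_eq_zero_of_truncExp m (t := -1) (t' := 0) (by norm_num) hn (F := LinearMap.id)
    (by rw [h1, truncExp_zero]; rfl)
  simpa using this

theorem actS_expHatC [Nontrivial V] (hH : H.IsGood) (t : ℂ) :
    H.obj.s0.actS (B.expHatC t) = LinearMap.id := by
  rw [SymplecticForm.expHatC_eq, map_truncExp, hH.actS_hatC]
  rw [← LinearMap.id_comp (truncExp _ t _)]
  exact truncExp_of_mul_eq_zero (by omega) t (by simp)

theorem swap_left (hH : H.IsGood) (Y : SuperSpace.{u}) (x : H.obj.s1.carrier) (y : Y.carrier) :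
    SuperSpace.swap H.obj.s1 Y (x ⊗ₜ y) =
      ((1 / 2 : ℂ) • ((1 + β) • y + (1 - β) • Y.par y)) ⊗ₜ[ℂ] x := by
  rw [SuperSpace.swap_tmul, hH.par_eq, ← TensorProduct.smul_tmul']
  congr 1
  simp only [TensorProduct.add_tmul, TensorProduct.tmul_smul, add_smul, sub_smul, one_smul,
    TensorProduct.sub_tmul, TensorProduct.smul_tmul']
  abel

theorem swap_right (hH : H.IsGood) (Y : SuperSpace.{u}) (x : H.obj.s1.carrier) (y : Y.carrier) :
    SuperSpace.swap Y H.obj.s1 (y ⊗ₜ x) =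
      x ⊗ₜ[ℂ] ((1 / 2 : ℂ) • ((1 + β) • y + (1 - β) • Y.par y)) := by
  rw [SuperSpace.swap_tmul, hH.par_eq, TensorProduct.tmul_smul]
  congr 1
  simp only [TensorProduct.tmul_add, TensorProduct.tmul_smul, add_smul, sub_smul, one_smul,
    TensorProduct.tmul_sub, ← TensorProduct.smul_tmul']
  abel

theorem comm_f0 (hH : H.IsGood) (z) : H.mul.f0 ((braiding B β H.obj H.obj).f0 z) = H.mul.f0 z :=
  LinearMap.congr_fun (congrArg GMap.f0 hH.commutative) z

theorem comm_f1 (hH : H.IsGood) (z) : H.mul.f1 ((braiding B β H.obj H.obj).f1 z) = H.mul.f1 z :=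
  LinearMap.congr_fun (congrArg GMap.f1 hH.commutative) z

theorem m00_braid (hH : H.IsGood) (z : H.obj.s0.carrier ⊗[ℂ] H.obj.s0.carrier) :
    H.m00 (braid00 B H.obj.s0 H.obj.s0 z) = H.m00 z := by
  have := hH.comm_f0 (z, 0)
  simpa [braiding, m00] using this

variable [Nontrivial V]

/-- Commutativity in sector 01, where `σ` acts trivially. The combination of `a` and its parity
image is the Koszul sign against a vector on which parity is `β`: it is `a` for `β = 1` and `par a`
for `β = -1`. -/
theorem m01_aux (hH : H.IsGood) (a : H.obj.s0.carrier) (y : H.obj.s1.carrier) :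
    H.m10 (y ⊗ₜ ((1 / 2 : ℂ) • ((1 + β) • a + (1 - β) • H.obj.s0.par a))) = H.m01 (a ⊗ₜ y) := by
  have := hH.comm_f1 (a ⊗ₜ y, 0)
  rw [← hH.swap_right H.obj.s0.toSuperSpace]
  simpa [braiding, m01, m10, braid01, hH.actS_expHatC] using this

theorem m10_aux (hH : H.IsGood) (a : H.obj.s0.carrier) (y : H.obj.s1.carrier) :
    H.m01 (((1 / 2 : ℂ) • ((1 + β) • H.obj.s0.par a + (1 - β) • a)) ⊗ₜ y) = H.m10 (y ⊗ₜ a) := by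
  have := hH.comm_f1 (0, y ⊗ₜ a)
  have h1 := hH.swap_left H.obj.s0.toSuperSpace y (H.obj.s0.par a)
  rw [H.obj.s0.par_par_apply] at h1
  rw [← h1]
  simpa [braiding, m01, m10, braid10, hH.actS_expHatC] using this

theorem m10_eq (hH : H.IsGood) (a : H.obj.s0.carrier) (y : H.obj.s1.carrier) :
    H.m10 (y ⊗ₜ a) = H.m01 (a ⊗ₜ y) ∧ H.m01 (H.obj.s0.par a ⊗ₜ y) = H.m01 (a ⊗ₜ y) := by
  have hn : (1 / 2 : ℂ) * (1 + 1) = 1 := by norm_num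
  have hn' : (1 / 2 : ℂ) * (1 - -1) = 1 := by norm_num
  have h1 := fun a => hH.m01_aux a y
  have h2 := fun a => hH.m10_aux a y
  have hp := H.obj.s0.par_par_apply a
  rcases hH.beta_sq with hβ | hβ
  · simp only [hβ, sub_self, zero_smul, add_zero, smul_smul, hn, one_smul] at h1 h2
    exact ⟨h1 a, (h2 a).trans (h1 a)⟩
  · simp only [hβ, add_neg_cancel, zero_smul, zero_add, smul_smul, hn', one_smul] at h1 h2
    have h3 := h1 (H.obj.s0.par a)
    rw [hp] at h3
    exact ⟨(h2 a).symm, h3.symm.trans (h2 a).symm⟩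

/-- Let `Q` act by `a` after `c`, and `R` in the opposite order. Sector 00 says `Q = R ∘ exp(-C)`.
Neither map sees the parity of its arguments, so `exp(-C)` may be replaced by `exp(C)`, and `R ∘ C =
0` follows; both claims are consequences. -/
theorem m01_comm_and (hH : H.IsGood) (a c : H.obj.s0.carrier) (y : H.obj.s1.carrier) :
    H.m01 (a ⊗ₜ H.m01 (c ⊗ₜ y)) = H.m01 (c ⊗ₜ H.m01 (a ⊗ₜ y)) ∧
    ∑ i, H.m01 (H.obj.s0.act (B.a i) c ⊗ₜ
      H.m01 (H.obj.s0.act (SymplecticForm.b i) a ⊗ₜ y)) = 0 := by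
  have hpar := fun a y => (hH.m10_eq a y).2
  let Q : H.obj.s0.carrier ⊗[ℂ] H.obj.s0.carrier →ₗ[ℂ] H.obj.s1.carrier :=
    H.m01 ∘ₗ (TensorProduct.mk ℂ _ _).flip y ∘ₗ H.m00
  have hQ : ∀ a c, Q (a ⊗ₜ c) = H.m01 (a ⊗ₜ H.m01 (c ⊗ₜ y)) := fun a c => (H.m01_m01 a c y).symm
  let R := Q ∘ₗ (TensorProduct.comm ℂ H.obj.s0.carrier H.obj.s0.carrier).toLinearMap
  have hR : ∀ a c, R (a ⊗ₜ c) = H.m01 (c ⊗ₜ H.m01 (a ⊗ₜ y)) := fun a c => hQ c a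
  have hQs : Q ∘ₗ SuperSpace.swap H.obj.s0.toSuperSpace H.obj.s0.toSuperSpace = R := by
    refine TensorProduct.ext' fun a c => ?_
    rw [LinearMap.comp_apply, SuperSpace.swap_tmul, map_smul, map_sub, map_add, map_add, hQ, hQ, hQ, hQ,
      hR, hpar, hpar]
    rw [add_sub_cancel_right, ← two_smul ℂ, smul_smul]; norm_num
  have h1 : Q = R ∘ₗ B.expC (-1) H.obj.s0 H.obj.s0 := by
    rw [← hQs]
    exact LinearMap.ext fun z => (congrArg (fun w => H.m01 (w ⊗ₜ[ℂ] y)) (hH.m00_braid z)).symm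
  have h2 : R ∘ₗ TensorProduct.map H.obj.s0.par LinearMap.id = R :=
    TensorProduct.ext' fun a c => by
      rw [LinearMap.comp_apply, TensorProduct.map_tmul, hR, hR, hpar]; rfl
  have h3 : Q ∘ₗ TensorProduct.map H.obj.s0.par LinearMap.id = Q :=
    TensorProduct.ext' fun a c => by
      rw [LinearMap.comp_apply, TensorProduct.map_tmul, hQ, hQ, hpar]; rfl
  -- Parity in the first factor can be inserted before `R` and removed after `Q`; passing it through
  -- the exponential reverses the sign of `C`.
  have h4 : R ∘ₗ B.expC 1 H.obj.s0 H.obj.s0 = R ∘ₗ B.expC (-1) H.obj.s0 H.obj.s0 := by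
    have := B.expC_par (-1) H.obj.s0 H.obj.s0
    rw [neg_neg] at this
    calc R ∘ₗ B.expC 1 H.obj.s0 H.obj.s0
        = (R ∘ₗ TensorProduct.map H.obj.s0.par LinearMap.id) ∘ₗ B.expC 1 H.obj.s0 H.obj.s0 := by rw [h2]
      _ = (R ∘ₗ B.expC (-1) H.obj.s0 H.obj.s0) ∘ₗ TensorProduct.map H.obj.s0.par LinearMap.id := by
          rw [LinearMap.comp_assoc, ← this]; rfl
      _ = R ∘ₗ B.expC (-1) H.obj.s0 H.obj.s0 := by rw [← h1, h3]
  obtain ⟨m, hm⟩ : ∃ m, Module.finrank ℂ V = m + 1 :=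
    ⟨Module.finrank ℂ V - 1, by have := Module.finrank_pos (R := ℂ) (M := V); omega⟩
  have h5 : R ∘ₗ B.actC H.obj.s0 H.obj.s0 = 0 := by
    refine comp_eq_zero_of_truncExp m (t := 1) (t' := -1) (by norm_num) ⟨_, B.actC_pow _ _⟩ ?_
    rw [SymplecticForm.expC_eq, SymplecticForm.expC_eq, hm] at h4
    exact h4
  constructor
  · have h6 : Q = R := by
      rw [h1, SymplecticForm.expC_eq, truncExp_of_mul_eq_zero (by omega) _ h5]
    rw [← hQ, h6, hR]
  · have h6 := LinearMap.congr_fun h5 (H.obj.s0.par a ⊗ₜ c)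
    rw [LinearMap.comp_apply, SymplecticForm.actC_tmul, map_sum, LinearMap.zero_apply] at h6
    simpa only [hR, H.obj.s0.par_par_apply] using h6

/-- The submodule generated by `N` acquires nothing new in the twisted sector: a product of a
twisted element with an element `g.(e n)` is by associativity the action of some element of `H_0` on
`n`. -/
theorem isSubmodule (hH : H.IsGood) (N : Submodule ℂ H.obj.s1.carrier)
    (hN : ∀ a, ∀ n ∈ N, H.m01 (a ⊗ₜ n) ∈ N) :
    H.IsSubmodule (Submodule.span ℂ {x | ∃ g e, ∃ n ∈ N, x = H.m11 (g ⊗ₜ (e ⊗ₜ n))}) N := by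
  have hact : ∀ (x : V), ∀ n ∈ Submodule.span ℂ {x | ∃ g e, ∃ n ∈ N, x = H.m11 (g ⊗ₜ (e ⊗ₜ n))},
      H.obj.s0.act x n ∈ Submodule.span ℂ {x | ∃ g e, ∃ n ∈ N, x = H.m11 (g ⊗ₜ (e ⊗ₜ n))} := by
    intro v n hn
    induction hn using Submodule.span_induction with
    | mem x hx =>
      obtain ⟨g, e, n, hn, rfl⟩ := hx
      exact Submodule.subset_span ⟨_, e, n, hn, H.act_m11 _ _ _⟩
    | zero => simp
    | add x y _ _ hx hy => rw [map_add]; exact Submodule.add_mem _ hx hy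
    | smul c x _ hx => rw [map_smul]; exact Submodule.smul_mem _ _ hx
  refine ⟨?_, ?_, hact, ?_, ?_, ?_, ?_⟩
  · intro n hn
    induction hn using Submodule.span_induction with
    | mem x hx =>
      obtain ⟨g, e, n, hn, rfl⟩ := hx
      refine Submodule.subset_span ⟨invol g, H.obj.s1.par e, H.obj.s1.par n, ?_, H.par_m11 _ _ _⟩
      rw [hH.par_eq]
      exact N.smul_mem _ hn
    | zero => simp
    | add x y _ _ hx hy => rw [map_add]; exact Submodule.add_mem _ hx hy
    | smul c x _ hx => rw [map_smul]; exact Submodule.smul_mem _ _ hx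
  · intro n hn
    rw [hH.par_eq]
    exact N.smul_mem _ hn
  · intro l n hn
    rw [m00_apply]
    induction hn using Submodule.span_induction with
    | mem x hx =>
      obtain ⟨g, e, n, hn, rfl⟩ := hx
      induction g using ext_induction generalizing l with
      | h1 =>
        rw [m00_m11]
        exact Submodule.subset_span ⟨1, _, n, hn, rfl⟩
      | hs c g hg =>
        rw [← TensorProduct.smul_tmul', map_smul, TensorProduct.tmul_smul, map_smul]
        exact Submodule.smul_mem _ _ (hg l)
      | ha g h hg hh =>
        rw [TensorProduct.add_tmul, map_add, TensorProduct.tmul_add, map_add]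
        exact Submodule.add_mem _ (hg l) (hh l)
      | hm v g hg =>
        -- The Leibniz rule `l (v.b) = v.(par(l) b) - (v.par(l)) b` reduces `v * g` to `g`, for
        -- varying `l`.
        have h1 := H.act_m00 v (H.obj.s0.par l) (H.m11 (g ⊗ₜ (e ⊗ₜ n)))
        rw [H.obj.s0.par_par_apply, act_m11] at h1
        rw [eq_sub_of_add_eq' h1.symm]
        exact Submodule.sub_mem _ (hact _ _ (hg _)) (hg _)
    | zero => simp
    | add x y _ _ hx hy => rw [TensorProduct.tmul_add, map_add]; exact Submodule.add_mem _ hx hy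
    | smul c x _ hx => rw [TensorProduct.tmul_smul, map_smul]; exact Submodule.smul_mem _ _ hx
  · intro g e n hn
    exact Submodule.subset_span ⟨g, e, n, hn, rfl⟩
  · intro l n hn
    exact hN l n hn
  · intro x n hn
    rw [m10_apply]
    induction hn using Submodule.span_induction with
    | mem z hz =>
      obtain ⟨g, e, n, hn, rfl⟩ := hz
      rw [H.m10_m11 e n (hH.swap_left _ _ _)]
      exact hN _ _ hn
    | zero => simp
    | add x y _ _ hx hy => rw [TensorProduct.tmul_add, map_add]; exact Submodule.add_mem _ hx hy
    | smul c x _ hx => rw [TensorProduct.tmul_smul, map_smul]; exact Submodule.smul_mem _ _ hx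

theorem eq_top (hH : H.IsGood) {N : Submodule ℂ H.obj.s1.carrier}
    (hN : ∀ a, ∀ n ∈ N, H.m01 (a ⊗ₜ n) ∈ N) (h0 : N ≠ ⊥) :
    Submodule.span ℂ {x | ∃ g e, ∃ n ∈ N, x = H.m11 (g ⊗ₜ (e ⊗ₜ n))} = ⊤ ∧ N = ⊤ :=
  (hH.simple.2 _ _ (hH.isSubmodule N hN)).resolve_left fun h => h0 h.2

end Alg.IsGood

/-- The data extracted from an algebra satisfying the five conditions: `H_1` is spanned by `t`, and
`H_0` acts on it through `χ`. -/
structure Alg.Split (H : Alg B β) (t : H.obj.s1.carrier) (χ : H.obj.s0.carrier →ₗ[ℂ] ℂ) : Prop where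
  ne_zero : t ≠ 0
  span_eq : ∀ y, ∃ c : ℂ, y = c • t
  m01 : ∀ a y, H.m01 (a ⊗ₜ y) = χ a • y
  m10 : ∀ a y, H.m10 (y ⊗ₜ a) = χ a • y
  gen : ∀ a, ∃ g, a = H.m11 (g ⊗ₜ (t ⊗ₜ t))

variable [Nontrivial V]

namespace Alg.IsGood

/-- The operators of `H_0` on `H_1` commute, so their eigenspaces are `H_0`-stable and, by
simplicity, exhaust `H_1`. Once all operators are scalar, every line is stable, so `H_1` is a line,
and the submodule it generates contains all of `H_0`. -/
theorem exists_split (hH : H.IsGood) : ∃ t χ, H.Split t χ := by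
  have := hH.twisted
  have hsc : ∀ a, ∃ c : ℂ, ∀ y, H.m01 (a ⊗ₜ y) = c • y := by
    intro a
    let F : Module.End ℂ H.obj.s1.carrier := H.m01 ∘ₗ TensorProduct.mk ℂ _ _ a
    obtain ⟨c, hc⟩ := Module.End.exists_eigenvalue F
    refine ⟨c, ?_⟩
    have h1 := (hH.eq_top (N := Module.End.eigenspace F c) ?_ hc).2
    · intro y
      have : y ∈ Module.End.eigenspace F c := h1 ▸ Submodule.mem_top
      exact Module.End.mem_eigenspace_iff.mp this
    · intro a' n hn
      rw [Module.End.mem_eigenspace_iff] at hn ⊢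
      change H.m01 (a ⊗ₜ H.m01 (a' ⊗ₜ n)) = _
      rw [(hH.m01_comm_and a a' n).1]
      change H.m01 (a' ⊗ₜ F n) = _
      rw [hn, TensorProduct.tmul_smul, map_smul]
  obtain ⟨t, ht⟩ := exists_ne (0 : H.obj.s1.carrier)
  have htop := hH.eq_top (N := Submodule.span ℂ {t}) (fun a n hn => by
    obtain ⟨c, hc⟩ := hsc a
    rw [hc]
    exact Submodule.smul_mem _ _ hn) (by simpa using ht)
  have hspan : ∀ y, ∃ c : ℂ, y = c • t := fun y => by
    have : y ∈ Submodule.span ℂ {t} := htop.2 ▸ Submodule.mem_top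
    obtain ⟨c, rfl⟩ := Submodule.mem_span_singleton.mp this
    exact ⟨c, rfl⟩
  obtain ⟨τ, hτ⟩ : ∃ τ : Module.Dual ℂ H.obj.s1.carrier, τ t ≠ 0 := by
    by_contra hcon
    push Not at hcon
    exact ht ((Module.forall_dual_apply_eq_zero_iff ℂ t).mp hcon)
  let χ : H.obj.s0.carrier →ₗ[ℂ] ℂ := (τ t)⁻¹ • (τ ∘ₗ H.m01 ∘ₗ (TensorProduct.mk ℂ _ _).flip t)
  have hχ : ∀ a y, H.m01 (a ⊗ₜ y) = χ a • y := by
    intro a y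
    obtain ⟨c, hc⟩ := hsc a
    have : χ a = c := by
      change (τ t)⁻¹ • τ (H.m01 (a ⊗ₜ t)) = c
      rw [hc, map_smul, smul_eq_mul, smul_eq_mul]
      field_simp
    rw [hc, this]
  refine ⟨t, χ, ht, hspan, hχ, fun a y => by rw [(hH.m10_eq a y).1, hχ], fun a => ?_⟩
  have ha : a ∈ Submodule.span ℂ
      {x | ∃ g e, ∃ n ∈ Submodule.span ℂ {t}, x = H.m11 (g ⊗ₜ (e ⊗ₜ n))} :=
    htop.1 ▸ Submodule.mem_top
  induction ha using Submodule.span_induction with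
  | mem z hz =>
    obtain ⟨g, e, n, hn, rfl⟩ := hz
    obtain ⟨c, rfl⟩ := hspan e
    obtain ⟨c', rfl⟩ := hspan n
    refine ⟨(c * c') • g, ?_⟩
    congr 1
    simp only [← TensorProduct.smul_tmul', TensorProduct.tmul_smul, smul_smul]
    rw [mul_comm]
  | zero => exact ⟨0, by simp⟩
  | add x y _ _ hx hy =>
    obtain ⟨g, rfl⟩ := hx
    obtain ⟨h, rfl⟩ := hy
    exact ⟨g + h, by rw [TensorProduct.add_tmul, map_add]⟩
  | smul c x _ hx =>
    obtain ⟨g, rfl⟩ := hx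
    exact ⟨c • g, by rw [← TensorProduct.smul_tmul', map_smul]⟩

/-- For `β = -1` the generator `t` is odd. In the braiding of `t` with itself the Koszul sign and
the parity involution cancel, which leaves the factor `β = -1`, so all products of twisted elements
vanish. They span `H_0`, which contains the unit. -/
theorem beta_eq_one (hH : H.IsGood) : β = 1 := by
  refine hH.beta_sq.resolve_right fun hβ => ?_
  subst hβ
  obtain ⟨t, χ, hs⟩ := hH.exists_split
  have h1 : ∀ g, H.m11 (g ⊗ₜ (t ⊗ₜ t)) = 0 := by
    intro g
    have h2 := hH.comm_f0 (0, g ⊗ₜ (t ⊗ₜ t))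
    have h3 : H.mul.f0 ((braiding B (-1) H.obj H.obj).f0 (0, g ⊗ₜ (t ⊗ₜ t))) =
        -H.obj.s0.actS (B.expHatC (-1 / 2)) (H.m11 (g ⊗ₜ (t ⊗ₜ t))) := by
      have h4 := hH.swap_left H.obj.s1 t t
      rw [hH.par_eq] at h4
      norm_num at h4
      rw [actS_m11]
      have h5 : (braiding B (-1) H.obj H.obj).f0 (0, g ⊗ₜ (t ⊗ₜ t)) =
          -(0, (B.expHatC (-1 / 2) * g) ⊗ₜ (t ⊗ₜ t)) := by
        have h6 : SuperSpace.swap H.obj.s1 H.obj.s1 (t ⊗ₜ t) = -(t ⊗ₜ t) := by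
          rw [h4, ← TensorProduct.neg_tmul]; congr 2
          rw [smul_smul]; norm_num
        have h7 : SuperSpace.swap H.obj.s1 H.obj.s1 (t ⊗ₜ H.obj.s1.par t) = t ⊗ₜ t := by
          rw [hH.par_eq, TensorProduct.tmul_smul, map_smul, h6]; simp
        simp [braiding, braid11, h7]
      rw [h5, map_neg, m11_apply]
    rw [h3, hH.actS_expHatC, m11_apply, LinearMap.id_apply] at h2
    have h4 : (2 : ℂ) • H.m11 (g ⊗ₜ (t ⊗ₜ t)) = 0 := by
      rw [two_smul]
      nth_rewrite 1 [← h2]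
      exact neg_add_cancel _
    exact (smul_eq_zero.mp h4).resolve_left two_ne_zero
  have h2 : ∀ a : H.obj.s0.carrier, a = 0 := fun a => by
    obtain ⟨g, rfl⟩ := hs.gen a
    exact h1 g
  apply hs.ne_zero
  rw [← H.one_m01 t, h2 H.one, TensorProduct.zero_tmul, map_zero]

end Alg.IsGood
end good

/-! ### The linear form of an algebra: Lagrangian annihilators and uniqueness -/

section split

variable {V : Type u} [AddCommGroup V] [Module ℂ V] [FiniteDimensional ℂ V]
variable {B : SymplecticForm V}

local notation "ι" => ExteriorAlgebra.ι ℂ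

namespace Alg

/-- The map `S → H_0`, `g ↦ g.(t t)`. -/
def orbit (H : Alg B (1 : ℂ)) (t : H.obj.s1.carrier) : ExteriorAlgebra ℂ V →ₗ[ℂ] H.obj.s0.carrier :=
  H.m11 ∘ₗ (TensorProduct.mk ℂ _ _).flip (t ⊗ₜ[ℂ] t)

variable {H : Alg B (1 : ℂ)} {t : H.obj.s1.carrier} {χ : H.obj.s0.carrier →ₗ[ℂ] ℂ}

theorem orbit_apply (g) : H.orbit t g = H.m11 (g ⊗ₜ (t ⊗ₜ t)) := rfl

theorem act_orbit (v : V) (g) : H.obj.s0.act v (H.orbit t g) = H.orbit t (ι v * g) :=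
  H.act_m11 _ _ _

theorem actS_orbit (g h) : H.obj.s0.actS g (H.orbit t h) = H.orbit t (g * h) :=
  H.actS_m11 _ _ _

theorem IsGood.par_s1 (hH : H.IsGood) (y : H.obj.s1.carrier) : H.obj.s1.par y = y := by
  rw [hH.par_eq, one_smul]

theorem par_orbit (hH : H.IsGood) (g) : H.obj.s0.par (H.orbit t g) = H.orbit t (invol g) := by
  rw [orbit_apply, H.par_m11, hH.par_s1, orbit_apply]

namespace Split

theorem orbit_surjective (hs : H.Split t χ) : Function.Surjective (H.orbit t) := fun a => by
  obtain ⟨g, rfl⟩ := hs.gen a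
  exact ⟨g, rfl⟩

theorem orbit_one_m00 (hH : H.IsGood) (hs : H.Split t χ) (a : H.obj.s0.carrier) :
    H.m00 (H.orbit t 1 ⊗ₜ a) = χ a • H.orbit t 1 := by
  rw [orbit_apply, ← m11_m10, hs.m10, TensorProduct.tmul_smul, TensorProduct.tmul_smul, map_smul]
  rw [TensorProduct.map_tmul, hH.par_s1]

theorem map_one (hs : H.Split t χ) : χ H.one = 1 := by
  have h := hs.m01 H.one t
  rw [one_m01] at h
  have : (1 - χ H.one) • t = 0 := by rw [sub_smul, one_smul, ← h, sub_self]
  exact (sub_eq_zero.mp ((smul_eq_zero.mp this).resolve_right hs.ne_zero)).symm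

theorem smul_eq_iff (hs : H.Split t χ) {x y : ℂ} : x • t = y • t ↔ x = y :=
  ⟨fun h => sub_eq_zero.mp ((smul_eq_zero.mp (by rw [sub_smul, h, sub_self])).resolve_right hs.ne_zero),
    fun h => by rw [h]⟩

theorem map_mul (hs : H.Split t χ) (a b : H.obj.s0.carrier) : χ (H.m00 (a ⊗ₜ b)) = χ a * χ b := by
  have h := H.m01_m01 a b t
  rw [hs.m01 b, TensorProduct.tmul_smul, map_smul, hs.m01, hs.m01, smul_smul, hs.smul_eq_iff] at h
  rw [← h, mul_comm]

/-- Sector 111 evaluated on `t`, `t`, `t`: both bracketings are multiples of `t`, and comparing the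
coefficients gives the invariance. -/
theorem map_phi (hs : H.Split t χ) (hH : H.IsGood) (g) :
    χ (H.orbit t (B.phi 1 g)) = χ (H.orbit t g) := by
  have h := H.m10_m11 (x := t) (g := g) (g' := g) t t
    (SuperSpace.swap_even_left _ _ (hH.par_s1 t) _)
  rw [hs.m10, hs.m01, hs.smul_eq_iff] at h
  exact h.symm

/-- Invariance under `φ` turns the contraction into multiplication by `w`, which acts as zero. -/
theorem map_contract (hs : H.Split t χ) (hH : H.IsGood) {w : V} (hw : w ∈ H.obj.s0.ann) (g) :
    χ (H.orbit t (contract (B.formSF w) g)) = 0 := by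
  rw [← hs.map_phi hH, B.phi_contract, ← act_orbit]
  have : H.obj.s0.act w = 0 := hw
  rw [this, LinearMap.zero_apply, _root_.map_zero]

theorem map_ι_mul {w : V} (hw : w ∈ H.obj.s0.ann) (g) : χ (H.orbit t (ι w * g)) = 0 := by
  rw [← act_orbit]
  have : H.obj.s0.act w = 0 := hw
  rw [this, LinearMap.zero_apply, _root_.map_zero]

variable [Nontrivial V]

theorem map_par (hs : H.Split t χ) (hH : H.IsGood) (a : H.obj.s0.carrier) :
    χ (H.obj.s0.par a) = χ a := by
  have h := (hH.m10_eq a t).2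
  rwa [hs.m01, hs.m01, hs.smul_eq_iff] at h

/-- The largest `h`-stable subspace `N` of `ker χ` is, together with `0` in the twisted sector, a
submodule of `H`; it is proper because `H_1 ≠ 0`, hence zero. -/
theorem eq_zero (hs : H.Split t χ) (hH : H.IsGood) {a : H.obj.s0.carrier}
    (ha : ∀ g, χ (H.obj.s0.actS g a) = 0) : a = 0 := by
  let N : Submodule ℂ H.obj.s0.carrier :=
    ⨅ g, LinearMap.ker (χ ∘ₗ H.obj.s0.actS g)
  have hN : ∀ {x}, x ∈ N ↔ ∀ g, χ (H.obj.s0.actS g x) = 0 := by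
    intro x
    simp [N]
  have hact : ∀ v, ∀ n ∈ N, H.obj.s0.act v n ∈ N := fun v n hn => by
    rw [hN] at hn ⊢
    intro g
    have := hn (g * ι v)
    rwa [_root_.map_mul, Rep.actS_ι] at this
  -- The subspace `P = H_0 N` is `h`-stable by the Leibniz rule and lies in `ker χ` because `χ` is
  -- multiplicative; so it lies in `N`.
  let P := Submodule.span ℂ {x | ∃ l, ∃ n ∈ N, x = H.m00 (l ⊗ₜ n)}
  have hPact : ∀ v, ∀ n ∈ P, H.obj.s0.act v n ∈ P := fun v n hn => by
    induction hn using Submodule.span_induction with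
    | mem x hx =>
      obtain ⟨l, n, hn, rfl⟩ := hx
      rw [act_m00]
      exact P.add_mem (Submodule.subset_span ⟨_, n, hn, rfl⟩)
        (Submodule.subset_span ⟨_, _, hact v n hn, rfl⟩)
    | zero => rw [_root_.map_zero]; exact P.zero_mem
    | add x y _ _ hx hy => rw [map_add]; exact P.add_mem hx hy
    | smul c x _ hx => rw [map_smul]; exact P.smul_mem _ hx
  have hPactS : ∀ g, ∀ n ∈ P, H.obj.s0.actS g n ∈ P := fun g n hn => by
    induction g using ext_induction with
    | h1 => rw [_root_.map_one]; exact hn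
    | hs c g hg => rw [map_smul]; exact P.smul_mem _ hg
    | ha g h hg hh => rw [map_add]; exact P.add_mem hg hh
    | hm v g hg => rw [Rep.actS_ι_mul]; exact hPact _ _ hg
  have hχN : ∀ n ∈ N, χ n = 0 := fun n hn => by
    have := hN.mp hn 1
    rwa [_root_.map_one] at this
  have hP : ∀ n ∈ P, χ n = 0 := fun n hn => by
    induction hn using Submodule.span_induction with
    | mem x hx => obtain ⟨l, n, hn, rfl⟩ := hx; rw [hs.map_mul, hχN n hn, mul_zero]
    | zero => exact _root_.map_zero _
    | add x y _ _ hx hy => rw [map_add, hx, hy, add_zero]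
    | smul c x _ hx => rw [map_smul, hx, smul_zero]
  have hsub : H.IsSubmodule N ⊥ :=
    { par0 := fun n hn => by
        rw [hN] at hn ⊢
        intro g
        have h1 := H.obj.s0.par_actS (invol g) n
        rw [invol_invol] at h1
        rw [← h1, hs.map_par hH, hn]
      par1 := fun n hn => by
        rw [(Submodule.mem_bot ℂ).mp hn, _root_.map_zero]; exact Submodule.zero_mem _
      act := hact
      mul00 := fun l n hn => hN.mpr fun g => hP _ (hPactS g _ (Submodule.subset_span ⟨l, n, hn, rfl⟩))
      mul11 := fun g e n hn => by
        rw [(Submodule.mem_bot ℂ).mp hn, TensorProduct.tmul_zero, TensorProduct.tmul_zero, m11_apply,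
          _root_.map_zero]
        exact N.zero_mem
      mul01 := fun l n hn => by
        rw [(Submodule.mem_bot ℂ).mp hn, TensorProduct.tmul_zero, m01_apply, _root_.map_zero]
        exact Submodule.zero_mem _
      mul10 := fun e n hn => by
        rw [m10_apply, hs.m10, hχN n hn, zero_smul]
        exact Submodule.zero_mem _ }
  have := hH.twisted
  rcases hH.simple.2 _ _ hsub with h | h
  · exact (Submodule.mem_bot ℂ).mp (h.1 ▸ hN.mpr ha)
  · exact absurd h.2 bot_ne_top

theorem map_actS_act (v : V) (g) (a : H.obj.s0.carrier) :
    χ (H.obj.s0.actS g (H.obj.s0.act v a)) = χ (H.obj.s0.act v (H.obj.s0.actS (invol g) a)) := by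
  rw [← Rep.actS_ι_mul, ← mul_ι, _root_.map_mul, Rep.actS_ι, Module.End.mul_apply]

theorem mem_ann_iff (hs : H.Split t χ) (hH : H.IsGood) (v : V) :
    v ∈ H.obj.s0.ann ↔ ∀ a, χ (H.obj.s0.act v a) = 0 := by
  constructor
  · intro hv a
    have : H.obj.s0.act v = 0 := hv
    rw [this, LinearMap.zero_apply, _root_.map_zero]
  · intro h
    refine LinearMap.mem_ker.mpr (LinearMap.ext fun a => hs.eq_zero hH fun g => ?_)
    rw [map_actS_act]
    exact h _

/-- Isotropy comes from contracting a product with a vector of the annihilator, maximality from the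
vanishing of the copairing `C` under `χ`. -/
theorem isLagrangian_ann (hs : H.Split t χ) (hH : H.IsGood) : B.IsLagrangian H.obj.s0.ann := by
  rw [B.isLagrangian_iff]
  intro x
  constructor
  · intro hx y hy
    obtain ⟨g, hg⟩ := hs.orbit_surjective H.one
    -- With `g` representing the unit, contracting `y * g` gives `(x, y)` up to a multiple of `y`,
    -- which the form kills.
    have h1 := hs.map_contract hH hx (ι y * g)
    rw [contract_ι_mul, map_sub, map_sub, map_smul, map_smul, hg, hs.map_one, map_ι_mul hy] at h1
    simpa using h1
  · intro hx
    rw [hs.mem_ann_iff hH]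
    intro a
    -- `T` is the copairing with `χ` of the action on `a` inserted in its first leg, so
    -- `m01_comm_and` says that `T` annihilates `H_0`. Pairing `T` with `x` gives `-χ(x.a)`.
    let T : V := ∑ i, χ (H.obj.s0.act (SymplecticForm.b i) a) • B.a i
    have hT : T ∈ H.obj.s0.ann := by
      rw [hs.mem_ann_iff hH]
      intro c
      have h1 := (hH.m01_comm_and a c t).2
      simp only [hs.m01, smul_smul, ← Finset.sum_smul] at h1
      simpa [T, mul_comm] using (smul_eq_zero.mp h1).resolve_right hs.ne_zero
    have h1 := hx T hT
    conv_lhs => rw [← B.sum_formSF_a_smul_b x]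
    simp only [T, map_sum, map_smul, smul_eq_mul] at h1
    simp only [map_sum, map_smul, LinearMap.sum_apply, LinearMap.smul_apply, smul_eq_mul]
    rw [← neg_eq_zero, ← h1, ← Finset.sum_neg_distrib]
    refine Finset.sum_congr rfl fun i _ => ?_
    rw [← B.formSF_neg x]
    ring

theorem smul (hs : H.Split t χ) {r : ℂ} (hr : r ≠ 0) : H.Split (r • t) χ where
  ne_zero := smul_ne_zero hr hs.ne_zero
  span_eq := fun y => by
    obtain ⟨c, rfl⟩ := hs.span_eq y
    exact ⟨c * r⁻¹, by rw [smul_smul, inv_mul_cancel_right₀ hr]⟩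
  m01 := hs.m01
  m10 := hs.m10
  gen := fun a => by
    obtain ⟨g, rfl⟩ := hs.gen a
    refine ⟨(r * r)⁻¹ • g, ?_⟩
    simp only [← TensorProduct.smul_tmul', TensorProduct.tmul_smul, smul_smul]
    rw [mul_inv_cancel₀ (mul_ne_zero hr hr), one_smul]

theorem orbit_smul (r : ℂ) (g) : H.orbit (r • t) g = (r * r) • H.orbit t g := by
  simp only [orbit_apply, ← TensorProduct.smul_tmul', TensorProduct.tmul_smul, smul_smul, map_smul]

/-- By `Adapted.eq_zero` the form would otherwise vanish, but it takes the value `χ(1) = 1` at a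
representative of the unit. -/
theorem map_wedge_ne_zero (hs : H.Split t χ) (hH : H.IsGood) {n : ℕ} {e g : ℕ → V}
    (h : B.Adapted H.obj.s0.ann n e g) : χ (H.orbit t (wedge g n)) ≠ 0 := by
  intro h0
  have := h.eq_zero (F := χ ∘ₗ H.orbit t) (fun w hw x => map_ι_mul hw x)
    (fun w hw x => hs.map_contract hH hw x) h0
  obtain ⟨x, hx⟩ := hs.orbit_surjective H.one
  have h1 := LinearMap.congr_fun this x
  rw [LinearMap.comp_apply, hx, hs.map_one] at h1
  exact one_ne_zero h1

theorem orbit_eq_zero_iff (hs : H.Split t χ) (hH : H.IsGood) (g) :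
    H.orbit t g = 0 ↔ ∀ h, χ (H.orbit t (h * g)) = 0 := by
  constructor
  · intro h0 h
    rw [← actS_orbit, h0, _root_.map_zero, _root_.map_zero]
  · intro h
    refine hs.eq_zero hH fun x => ?_
    rw [actS_orbit, h]

/-- The isomorphism `ℂ ≃ H_1` given by `t`. -/
def line (hs : H.Split t χ) : ℂ ≃ₗ[ℂ] H.obj.s1.carrier :=
  LinearEquiv.ofBijective (LinearMap.toSpanSingleton ℂ _ t)
    ⟨fun _ _ h => hs.smul_eq_iff.mp h, fun y => by
      obtain ⟨c, rfl⟩ := hs.span_eq y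
      exact ⟨c, rfl⟩⟩

theorem line_apply (hs : H.Split t χ) (c : ℂ) : hs.line c = c • t := rfl

end Split

theorem IsGood.isLagrangian_ann [Nontrivial V] (hH : H.IsGood) : B.IsLagrangian H.obj.s0.ann := by
  obtain ⟨t, χ, hs⟩ := hH.exists_split
  exact hs.isLagrangian_ann hH

theorem iso_of_equiv {β : ℂ} {H K : Alg B β} (ψ₀ : H.obj.s0.carrier ≃ₗ[ℂ] K.obj.s0.carrier)
    (ψ₁ : H.obj.s1.carrier ≃ₗ[ℂ] K.obj.s1.carrier)
    (h0 : ∀ a, ψ₀ (H.obj.s0.par a) = K.obj.s0.par (ψ₀ a))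
    (h1 : ∀ y, ψ₁ (H.obj.s1.par y) = K.obj.s1.par (ψ₁ y))
    (hv : ∀ v a, ψ₀ (H.obj.s0.act v a) = K.obj.s0.act v (ψ₀ a))
    (h00 : ∀ a b, ψ₀ (H.m00 (a ⊗ₜ b)) = K.m00 (ψ₀ a ⊗ₜ ψ₀ b))
    (h01 : ∀ a y, ψ₁ (H.m01 (a ⊗ₜ y)) = K.m01 (ψ₀ a ⊗ₜ ψ₁ y))
    (h10 : ∀ a y, ψ₁ (H.m10 (y ⊗ₜ a)) = K.m10 (ψ₁ y ⊗ₜ ψ₀ a))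
    (h11 : ∀ g y z, ψ₀ (H.m11 (g ⊗ₜ (y ⊗ₜ z))) = K.m11 (g ⊗ₜ (ψ₁ y ⊗ₜ ψ₁ z))) : H.Iso K := by
  -- Units need no hypothesis: the image of the unit is a left unit and `K.one` is a right unit.
  have hone : ψ₀ H.one = K.one := by
    have := h00 H.one (ψ₀.symm K.one)
    rwa [ψ₀.apply_symm_apply, one_m00, m00_one, ψ₀.apply_symm_apply, eq_comm] at this
  refine ⟨⟨ψ₀, ψ₁⟩, ⟨ψ₀.symm, ψ₁.symm⟩, ⟨LinearMap.ext h0, LinearMap.ext h1,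
    fun v => LinearMap.ext (hv v)⟩, ⟨LinearMap.ext fun a => ?_, LinearMap.ext fun a => ?_,
    fun v => LinearMap.ext fun a => ?_⟩, ?_, ?_, ?_, ?_⟩
  · apply ψ₀.injective
    simp [h0]
  · apply ψ₁.injective
    simp [h1]
  · apply ψ₀.injective
    simp [hv]
  · ext x <;> simp [GMap.comp, GMap.id]
  · ext x <;> simp [GMap.comp, GMap.id]
  · refine GMap.ext ?_ ?_
    · refine LinearMap.prod_ext (TensorProduct.ext' fun a b => ?_)
        (TensorProduct.ext' fun g z => ?_)
      · simpa [GMap.comp, GMap.tensor, m00, m01, m10, m11] using h00 a b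
      · induction z using TensorProduct.induction_on with
        | zero => rw [TensorProduct.tmul_zero, map_zero, map_zero]
        | tmul y z => simpa [GMap.comp, GMap.tensor, m00, m01, m10, m11] using h11 g y z
        | add y z hy hz => rw [TensorProduct.tmul_add, map_add, hy, hz, map_add]
    · refine LinearMap.prod_ext (TensorProduct.ext' fun a b => ?_)
        (TensorProduct.ext' fun a b => ?_)
      · simpa [GMap.comp, GMap.tensor, m00, m01, m10, m11] using h01 a b
      · simpa [GMap.comp, GMap.tensor, m00, m01, m10, m11] using h10 b a
  · refine GMap.ext (LinearMap.ext fun c => ?_) (LinearMap.ext fun c => ?_)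
    · have hc : c = c.down • ULift.up 1 := by ext; simp
      rw [hc, map_smul, map_smul]
      exact congrArg (c.down • ·) hone
    · have hc : c = 0 := Subsingleton.elim _ _
      rw [hc, map_zero, map_zero]

/-- The kernel of `g ↦ g.(t t)` is the set of `g` all of whose multiples are killed by the form, so
equal forms give the same quotient of `S`. The product is also determined: `t t` multiplies by `χ`,
and the Leibniz rule extends this to all of `H_0`. -/
theorem Split.isom [Nontrivial V] {K : Alg B (1 : ℂ)} {t' : K.obj.s1.carrier}
    {χ' : K.obj.s0.carrier →ₗ[ℂ] ℂ} (hs : H.Split t χ) (hH : H.IsGood) (hs' : K.Split t' χ')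
    (hK : K.IsGood) (h : ∀ g, χ (H.orbit t g) = χ' (K.orbit t' g)) : H.Iso K := by
  have hker : LinearMap.ker (H.orbit t) = LinearMap.ker (K.orbit t') := by
    ext g
    rw [LinearMap.mem_ker, LinearMap.mem_ker, hs.orbit_eq_zero_iff hH, hs'.orbit_eq_zero_iff hK]
    simp only [h]
  let ψ₀ := ((H.orbit t).quotKerEquivOfSurjective hs.orbit_surjective).symm ≪≫ₗ
    Submodule.quotEquivOfEq _ _ hker ≪≫ₗ
      (K.orbit t').quotKerEquivOfSurjective hs'.orbit_surjective
  have hψ : ∀ g, ψ₀ (H.orbit t g) = K.orbit t' g := by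
    intro g
    have h1 : ((H.orbit t).quotKerEquivOfSurjective hs.orbit_surjective).symm (H.orbit t g) =
        Submodule.Quotient.mk g := by
      rw [LinearEquiv.symm_apply_eq]; rfl
    simp only [ψ₀, LinearEquiv.trans_apply, h1]
    rfl
  have hχ : ∀ a, χ' (ψ₀ a) = χ a := fun a => by
    obtain ⟨g, rfl⟩ := hs.orbit_surjective a
    rw [hψ, h]
  let ψ₁ := hs.line.symm ≪≫ₗ hs'.line
  have hψ₁ : ∀ c : ℂ, ψ₁ (c • t) = c • t' := fun c => by
    rw [← hs.line_apply, LinearEquiv.trans_apply, LinearEquiv.symm_apply_apply, hs'.line_apply]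
  have hpar : ∀ a, ψ₀ (H.obj.s0.par a) = K.obj.s0.par (ψ₀ a) := fun a => by
    obtain ⟨g, rfl⟩ := hs.orbit_surjective a
    rw [par_orbit hH, hψ, hψ, par_orbit hK]
  have hact : ∀ v a, ψ₀ (H.obj.s0.act v a) = K.obj.s0.act v (ψ₀ a) := fun v a => by
    obtain ⟨g, rfl⟩ := hs.orbit_surjective a
    rw [act_orbit, hψ, hψ, act_orbit]
  -- The Leibniz rule brings in the parity of the left factor, so the induction carries `g` and
  -- `invol g` together.
  have hmul : ∀ g, (∀ b, ψ₀ (H.m00 (H.orbit t g ⊗ₜ b)) = K.m00 (ψ₀ (H.orbit t g) ⊗ₜ ψ₀ b)) ∧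
      ∀ b, ψ₀ (H.m00 (H.orbit t (invol g) ⊗ₜ b)) = K.m00 (ψ₀ (H.orbit t (invol g)) ⊗ₜ ψ₀ b) := by
    intro g
    induction g using ext_induction with
    | h1 =>
      have h1 : ∀ b, ψ₀ (H.m00 (H.orbit t 1 ⊗ₜ b)) = K.m00 (ψ₀ (H.orbit t 1) ⊗ₜ ψ₀ b) := fun b => by
        rw [orbit_one_m00 hH hs, map_smul, hψ, orbit_one_m00 hK hs', hχ]
      exact ⟨h1, by rwa [_root_.map_one invol]⟩
    | hs c g hg =>
      refine ⟨fun b => ?_, fun b => ?_⟩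
      · rw [map_smul, ← TensorProduct.smul_tmul', map_smul, map_smul, hg.1, map_smul,
          ← TensorProduct.smul_tmul', map_smul]
      · rw [map_smul, map_smul, ← TensorProduct.smul_tmul', map_smul, map_smul, hg.2, map_smul,
          ← TensorProduct.smul_tmul', map_smul]
    | ha g h hg hh =>
      refine ⟨fun b => ?_, fun b => ?_⟩
      · rw [map_add, TensorProduct.add_tmul, map_add, map_add, hg.1, hh.1, map_add,
          TensorProduct.add_tmul, map_add]
      · rw [map_add, map_add, TensorProduct.add_tmul, map_add, map_add, hg.2, hh.2, map_add,
          TensorProduct.add_tmul, map_add]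
    | hm v g hg =>
      have key : ∀ g, (∀ b, ψ₀ (H.m00 (H.orbit t g ⊗ₜ b)) = K.m00 (ψ₀ (H.orbit t g) ⊗ₜ ψ₀ b)) →
          (∀ b, ψ₀ (H.m00 (H.orbit t (invol g) ⊗ₜ b)) = K.m00 (ψ₀ (H.orbit t (invol g)) ⊗ₜ ψ₀ b)) →
          ∀ b, ψ₀ (H.m00 (H.orbit t (ι v * g) ⊗ₜ b)) = K.m00 (ψ₀ (H.orbit t (ι v * g)) ⊗ₜ ψ₀ b) := by
        intro g h1 h2 b
        rw [← act_orbit, eq_sub_of_add_eq (H.act_m00 v (H.orbit t g) b).symm, map_sub, hact, h1,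
          par_orbit hH, h2, hact, hact, act_m00, ← hpar, par_orbit hH, add_sub_cancel_right]
      refine ⟨key g hg.1 hg.2, fun b => ?_⟩
      have := key (invol g) hg.2 (by rw [invol_invol]; exact hg.1) b
      rw [invol_ι_mul, map_neg, TensorProduct.neg_tmul, map_neg, map_neg, this, map_neg,
        TensorProduct.neg_tmul, map_neg]
  refine iso_of_equiv ψ₀ ψ₁ hpar (fun y => ?_) hact (fun a b => ?_) (fun a y => ?_) (fun a y => ?_)
    fun g y z => ?_
  · rw [hH.par_s1, hK.par_s1]
  · obtain ⟨g, rfl⟩ := hs.orbit_surjective a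
    exact (hmul g).1 b
  · rw [hs.m01, map_smul, hs'.m01, hχ]
  · rw [hs.m10, map_smul, hs'.m10, hχ]
  · obtain ⟨c, rfl⟩ := hs.span_eq y
    obtain ⟨c', rfl⟩ := hs.span_eq z
    simp only [hψ₁, ← TensorProduct.smul_tmul', TensorProduct.tmul_smul, map_smul]
    rw [← orbit_apply, hψ]
    rfl

/-- Both forms lie in the one-dimensional space of `Adapted.eq_zero`; rescaling `t` makes them
equal. -/
theorem IsGood.iso_of_ann_eq [Nontrivial V] {K : Alg B (1 : ℂ)} (hH : H.IsGood) (hK : K.IsGood)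
    (h : H.obj.s0.ann = K.obj.s0.ann) : H.Iso K := by
  obtain ⟨t, χ, hs⟩ := hH.exists_split
  obtain ⟨t', χ', hs'⟩ := hK.exists_split
  obtain ⟨n, e, g, had⟩ := hH.isLagrangian_ann.exists_adapted
  have h1 := hs.map_wedge_ne_zero hH had
  have h2 := hs'.map_wedge_ne_zero hK (h ▸ had)
  set x := χ (H.orbit t (wedge g n)) with hx
  set y := χ' (K.orbit t' (wedge g n)) with hy
  -- The form is quadratic in `t`, so the scaling factor is a square root of the ratio of the two
  -- values.
  obtain ⟨r, hr⟩ := IsAlgClosed.exists_pow_nat_eq (y / x) (n := 2) (by norm_num)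
  have hr0 : r ≠ 0 := by
    rintro rfl
    rw [zero_pow two_ne_zero, eq_comm, div_eq_zero_iff] at hr
    exact hr.elim h2 h1
  refine (hs.smul hr0).isom hH hs' hK fun z => ?_
  have h3 := had.eq_zero (F := χ ∘ₗ H.orbit (r • t) - χ' ∘ₗ K.orbit t') ?_ ?_ ?_
  · exact sub_eq_zero.mp (LinearMap.congr_fun h3 z)
  · intro w hw z
    rw [LinearMap.sub_apply, LinearMap.comp_apply, LinearMap.comp_apply, Split.map_ι_mul hw,
      Split.map_ι_mul (h ▸ hw), sub_zero]
  · intro w hw z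
    rw [LinearMap.sub_apply, LinearMap.comp_apply, LinearMap.comp_apply,
      (hs.smul hr0).map_contract hH hw, hs'.map_contract hK (h ▸ hw), sub_zero]
  · rw [LinearMap.sub_apply, LinearMap.comp_apply, LinearMap.comp_apply, Split.orbit_smul, map_smul,
      ← hx, ← hy, ← pow_two, hr, smul_eq_mul, div_mul_cancel₀ _ h1, sub_self]

end Alg
end split

section assocInv

variable {V : Type u} [AddCommGroup V] [Module ℂ V] [FiniteDimensional ℂ V]

local notation "ι" => ExteriorAlgebra.ι ℂ

/-! ### Linear maps out of triple tensor products -/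

theorem triple_ext_f0 {X Y Z : Obj V} {M : Type*} [AddCommGroup M] [Module ℂ M]
    {p q : (X.tensor (Y.tensor Z)).s0.carrier →ₗ[ℂ] M}
    (h000 : ∀ x y z, p (x ⊗ₜ (y ⊗ₜ z, 0), 0) = q (x ⊗ₜ (y ⊗ₜ z, 0), 0))
    (h011 : ∀ x (g : ExteriorAlgebra ℂ V) y z,
      p (x ⊗ₜ (0, g ⊗ₜ (y ⊗ₜ z)), 0) = q (x ⊗ₜ (0, g ⊗ₜ (y ⊗ₜ z)), 0))
    (h101 : ∀ (g : ExteriorAlgebra ℂ V) x y z,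
      p (0, g ⊗ₜ (x ⊗ₜ (y ⊗ₜ z, 0))) = q (0, g ⊗ₜ (x ⊗ₜ (y ⊗ₜ z, 0))))
    (h110 : ∀ (g : ExteriorAlgebra ℂ V) x y z,
      p (0, g ⊗ₜ (x ⊗ₜ (0, y ⊗ₜ z))) = q (0, g ⊗ₜ (x ⊗ₜ (0, y ⊗ₜ z)))) : p = q := by
  refine LinearMap.prod_ext ?_ ?_
  · ext x y z
    · simpa using h000 x y z
    · simpa using h011 _ _ _ _
  · ext g x y z
    · simpa using h101 _ _ _ _
    · simpa using h110 _ _ _ _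

theorem triple_ext_f1 {X Y Z : Obj V} {M : Type*} [AddCommGroup M] [Module ℂ M]
    {p q : (X.tensor (Y.tensor Z)).s1.carrier →ₗ[ℂ] M}
    (h001 : ∀ x y z, p (x ⊗ₜ (y ⊗ₜ z, 0), 0) = q (x ⊗ₜ (y ⊗ₜ z, 0), 0))
    (h010 : ∀ x y z, p (x ⊗ₜ (0, y ⊗ₜ z), 0) = q (x ⊗ₜ (0, y ⊗ₜ z), 0))
    (h100 : ∀ x y z, p (0, x ⊗ₜ (y ⊗ₜ z, 0)) = q (0, x ⊗ₜ (y ⊗ₜ z, 0)))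
    (h111 : ∀ x (g : ExteriorAlgebra ℂ V) y z,
      p (0, x ⊗ₜ (0, g ⊗ₜ (y ⊗ₜ z))) = q (0, x ⊗ₜ (0, g ⊗ₜ (y ⊗ₜ z)))) : p = q := by
  refine LinearMap.prod_ext ?_ ?_
  · ext x y z
    · simpa using h001 x y z
    · simpa using h010 x y _
  · ext x y z
    · simpa using h100 x y z
    · simpa using h111 _ _ _ _

/-! ### Invertibility of the associator -/

section eval

variable (B : SymplecticForm V) (β : ℂ) (X Y Z : Obj V)

theorem associator_000 : (associator B β X Y Z).f0 ∘ₗ LinearMap.inl ℂ _ _ ∘ₗ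
    LinearMap.lTensor X.s0.carrier (LinearMap.inl ℂ _ _) =
      (LinearMap.inl ℂ _ _ ∘ₗ LinearMap.rTensor Z.s0.carrier (LinearMap.inl ℂ _ _)) ∘ₗ
        vassoc X.s0.carrier Y.s0.carrier Z.s0.carrier := by
  ext <;> simp [associator]

theorem associator_011 : (associator B β X Y Z).f0 ∘ₗ LinearMap.inl ℂ _ _ ∘ₗ
    LinearMap.lTensor X.s0.carrier (LinearMap.inr ℂ _ _) =
      (LinearMap.inr ℂ _ _ ∘ₗ LinearMap.lTensor (ExteriorAlgebra ℂ V)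
        (LinearMap.rTensor Z.s1.carrier (LinearMap.inl ℂ _ _))) ∘ₗ
          assoc011 X.s0 Y.s1 Z.s1 := by
  refine TensorProduct.ext' fun x w => ?_
  simp [associator]

theorem associator_101 : (associator B β X Y Z).f0 ∘ₗ LinearMap.inr ℂ _ _ ∘ₗ
    LinearMap.lTensor (ExteriorAlgebra ℂ V) (LinearMap.lTensor X.s1.carrier (LinearMap.inl ℂ _ _)) =
      (LinearMap.inr ℂ _ _ ∘ₗ LinearMap.lTensor (ExteriorAlgebra ℂ V)
        (LinearMap.rTensor Z.s1.carrier (LinearMap.inr ℂ _ _))) ∘ₗ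
          assoc101 B X.s1 Y.s0 Z.s1 := by
  ext <;> simp [associator]

theorem associator_110 : (associator B β X Y Z).f0 ∘ₗ LinearMap.inr ℂ _ _ ∘ₗ
    LinearMap.lTensor (ExteriorAlgebra ℂ V) (LinearMap.lTensor X.s1.carrier (LinearMap.inr ℂ _ _)) =
      (LinearMap.inl ℂ _ _ ∘ₗ LinearMap.rTensor Z.s0.carrier (LinearMap.inr ℂ _ _)) ∘ₗ
        assoc110 X.s1 Y.s1 Z.s0 := by
  ext <;> simp [associator]

theorem associator_001 : (associator B β X Y Z).f1 ∘ₗ LinearMap.inl ℂ _ _ ∘ₗ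
    LinearMap.lTensor X.s0.carrier (LinearMap.inl ℂ _ _) =
      (LinearMap.inl ℂ _ _ ∘ₗ LinearMap.rTensor Z.s1.carrier (LinearMap.inl ℂ _ _)) ∘ₗ
        vassoc X.s0.carrier Y.s0.carrier Z.s1.carrier := by
  ext <;> simp [associator]

theorem associator_010 : (associator B β X Y Z).f1 ∘ₗ LinearMap.inl ℂ _ _ ∘ₗ
    LinearMap.lTensor X.s0.carrier (LinearMap.inr ℂ _ _) =
      (LinearMap.inr ℂ _ _ ∘ₗ LinearMap.rTensor Z.s0.carrier (LinearMap.inl ℂ _ _)) ∘ₗ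
        assoc010 B X.s0 Y.s1 Z.s0 := by
  refine TensorProduct.ext' fun x w => ?_
  simp [associator]

theorem associator_100 : (associator B β X Y Z).f1 ∘ₗ LinearMap.inr ℂ _ _ ∘ₗ
    LinearMap.lTensor X.s1.carrier (LinearMap.inl ℂ _ _) =
      (LinearMap.inr ℂ _ _ ∘ₗ LinearMap.rTensor Z.s0.carrier (LinearMap.inr ℂ _ _)) ∘ₗ
        vassoc X.s1.carrier Y.s0.carrier Z.s0.carrier := by
  refine TensorProduct.ext' fun x w => ?_
  simp [associator]

theorem associator_111 : (associator B β X Y Z).f1 ∘ₗ LinearMap.inr ℂ _ _ ∘ₗ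
    LinearMap.lTensor X.s1.carrier (LinearMap.inr ℂ _ _) =
      (LinearMap.inl ℂ _ _ ∘ₗ LinearMap.rTensor Z.s1.carrier (LinearMap.inr ℂ _ _)) ∘ₗ
        assoc111 B β X.s1 Y.s1 Z.s1 := by
  refine TensorProduct.ext' fun x w => ?_
  simp [associator]

end eval
end assocInv

/-! ### Surjectivity of the coactions and of the blocks of the associator -/

section coaction

variable {V : Type u} [AddCommGroup V] [Module ℂ V] [FiniteDimensional ℂ V]

local notation "ι" => ExteriorAlgebra.ι ℂ

theorem comul_ι_mul (v : V) (g : ExteriorAlgebra ℂ V) : comul V (ι v * g) =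
    LinearMap.rTensor _ (LinearMap.mulLeft ℂ (ι v)) (comul V g) +
      TensorProduct.map invol.toLinearMap (LinearMap.mulLeft ℂ (ι v)) (comul V g) :=
  Rep.actS_ι_mul _ v g _

theorem antipode_ι_mul (v : V) (g : ExteriorAlgebra ℂ V) : antipode (ι v * g) = -(ι v * antipode g) :=
  invol_ι_mul v g

variable (U : Rep V)

theorem coact_ι_mul (v : V) (g : ExteriorAlgebra ℂ V) (x : U.carrier) :
    coact U ((ι v * g) ⊗ₜ x) = LinearMap.rTensor _ (LinearMap.mulLeft ℂ (ι v)) (coact U (g ⊗ₜ x)) +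
      TensorProduct.map invol.toLinearMap (U.act v) (coact U (g ⊗ₜ x)) := by
  simp only [coact, LinearMap.comp_apply, LinearMap.rTensor_tmul, comul_ι_mul]
  generalize comul V g = z
  induction z using TensorProduct.induction_on with
  | zero => simp
  | tmul g h => simp [TensorProduct.add_tmul, Rep.actMap, U.actS_ι]
  | add y z hy hz =>
    simp only [map_add, TensorProduct.add_tmul] at hy hz ⊢
    rw [add_add_add_comm, hy, hz, add_add_add_comm]

theorem coactAntipode_ι_mul (v : V) (g : ExteriorAlgebra ℂ V) (x : U.carrier) :
    coactAntipode U ((ι v * g) ⊗ₜ x) =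
      LinearMap.rTensor _ (LinearMap.mulLeft ℂ (ι v)) (coactAntipode U (g ⊗ₜ x)) -
        TensorProduct.map invol.toLinearMap (U.act v) (coactAntipode U (g ⊗ₜ x)) := by
  simp only [coactAntipode, LinearMap.comp_apply, LinearMap.rTensor_tmul, comul_ι_mul]
  generalize comul V g = z
  induction z using TensorProduct.induction_on with
  | zero => simp
  | tmul g h =>
    simp [TensorProduct.add_tmul, Rep.actMap, U.actS_ι, antipode_ι_mul, TensorProduct.tmul_neg,
      sub_eq_add_neg]
  | add y z hy hz =>
    simp only [map_add, TensorProduct.add_tmul] at hy hz ⊢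
    rw [add_add_add_comm, hy, hz, add_sub_add_comm]

theorem coactAntipode_map (v : V) (g : ExteriorAlgebra ℂ V) (x : U.carrier) :
    coactAntipode U (invol g ⊗ₜ U.act v x) =
      TensorProduct.map invol.toLinearMap (U.act v) (coactAntipode U (g ⊗ₜ x)) := by
  induction g using ext_induction with
  | h1 => simp [coactAntipode_one]
  | hs c g hg => simp only [map_smul, ← TensorProduct.smul_tmul', hg]
  | ha g h hg hh => simp only [map_add, TensorProduct.add_tmul, hg, hh]
  | hm w g hg =>
    rw [invol_ι_mul, TensorProduct.neg_tmul, map_neg, coactAntipode_ι_mul, coactAntipode_ι_mul, hg]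
    generalize coactAntipode U (g ⊗ₜ x) = z
    induction z using TensorProduct.induction_on with
    | zero => simp
    | tmul h y =>
      simp [TensorProduct.neg_tmul, U.act_act_apply w v, TensorProduct.tmul_neg]
      abel
    | add y z hy hz =>
      simp only [map_add, map_sub] at hy hz ⊢
      rw [add_sub_add_comm, neg_add, hy, hz]
      abel

/-- The map `L` is triangular: it sends `v z` to `v L(z)` plus a correction involving fewer vectors
in the first factor. Induction puts each `g ⊗ x` in the image; the correction contains `invol g`,
which is therefore carried along. -/
theorem surjective_of_ι_mul {L : ExteriorAlgebra ℂ V ⊗[ℂ] U.carrier →ₗ[ℂ] ExteriorAlgebra ℂ V ⊗[ℂ] U.carrier}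
    (h1 : ∀ x, L (1 ⊗ₜ x) = 1 ⊗ₜ x) (c : ℂ)
    (hm : ∀ v g x, L ((ι v * g) ⊗ₜ x) = LinearMap.rTensor _ (LinearMap.mulLeft ℂ (ι v)) (L (g ⊗ₜ x)) +
      c • TensorProduct.map invol.toLinearMap (U.act v) (L (g ⊗ₜ x))) : Function.Surjective L := by
  rw [← LinearMap.range_eq_top, eq_top_iff]
  have hm' : ∀ v z, L (LinearMap.rTensor _ (LinearMap.mulLeft ℂ (ι v)) z) =
      LinearMap.rTensor _ (LinearMap.mulLeft ℂ (ι v)) (L z) +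
      c • TensorProduct.map invol.toLinearMap (U.act v) (L z) := by
    intro v z
    induction z using TensorProduct.induction_on with
    | zero => simp
    | tmul h y => exact hm v h y
    | add y z hy hz => simp only [map_add, hy, hz, smul_add]; abel
  have key : ∀ g, (∀ x : U.carrier, g ⊗ₜ[ℂ] x ∈ LinearMap.range L) ∧
      ∀ x : U.carrier, invol g ⊗ₜ[ℂ] x ∈ LinearMap.range L := by
    intro g
    induction g using ext_induction with
    | h1 =>
      have : ∀ x : U.carrier, (1 : ExteriorAlgebra ℂ V) ⊗ₜ[ℂ] x ∈ LinearMap.range L := fun x => ⟨_, h1 x⟩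
      exact ⟨this, by rwa [map_one]⟩
    | hs a g hg =>
      simp only [map_smul, ← TensorProduct.smul_tmul']
      exact ⟨fun x => Submodule.smul_mem _ _ (hg.1 x), fun x => Submodule.smul_mem _ _ (hg.2 x)⟩
    | ha g h hg hh =>
      simp only [map_add, TensorProduct.add_tmul]
      exact ⟨fun x => Submodule.add_mem _ (hg.1 x) (hh.1 x), fun x => Submodule.add_mem _ (hg.2 x) (hh.2 x)⟩
    | hm v g hg =>
      have step : ∀ g, (∀ x : U.carrier, g ⊗ₜ[ℂ] x ∈ LinearMap.range L) →
          (∀ x : U.carrier, invol g ⊗ₜ[ℂ] x ∈ LinearMap.range L) →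
          ∀ x : U.carrier, (ι v * g) ⊗ₜ[ℂ] x ∈ LinearMap.range L := by
        intro g h1 h2 x
        obtain ⟨z, hz⟩ := h1 x
        have h3 := hm' v z
        rw [hz] at h3
        rw [LinearMap.rTensor_tmul, TensorProduct.map_tmul] at h3
        rw [show (ι v * g) ⊗ₜ[ℂ] x = L (LinearMap.rTensor _ (LinearMap.mulLeft ℂ (ι v)) z) -
          c • (invol g ⊗ₜ[ℂ] U.act v x) from eq_sub_of_add_eq h3.symm]
        exact Submodule.sub_mem _ ⟨_, rfl⟩ (Submodule.smul_mem _ _ (h2 _))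
      refine ⟨step g hg.1 hg.2, ?_⟩
      have := step (invol g) hg.2 (by rw [invol_invol]; exact hg.1)
      intro x
      rw [invol_ι_mul, TensorProduct.neg_tmul]
      exact Submodule.neg_mem _ (this x)
  intro z _
  induction z using TensorProduct.induction_on with
  | zero => exact Submodule.zero_mem _
  | tmul h y => exact (key h).1 y
  | add y z hy hz => exact Submodule.add_mem _ (hy trivial) (hz trivial)

theorem coact_surjective : Function.Surjective (coact U) :=
  surjective_of_ι_mul U (coact_one U) 1 fun v g x => by rw [coact_ι_mul, one_smul]

theorem coactAntipode_surjective : Function.Surjective (coactAntipode U) :=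
  surjective_of_ι_mul U (coactAntipode_one U) (-1) fun v g x => by
    rw [coactAntipode_ι_mul, sub_eq_add_neg, ← neg_one_smul ℂ (TensorProduct.map _ _ _)]

theorem SuperSpace.swap_swap (X Y : SuperSpace.{u}) (z : X.carrier ⊗[ℂ] Y.carrier) :
    SuperSpace.swap Y X (SuperSpace.swap X Y z) = z := by
  induction z using TensorProduct.induction_on with
  | zero => simp
  | tmul x y =>
    simp only [swap_tmul, map_smul, map_add, map_sub, par_par_apply]
    module
  | add y z hy hz => rw [map_add, map_add, hy, hz]

theorem SuperSpace.swap_surjective (X Y : SuperSpace.{u}) : Function.Surjective (SuperSpace.swap X Y) :=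
  fun z => ⟨_, SuperSpace.swap_swap Y X z⟩

variable (B : SymplecticForm V) (β : ℂ)

theorem SymplecticForm.expC_surjective [Nontrivial V] (t : ℂ) (X Y : Rep V) :
    Function.Surjective (B.expC t X Y) := by
  obtain ⟨m, hm⟩ : ∃ m, Module.finrank ℂ V = m + 1 :=
    ⟨Module.finrank ℂ V - 1, by have := Module.finrank_pos (R := ℂ) (M := V); omega⟩
  rw [B.expC_eq, hm]
  exact ((Module.End.isUnit_iff _).mp (isUnit_truncExp m t ⟨_, B.actC_pow X Y⟩)).2

section blocks

variable (X Y Z : Rep V) (X' Y' Z' : SuperSpace.{u})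

theorem vassoc_surjective (X Y Z : Type u) [AddCommGroup X] [Module ℂ X] [AddCommGroup Y] [Module ℂ Y]
    [AddCommGroup Z] [Module ℂ Z] : Function.Surjective (vassoc X Y Z) := LinearEquiv.surjective _

theorem vassoc'_surjective (X Y Z : Type u) [AddCommGroup X] [Module ℂ X] [AddCommGroup Y] [Module ℂ Y]
    [AddCommGroup Z] [Module ℂ Z] : Function.Surjective (vassoc' X Y Z) := LinearEquiv.surjective _

theorem surjective_comp {A A' A'' : Type*} [AddCommGroup A] [Module ℂ A] [AddCommGroup A']
    [Module ℂ A'] [AddCommGroup A''] [Module ℂ A''] {p : A' →ₗ[ℂ] A''} {q : A →ₗ[ℂ] A'}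
    (hp : Function.Surjective p) (hq : Function.Surjective q) : Function.Surjective (p ∘ₗ q) :=
  hp.comp hq

theorem assoc011_surjective : Function.Surjective (assoc011 X Y' Z') := by
  intro z
  obtain ⟨z, rfl⟩ := LinearMap.lTensor_surjective _ (vassoc_surjective _ _ _) z
  obtain ⟨z, rfl⟩ := vassoc'_surjective _ _ _ z
  obtain ⟨z, rfl⟩ := LinearMap.rTensor_surjective _ (surjective_comp (coactAntipode_surjective X)
    (SuperSpace.swap_surjective X.toSuperSpace (reg V).toSuperSpace)) z
  obtain ⟨z, rfl⟩ := vassoc_surjective _ _ _ z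
  exact ⟨z, rfl⟩

theorem assoc110_surjective : Function.Surjective (assoc110 X' Y' Z) := by
  intro z
  obtain ⟨z, rfl⟩ := vassoc_surjective _ _ _ z
  obtain ⟨z, rfl⟩ := LinearMap.lTensor_surjective _
    (SuperSpace.swap_surjective Z.toSuperSpace (X'.tensor Y')) z
  obtain ⟨z, rfl⟩ := vassoc'_surjective _ _ _ z
  obtain ⟨z, rfl⟩ := LinearMap.rTensor_surjective _ (coact_surjective Z) z
  obtain ⟨z, rfl⟩ := vassoc_surjective _ _ _ z
  obtain ⟨z, rfl⟩ := LinearMap.lTensor_surjective _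
    (SuperSpace.swap_surjective (X'.tensor Y') Z.toSuperSpace) z
  obtain ⟨z, rfl⟩ := LinearMap.lTensor_surjective _ (vassoc_surjective _ _ _) z
  exact ⟨z, by simp only [assoc110, LinearMap.comp_apply, LinearMap.lTensor_comp]⟩

theorem assoc111_surjective (hβ : β ^ 2 = 1) : Function.Surjective (assoc111 B β X' Y' Z') := by
  intro z
  obtain ⟨z, rfl⟩ := vassoc_surjective _ _ _ z
  obtain ⟨z, rfl⟩ := LinearMap.lTensor_surjective _ (vassoc_surjective _ _ _) z
  obtain ⟨z, rfl⟩ := vassoc'_surjective _ _ _ z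
  obtain ⟨z, rfl⟩ := LinearMap.rTensor_surjective _ (surjective_comp
    (LinearMap.rTensor_surjective _ (SymplecticForm.phi_bijective (B := B) hβ).2)
      (SuperSpace.swap_surjective X' (reg V).toSuperSpace)) z
  obtain ⟨z, rfl⟩ := vassoc_surjective _ _ _ z
  exact ⟨z, rfl⟩

variable [Nontrivial V]

theorem assoc010_surjective : Function.Surjective (assoc010 B X Y' Z) :=
  surjective_comp (vassoc_surjective _ _ _) <|
  surjective_comp (LinearMap.lTensor_surjective _ (SuperSpace.swap_surjective _ _)) <|
  surjective_comp (vassoc'_surjective _ _ _) <|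
  surjective_comp (LinearMap.rTensor_surjective _ (B.expC_surjective 1 X Z)) <|
  surjective_comp (vassoc_surjective _ _ _) <|
  LinearMap.lTensor_surjective _ (SuperSpace.swap_surjective _ _)

theorem assoc101_surjective : Function.Surjective (assoc101 B X' Y Z') :=
  surjective_comp (LinearMap.lTensor_surjective _
    (surjective_comp (LinearMap.rTensor_surjective _ (SuperSpace.swap_surjective _ _))
      (vassoc_surjective _ _ _))) <|
  surjective_comp (vassoc'_surjective _ _ _) <|
  surjective_comp (LinearMap.rTensor_surjective _ (B.expC_surjective 1 (reg V) Y)) <|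
  surjective_comp (vassoc_surjective _ _ _) <|
  LinearMap.lTensor_surjective _ (surjective_comp (vassoc'_surjective _ _ _) <|
    surjective_comp (LinearMap.rTensor_surjective _ (SuperSpace.swap_surjective _ _))
      (vassoc_surjective _ _ _))

end blocks

section invertible

variable [Nontrivial V] {β} (X Y Z : Obj V)

/-- If `a` is surjective and `α ∘ j = i ∘ a`, then the image of `i` lies in the image of `α`. -/
theorem mkQ_comp_eq_zero {A A' P Q : Type*} [AddCommGroup A] [Module ℂ A] [AddCommGroup A']
    [Module ℂ A'] [AddCommGroup P] [Module ℂ P] [AddCommGroup Q] [Module ℂ Q] {α : P →ₗ[ℂ] Q}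
    {j : A →ₗ[ℂ] P} {i : A' →ₗ[ℂ] Q} {a : A →ₗ[ℂ] A'} (h : α ∘ₗ j = i ∘ₗ a)
    (ha : Function.Surjective a) : (LinearMap.range α).mkQ ∘ₗ i = 0 := by
  refine LinearMap.ext fun y => ?_
  obtain ⟨x, rfl⟩ := ha y
  exact (Submodule.Quotient.mk_eq_zero _).mpr ⟨j x, LinearMap.congr_fun h x⟩

theorem surjective_of_mkQ_eq_zero {P Q : Type*} [AddCommGroup P] [Module ℂ P] [AddCommGroup Q]
    [Module ℂ Q] {α : P →ₗ[ℂ] Q} (h : (LinearMap.range α).mkQ = 0) : Function.Surjective α := by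
  rw [← LinearMap.range_eq_top, ← Submodule.ker_mkQ (LinearMap.range α), h, LinearMap.ker_zero]

/-- Modulo the image of the associator each of the four target sectors vanishes, because the
corresponding block is surjective. -/
theorem associator_f0_surjective : Function.Surjective (associator B β X Y Z).f0 := by
  have h1 := mkQ_comp_eq_zero (associator_000 B β X Y Z) (vassoc_surjective _ _ _)
  have h2 := mkQ_comp_eq_zero (associator_011 B β X Y Z) (assoc011_surjective _ _ _)
  have h3 := mkQ_comp_eq_zero (associator_101 B β X Y Z) (assoc101_surjective B _ _ _)
  have h4 : ∀ p z, (LinearMap.range (associator B β X Y Z).f0).mkQ ((0, p) ⊗ₜ z, 0) = 0 := by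
    intro p z
    obtain ⟨w, hw⟩ := assoc110_surjective Z.s0 X.s1 Y.s1 (p ⊗ₜ z)
    refine (Submodule.Quotient.mk_eq_zero _).mpr
      ⟨_, (LinearMap.congr_fun (associator_110 B β X Y Z) w).trans ?_⟩
    rw [LinearMap.comp_apply, hw]
    rfl
  refine surjective_of_mkQ_eq_zero ?_
  generalize (LinearMap.range (associator B β X Y Z).f0).mkQ = q at h1 h2 h3 h4 ⊢
  refine LinearMap.prod_ext (TensorProduct.ext (LinearMap.prod_ext ?_ ?_))
    (TensorProduct.ext (LinearMap.ext fun g => TensorProduct.ext (LinearMap.prod_ext ?_ ?_)))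
  · refine LinearMap.ext fun p => LinearMap.ext fun z => ?_
    exact LinearMap.congr_fun h1 (p ⊗ₜ z)
  · refine LinearMap.ext fun p => LinearMap.ext fun z => ?_
    exact h4 p z
  · refine LinearMap.ext fun p => LinearMap.ext fun z => ?_
    exact LinearMap.congr_fun h2 (g ⊗ₜ (p ⊗ₜ z))
  · refine LinearMap.ext fun p => LinearMap.ext fun z => ?_
    exact LinearMap.congr_fun h3 (g ⊗ₜ (p ⊗ₜ z))

theorem associator_f1_surjective (hβ : β ^ 2 = 1) : Function.Surjective (associator B β X Y Z).f1 := by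
  have h1 := mkQ_comp_eq_zero (associator_001 B β X Y Z) (vassoc_surjective _ _ _)
  have h2 := mkQ_comp_eq_zero (associator_010 B β X Y Z) (assoc010_surjective B _ _ _)
  have h3 := mkQ_comp_eq_zero (associator_100 B β X Y Z) (vassoc_surjective _ _ _)
  have h4 : ∀ p z, (LinearMap.range (associator B β X Y Z).f1).mkQ ((0, p) ⊗ₜ z, 0) = 0 := by
    intro p z
    obtain ⟨w, hw⟩ := assoc111_surjective B β X.s1 Y.s1 Z.s1 hβ (p ⊗ₜ z)
    refine (Submodule.Quotient.mk_eq_zero _).mpr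
      ⟨_, (LinearMap.congr_fun (associator_111 B β X Y Z) w).trans ?_⟩
    rw [LinearMap.comp_apply, hw]
    rfl
  refine surjective_of_mkQ_eq_zero ?_
  generalize (LinearMap.range (associator B β X Y Z).f1).mkQ = q at h1 h2 h3 h4 ⊢
  refine LinearMap.prod_ext (TensorProduct.ext (LinearMap.prod_ext ?_ ?_))
    (TensorProduct.ext (LinearMap.prod_ext ?_ ?_))
  · refine LinearMap.ext fun p => LinearMap.ext fun z => ?_
    exact LinearMap.congr_fun h1 (p ⊗ₜ z)
  · refine LinearMap.ext fun p => LinearMap.ext fun z => ?_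
    exact h4 p z
  · refine LinearMap.ext fun p => LinearMap.ext fun z => ?_
    exact LinearMap.congr_fun h2 (p ⊗ₜ z)
  · refine LinearMap.ext fun p => LinearMap.ext fun z => ?_
    exact LinearMap.congr_fun h3 (p ⊗ₜ z)

/-- Both bracketings have the same finite dimension, so surjectivity suffices. -/
theorem associator_bijective (hβ : β ^ 2 = 1) : Function.Bijective (associator B β X Y Z).f0 ∧
    Function.Bijective (associator B β X Y Z).f1 := by
  have h0 := associator_f0_surjective B (β := β) X Y Z
  have h1 := associator_f1_surjective B X Y Z hβ
  refine ⟨⟨(LinearMap.injective_iff_surjective_of_finrank_eq_finrank ?_).mpr h0, h0⟩,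
    ⟨(LinearMap.injective_iff_surjective_of_finrank_eq_finrank ?_).mpr h1, h1⟩⟩
  · simp only [Module.finrank_prod, Module.finrank_tensorProduct]; ring
  · simp only [Module.finrank_prod, Module.finrank_tensorProduct]; ring

end invertible
end coaction

section datum

variable {V : Type u} [AddCommGroup V] [Module ℂ V] [FiniteDimensional ℂ V]

local notation "ι" => ExteriorAlgebra.ι ℂ

/-! ### A construction of algebras with a one-dimensional twisted part -/

/-- A commutative algebra `A` in the untwisted sector, together with a character `ε`, a Frobenius form `κ`
and an element `s`, from which one obtains an algebra with twisted part `ℂ^{1|0}`, on which `A` acts by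
`ε`, and with the product `g ⊗ y ⊗ z ↦ y z g.s` of twisted elements. -/
structure Datum (B : SymplecticForm V) where
  A : Rep V
  p : A.carrier ⊗[ℂ] A.carrier →ₗ[ℂ] A.carrier
  one : A.carrier
  ε : A.carrier →ₗ[ℂ] ℂ
  κ : A.carrier →ₗ[ℂ] ℂ
  s : A.carrier
  p_assoc : ∀ a b c, p (a ⊗ₜ p (b ⊗ₜ c)) = p (p (a ⊗ₜ b) ⊗ₜ c)
  one_p : ∀ a, p (one ⊗ₜ a) = a
  p_one : ∀ a, p (a ⊗ₜ one) = a
  p_swap : ∀ z, p (SuperSpace.swap A.toSuperSpace A.toSuperSpace z) = p z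
  act_p : ∀ v a b, A.act v (p (a ⊗ₜ b)) = p (A.act v a ⊗ₜ b) + p (A.par a ⊗ₜ A.act v b)
  par_p : ∀ a b, A.par (p (a ⊗ₜ b)) = p (A.par a ⊗ₜ A.par b)
  act_one : ∀ v, A.act v one = 0
  par_one : A.par one = one
  ε_p : ∀ a b, ε (p (a ⊗ₜ b)) = ε a * ε b
  ε_one : ε one = 1
  ε_par : ∀ a, ε (A.par a) = ε a
  p_s : ∀ a, p (a ⊗ₜ s) = ε a • s
  s_p : ∀ a, p (s ⊗ₜ a) = ε a • s
  par_s : A.par s = s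
  actC_eq : B.actC A A = 0
  actS_hatC : A.actS B.hatC = 0
  ε_phi : ∀ g, ε (A.actS (B.phi 1 g) s) = ε (A.actS g s)
  κ_act : ∀ v a, κ (A.act v a) = 0
  κ_par : ∀ a, κ (A.par a) = κ a
  κ_s : κ s ≠ 0
  nondeg : ∀ a, (∀ b, κ (p (b ⊗ₜ a)) = 0) → a = 0
  simple : ∀ N : Submodule ℂ A.carrier, (∀ v, ∀ n ∈ N, A.act v n ∈ N) →
    (∀ l, ∀ n ∈ N, p (l ⊗ₜ n) ∈ N) → N = ⊥ ∨ N = ⊤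

theorem swap_ι_mul (A : Rep V) (x : A.carrier) (v : V) (g : ExteriorAlgebra ℂ V) :
    SuperSpace.swap A.toSuperSpace (reg V).toSuperSpace (x ⊗ₜ (ι v * g)) =
      LinearMap.rTensor A.carrier (LinearMap.mulLeft ℂ (ι v))
        (SuperSpace.swap A.toSuperSpace (reg V).toSuperSpace (A.par x ⊗ₜ g)) := by
  have h : (reg V).par (ι v * g) = -(ι v * invol g) := invol_ι_mul v g
  have h' : (reg V).par g = invol g := rfl
  rw [SuperSpace.swap_tmul, SuperSpace.swap_tmul, h, h', A.par_par_apply]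
  simp only [map_smul, map_add, map_sub, LinearMap.rTensor_tmul, LinearMap.mulLeft_apply,
    TensorProduct.neg_tmul]
  module

theorem swap_act (A : Rep V) (x : A.carrier) (v : V) (g : ExteriorAlgebra ℂ V) :
    SuperSpace.swap A.toSuperSpace (reg V).toSuperSpace (A.act v x ⊗ₜ g) =
      TensorProduct.map invol.toLinearMap (A.act v)
        (SuperSpace.swap A.toSuperSpace (reg V).toSuperSpace (x ⊗ₜ g)) := by
  have h' : (reg V).par g = invol g := rfl
  rw [SuperSpace.swap_tmul, SuperSpace.swap_tmul, h', A.par_act_apply]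
  simp only [map_smul, map_add, map_sub, TensorProduct.map_tmul, AlgHom.toLinearMap_apply, invol_invol,
    TensorProduct.tmul_neg]
  module

theorem coactAntipode_map' (U : Rep V) (v : V) (z : ExteriorAlgebra ℂ V ⊗[ℂ] U.carrier) :
    coactAntipode U (TensorProduct.map invol.toLinearMap (U.act v) z) =
      TensorProduct.map invol.toLinearMap (U.act v) (coactAntipode U z) := by
  induction z using TensorProduct.induction_on with
  | zero => simp
  | tmul g x => exact coactAntipode_map U v g x
  | add y z hy hz => rw [map_add, map_add, hy, hz, map_add, map_add]

theorem coactAntipode_rTensor (U : Rep V) (v : V) (z : ExteriorAlgebra ℂ V ⊗[ℂ] U.carrier) :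
    coactAntipode U (LinearMap.rTensor U.carrier (LinearMap.mulLeft ℂ (ι v)) z) =
      LinearMap.rTensor _ (LinearMap.mulLeft ℂ (ι v)) (coactAntipode U z) -
        TensorProduct.map invol.toLinearMap (U.act v) (coactAntipode U z) := by
  induction z using TensorProduct.induction_on with
  | zero => simp
  | tmul g x => exact coactAntipode_ι_mul U v g x
  | add y z hy hz => simp only [map_add, hy, hz]; abel

variable {B : SymplecticForm V} (D : Datum B)

namespace Datum

/-- The product of two elements of the twisted part. -/
def lineMul : (ULift.{u} ℂ) ⊗[ℂ] (ULift.{u} ℂ) →ₗ[ℂ] ℂ :=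
  LinearMap.mul' ℂ ℂ ∘ₗ TensorProduct.map ULift.moduleEquiv.toLinearMap ULift.moduleEquiv.toLinearMap

theorem lineMul_tmul (y z : ULift.{u} ℂ) : lineMul (y ⊗ₜ z) = y.down * z.down := rfl

/-- The product `S ⊗ H_1 ⊗ H_1 → A`. -/
def q : ExteriorAlgebra ℂ V ⊗[ℂ] ((ULift.{u} ℂ) ⊗[ℂ] (ULift.{u} ℂ)) →ₗ[ℂ] D.A.carrier :=
  (TensorProduct.rid ℂ D.A.carrier).toLinearMap ∘ₗ
    TensorProduct.map (LinearMap.applyₗ D.s ∘ₗ D.A.actS.toLinearMap) lineMul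

theorem q_tmul (g : ExteriorAlgebra ℂ V) (w) : D.q (g ⊗ₜ w) = lineMul w • D.A.actS g D.s := by
  simp [q]

/-- The action `A ⊗ H_1 → H_1`. -/
def l : D.A.carrier ⊗[ℂ] (ULift.{u} ℂ) →ₗ[ℂ] ULift.{u} ℂ :=
  (TensorProduct.lid ℂ _).toLinearMap ∘ₗ TensorProduct.map D.ε LinearMap.id

theorem l_tmul (a y) : D.l (a ⊗ₜ y) = D.ε a • y := by simp [l]

/-- The action `H_1 ⊗ A → H_1`. -/
def r : (ULift.{u} ℂ) ⊗[ℂ] D.A.carrier →ₗ[ℂ] ULift.{u} ℂ :=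
  (TensorProduct.rid ℂ _).toLinearMap ∘ₗ TensorProduct.map LinearMap.id D.ε

theorem r_tmul (y a) : D.r (y ⊗ₜ a) = D.ε a • y := by simp [r]

/-- The underlying object. -/
abbrev obj : Obj V := ⟨D.A, SuperSpace.evenLine⟩

/-- The multiplication. -/
def mul : GMap (D.obj.tensor D.obj) D.obj := ⟨D.p.coprod D.q, D.l.coprod D.r⟩

/-- The map `S ⊗ A → A`, `g ⊗ a ↦ ε(a) g.s`. -/
def actε : ExteriorAlgebra ℂ V ⊗[ℂ] D.A.carrier →ₗ[ℂ] D.A.carrier :=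
  (TensorProduct.rid ℂ D.A.carrier).toLinearMap ∘ₗ
    TensorProduct.map (LinearMap.applyₗ D.s ∘ₗ D.A.actS.toLinearMap) D.ε

theorem actε_tmul (g : ExteriorAlgebra ℂ V) (a) : D.actε (g ⊗ₜ a) = D.ε a • D.A.actS g D.s := by
  simp [actε]

theorem actε_rTensor (v : V) (z) :
    D.actε (LinearMap.rTensor _ (LinearMap.mulLeft ℂ (ι v)) z) = D.A.act v (D.actε z) := by
  induction z using TensorProduct.induction_on with
  | zero => simp
  | tmul g a => simp [actε_tmul, D.A.actS_ι]
  | add y z hy hz => simp only [map_add, hy, hz]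

/-- The identity behind associativity in sector 011: `∑ ± ε(S(g'').x) g'.s = x (g.s)`. At `g = 1` it
is `x s = ε(x) s`; the step is the Leibniz rule solved for `x (v.b)`. -/
theorem actε_coactAntipode (x : D.A.carrier) (g : ExteriorAlgebra ℂ V) :
    D.actε (coactAntipode D.A (SuperSpace.swap D.A.toSuperSpace (reg V).toSuperSpace (x ⊗ₜ g))) =
      D.p (x ⊗ₜ D.A.actS g D.s) := by
  induction g using ext_induction generalizing x with
  | h1 =>
    have h1 := SuperSpace.swap_even_right D.A.toSuperSpace (reg V).toSuperSpace x (y := 1)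
      (map_one invol)
    refine (congrArg (fun z => D.actε (coactAntipode D.A z)) h1).trans ?_
    refine (congrArg D.actε (coactAntipode_one D.A x)).trans ?_
    rw [actε_tmul, map_one, Module.End.one_apply, D.p_s]
  | hs c g hg =>
    rw [TensorProduct.tmul_smul, map_smul, map_smul, map_smul, hg, map_smul, LinearMap.smul_apply,
      TensorProduct.tmul_smul, map_smul]
  | ha g h hg hh =>
    rw [TensorProduct.tmul_add, map_add, map_add, map_add, hg, hh, map_add, LinearMap.add_apply,
      TensorProduct.tmul_add, map_add]
  | hm v g hg =>
    have h1 := D.act_p v (D.A.par x) (D.A.actS g D.s)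
    rw [swap_ι_mul]
    refine (congrArg D.actε (coactAntipode_rTensor D.A v _)).trans ?_
    rw [map_sub, actε_rTensor, ← coactAntipode_map', ← swap_act, hg, hg, h1, D.A.par_par_apply,
      D.A.actS_ι_mul, add_sub_cancel_left]

/-- The map `S ⊗ A → A`, `g ⊗ a ↦ (g.s) a`. -/
def actp : ExteriorAlgebra ℂ V ⊗[ℂ] D.A.carrier →ₗ[ℂ] D.A.carrier :=
  D.p ∘ₗ LinearMap.rTensor _ (LinearMap.applyₗ D.s ∘ₗ D.A.actS.toLinearMap)

theorem actp_tmul (g : ExteriorAlgebra ℂ V) (a) :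
    D.actp (g ⊗ₜ a) = D.p (D.A.actS g D.s ⊗ₜ a) := rfl

theorem actp_act (v : V) (z) :
    D.actp (LinearMap.rTensor _ (LinearMap.mulLeft ℂ (ι v)) z +
      TensorProduct.map invol.toLinearMap (D.A.act v) z) = D.A.act v (D.actp z) := by
  induction z using TensorProduct.induction_on with
  | zero => simp
  | tmul g a =>
    rw [LinearMap.rTensor_tmul, TensorProduct.map_tmul, map_add, actp_tmul, actp_tmul, actp_tmul,
      D.act_p, D.A.par_actS, D.par_s, LinearMap.mulLeft_apply, D.A.actS_ι_mul]
    rfl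
  | add y z hy hz =>
    simp only [map_add] at hy hz ⊢
    rw [← hy, ← hz]
    abel

/-- The identity behind sector 110: `∑ ± (g'.s)(g''.a) = g.(s a)` by equivariance of the product,
and `s a = ε(a) s`. -/
theorem actp_coact (g : ExteriorAlgebra ℂ V) (a : D.A.carrier) :
    D.actp (coact D.A (g ⊗ₜ a)) = D.ε a • D.A.actS g D.s := by
  induction g using ext_induction with
  | h1 => rw [coact_one, actp_tmul, map_one, Module.End.one_apply, D.s_p]
  | hs c g hg =>
    rw [← TensorProduct.smul_tmul', map_smul, map_smul, hg, map_smul, LinearMap.smul_apply, smul_comm]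
  | ha g h hg hh =>
    rw [TensorProduct.add_tmul, map_add, map_add, hg, hh, map_add, LinearMap.add_apply, smul_add]
  | hm v g hg => rw [coact_ι_mul, actp_act, hg, map_smul, D.A.actS_ι_mul]

variable [Nontrivial V]

theorem expC_eq (t : ℂ) (z : D.A.carrier ⊗[ℂ] D.A.carrier) : B.expC t D.A D.A z = z := by
  rw [B.expC_eq, D.actC_eq]
  exact truncExp_apply_of_eq_zero (by omega) t rfl

theorem actS_expHatC (t : ℂ) : D.A.actS (B.expHatC t) = LinearMap.id := by
  rw [SymplecticForm.expHatC_eq, map_truncExp, D.actS_hatC, ← LinearMap.id_comp (truncExp _ t _)]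
  exact truncExp_of_mul_eq_zero (by omega) t (by simp)

/-- The identity behind sector 101. The map `g ↦ g.s` carries the action of `C` on `S ⊗ A` to that
on `A ⊗ A`, where `C` acts as zero. -/
theorem actε_expC (t : ℂ) (z : ExteriorAlgebra ℂ V ⊗[ℂ] D.A.carrier) :
    D.actε (B.expC t (reg V) D.A z) = D.actε z := by
  have h1 : D.actε ∘ₗ B.actC (reg V) D.A = 0 := by
    refine TensorProduct.ext' fun g a => ?_
    let F : D.A.carrier ⊗[ℂ] D.A.carrier →ₗ[ℂ] D.A.carrier :=
      (TensorProduct.rid ℂ D.A.carrier).toLinearMap ∘ₗ LinearMap.lTensor _ D.ε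
    -- The parities in this argument are chosen to cancel the Koszul sign contained in `actC`.
    have h2 : F (B.actC D.A D.A (D.A.par (D.A.actS (invol g) D.s) ⊗ₜ a)) = 0 := by
      rw [D.actC_eq]; exact map_zero F
    rw [SymplecticForm.actC_tmul, map_sum] at h2
    rw [LinearMap.comp_apply, SymplecticForm.actC_tmul, map_sum, LinearMap.zero_apply, ← h2]
    refine Finset.sum_congr rfl fun i _ => ?_
    rw [D.A.par_par_apply, ← D.A.actS_ι_mul]
    refine (D.actε_tmul _ _).trans ?_
    simp [F]
    rfl
  have h2 := truncExp_of_mul_eq_zero (m := Module.finrank ℂ V + 1) (by omega) t h1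
  exact LinearMap.congr_fun h2 z

end Datum
end datum

/-! ### Associativity and unit of the constructed algebra -/

section datumAlg

variable {V : Type u} [AddCommGroup V] [Module ℂ V] [FiniteDimensional ℂ V]

local notation "ι" => ExteriorAlgebra.ι ℂ

variable {B : SymplecticForm V} (D : Datum B)

namespace Datum

theorem mul_mor : D.mul.IsMor where
  even0 := by
    refine LinearMap.prod_ext (TensorProduct.ext' fun a b => ?_) (TensorProduct.ext' fun g w => ?_)
    · simp [mul, D.par_p]
    · have h1 : D.A.par (D.A.actS g D.s) = D.A.actS (invol g) D.s := by rw [D.A.par_actS, D.par_s]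
      simp [mul, q_tmul]
      rw [h1]; rfl
  even1 := by
    refine LinearMap.prod_ext (TensorProduct.ext' fun a b => ?_) (TensorProduct.ext' fun a b => ?_)
    · simp [mul, l_tmul, D.ε_par]
    · simp [mul, r_tmul, D.ε_par]
  equivariant := fun v => by
    refine LinearMap.prod_ext (TensorProduct.ext' fun a b => ?_) (TensorProduct.ext' fun g w => ?_)
    · simp [mul, D.act_p]
    · simp [mul, q_tmul, D.A.actS_ι]

theorem par_line (y : ULift.{u} ℂ) : (SuperSpace.evenLine.{u}).par y = y := rfl

variable [Nontrivial V]

theorem swap_line_left (X : SuperSpace.{u}) (x : (SuperSpace.evenLine.{u}).carrier) (a : X.carrier) :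
    SuperSpace.swap SuperSpace.evenLine X (x ⊗ₜ[ℂ] a) = a ⊗ₜ[ℂ] x :=
  SuperSpace.swap_even_left SuperSpace.evenLine X (par_line x) a

theorem swap_line_right (X : SuperSpace.{u}) (x : (SuperSpace.evenLine.{u}).carrier) (a : X.carrier) :
    SuperSpace.swap X SuperSpace.evenLine (a ⊗ₜ[ℂ] x) = x ⊗ₜ[ℂ] a :=
  SuperSpace.swap_even_right X SuperSpace.evenLine a (par_line x)

theorem par_lines (x : (SuperSpace.evenLine.{u}.tensor SuperSpace.evenLine.{u}).carrier) :
    (SuperSpace.evenLine.{u}.tensor SuperSpace.evenLine.{u}).par x = x :=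
  LinearMap.congr_fun (TensorProduct.map_id (R := ℂ) (M := ULift.{u} ℂ) (N := ULift.{u} ℂ)) x

theorem swap_lines_left (X : SuperSpace.{u})
    (x : (SuperSpace.evenLine.{u}.tensor SuperSpace.evenLine.{u}).carrier) (a : X.carrier) :
    SuperSpace.swap (SuperSpace.evenLine.tensor SuperSpace.evenLine) X (x ⊗ₜ[ℂ] a) = a ⊗ₜ[ℂ] x :=
  SuperSpace.swap_even_left (SuperSpace.evenLine.tensor SuperSpace.evenLine) X (par_lines x) a

theorem swap_lines_right (X : SuperSpace.{u})
    (x : (SuperSpace.evenLine.{u}.tensor SuperSpace.evenLine.{u}).carrier) (a : X.carrier) :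
    SuperSpace.swap X (SuperSpace.evenLine.tensor SuperSpace.evenLine) (a ⊗ₜ[ℂ] x) = x ⊗ₜ[ℂ] a :=
  SuperSpace.swap_even_right X (SuperSpace.evenLine.tensor SuperSpace.evenLine) a (par_lines x)

/-- Stated for an arbitrary tensor `w`, because the coaction of a pure tensor is a sum of several.
-/
theorem q_block011 (w : ExteriorAlgebra ℂ V ⊗[ℂ] D.A.carrier) (y z : ULift.{u} ℂ) :
    D.q (LinearMap.lTensor (ExteriorAlgebra ℂ V)
      (TensorProduct.map (D.l.coprod D.r) (LinearMap.id (M := ULift.{u} ℂ)))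
      (LinearMap.lTensor (ExteriorAlgebra ℂ V)
        (LinearMap.rTensor (ULift.{u} ℂ) (LinearMap.inl ℂ (D.A.carrier ⊗[ℂ] ULift.{u} ℂ)
          ((ULift.{u} ℂ) ⊗[ℂ] D.A.carrier)))
        (LinearMap.lTensor (ExteriorAlgebra ℂ V) (vassoc D.A.carrier (ULift.{u} ℂ) (ULift.{u} ℂ))
          (TensorProduct.assoc ℂ (ExteriorAlgebra ℂ V) D.A.carrier _ (w ⊗ₜ (y ⊗ₜ z)))))) =
      lineMul (y ⊗ₜ z) • D.actε w := by
  induction w using TensorProduct.induction_on with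
  | zero => simp
  | tmul g a =>
    simp [q_tmul, l_tmul, lineMul_tmul, actε_tmul, smul_smul]
    ring_nf
  | add w w' hw hw' => rw [TensorProduct.add_tmul]; simp only [map_add, hw, hw', smul_add]

theorem q_block101 (w : ExteriorAlgebra ℂ V ⊗[ℂ] D.A.carrier) (y z : ULift.{u} ℂ) :
    D.q (LinearMap.lTensor (ExteriorAlgebra ℂ V)
      (TensorProduct.map (D.l.coprod D.r) (LinearMap.id (M := ULift.{u} ℂ)))
      (LinearMap.lTensor (ExteriorAlgebra ℂ V)
        (LinearMap.rTensor (ULift.{u} ℂ) (LinearMap.inr ℂ (D.A.carrier ⊗[ℂ] ULift.{u} ℂ)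
          ((ULift.{u} ℂ) ⊗[ℂ] D.A.carrier)))
        (LinearMap.lTensor (ExteriorAlgebra ℂ V) (LinearMap.rTensor (ULift.{u} ℂ)
            (SuperSpace.swap D.A.toSuperSpace SuperSpace.evenLine) ∘ₗ
            vassoc D.A.carrier (ULift.{u} ℂ) (ULift.{u} ℂ))
          (TensorProduct.assoc ℂ (ExteriorAlgebra ℂ V) D.A.carrier _ (w ⊗ₜ (y ⊗ₜ z)))))) =
      lineMul (y ⊗ₜ z) • D.actε w := by
  induction w using TensorProduct.induction_on with
  | zero => simp
  | tmul g a =>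
    have := swap_line_right D.A.toSuperSpace y a
    simp [q_tmul, r_tmul, lineMul_tmul, actε_tmul, smul_smul, this]
    ring_nf
  | add w w' hw hw' => rw [TensorProduct.add_tmul]; simp only [map_add, hw, hw', smul_add]

theorem q_block110 (w : ExteriorAlgebra ℂ V ⊗[ℂ] D.A.carrier) (y z : ULift.{u} ℂ) :
    D.p (TensorProduct.map D.q LinearMap.id
      ((TensorProduct.assoc ℂ (ExteriorAlgebra ℂ V) (ULift.{u} ℂ ⊗[ℂ] ULift.{u} ℂ) D.A.carrier).symm
      (LinearMap.lTensor (ExteriorAlgebra ℂ V)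
        (SuperSpace.swap D.A.toSuperSpace (SuperSpace.evenLine.tensor SuperSpace.evenLine))
          (TensorProduct.assoc ℂ (ExteriorAlgebra ℂ V) D.A.carrier _ (w ⊗ₜ (y ⊗ₜ z)))))) =
      lineMul (y ⊗ₜ z) • D.actp w := by
  induction w using TensorProduct.induction_on with
  | zero => simp
  | tmul g a =>
    have := swap_lines_right D.A.toSuperSpace (y ⊗ₜ z) a
    simp [q_tmul, actp_tmul, this]
    rw [← TensorProduct.smul_tmul', map_smul]
  | add w w' hw hw' => rw [TensorProduct.add_tmul]; simp only [map_add, hw, hw', smul_add]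

theorem mul_assoc_f0 : (D.mul.comp ((GMap.id D.obj).tensor D.mul)).f0 =
    ((D.mul.comp (D.mul.tensor (GMap.id D.obj))).comp (associator B 1 D.obj D.obj D.obj)).f0 := by
  refine triple_ext_f0 ?_ ?_ ?_ ?_
  · intro x y z
    simp [GMap.comp, GMap.tensor, GMap.id, associator, mul, D.p_assoc]
  · intro x g y z
    simp [GMap.comp, GMap.tensor, GMap.id, associator, mul, q_tmul, assoc011]
    refine Eq.trans ?_ (q_block011 D _ y z).symm
    rw [D.actε_coactAntipode]
  · intro g x a z
    have h1 := swap_line_left D.A.toSuperSpace x a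
    simp [GMap.comp, GMap.tensor, GMap.id, associator, mul, q_tmul, l_tmul, assoc101, h1]
    refine Eq.trans ?_ (q_block101 D _ x z).symm
    rw [D.actε_expC, actε_tmul, smul_comm]
  · intro g x y a
    have h1 := swap_lines_left D.A.toSuperSpace (x ⊗ₜ y) a
    simp [GMap.comp, GMap.tensor, GMap.id, associator, mul, q_tmul, r_tmul, assoc110, h1]
    refine Eq.trans ?_ (q_block110 D _ x y).symm
    rw [D.actp_coact, smul_comm]

theorem mul_assoc_f1 : (D.mul.comp ((GMap.id D.obj).tensor D.mul)).f1 =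
    ((D.mul.comp (D.mul.tensor (GMap.id D.obj))).comp (associator B 1 D.obj D.obj D.obj)).f1 := by
  refine triple_ext_f1 ?_ ?_ ?_ ?_
  · intro x y z
    simp [GMap.comp, GMap.tensor, GMap.id, associator, mul, l_tmul, D.ε_p, smul_smul]
    rw [mul_comm]
  · intro a y c
    have h1 := swap_line_left D.A.toSuperSpace y c
    have h2 := swap_line_right D.A.toSuperSpace y c
    simp [GMap.comp, GMap.tensor, GMap.id, associator, mul, l_tmul, r_tmul, assoc010, D.expC_eq, h1, h2]
  · intro y a b
    simp [GMap.comp, GMap.tensor, GMap.id, associator, mul, r_tmul, D.ε_p, smul_smul]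
    rw [mul_comm]
  · intro x g y z
    have h1 : (SuperSpace.swap SuperSpace.evenLine (reg V).toSuperSpace) (x ⊗ₜ g) = g ⊗ₜ x :=
      swap_line_left (reg V).toSuperSpace x g
    simp [GMap.comp, GMap.tensor, GMap.id, associator, mul, q_tmul, r_tmul, l_tmul, assoc111, h1,
      D.ε_phi, lineMul_tmul]
    ext
    simp
    ring

/-- The unit. -/
def unit : GMap (Obj.one V) D.obj :=
  ⟨LinearMap.toSpanSingleton ℂ _ D.one ∘ₗ ULift.moduleEquiv.toLinearMap, 0⟩

theorem unit_mor : D.unit.IsMor where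
  even0 := by
    refine LinearMap.ext fun c => ?_
    simp [unit, D.par_one]
  even1 := by simp [unit]
  equivariant := fun v => by
    refine LinearMap.ext fun c => ?_
    simp [unit, D.act_one]

/-- The algebra defined by `D`. -/
def alg : Alg B (1 : ℂ) where
  obj := D.obj
  mul := D.mul
  mul_mor := D.mul_mor
  unit := D.unit
  unit_mor := D.unit_mor
  mul_assoc := GMap.ext D.mul_assoc_f0 D.mul_assoc_f1
  mul_unit := by
    refine GMap.ext (LinearMap.prod_ext (TensorProduct.ext' fun a b => ?_)
      (TensorProduct.ext' fun g w => ?_)) (LinearMap.prod_ext (TensorProduct.ext' fun a b => ?_)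
      (TensorProduct.ext' fun a b => ?_))
    · simp [GMap.comp, GMap.tensor, GMap.id, rightUnitor, mul, unit, D.p_one]
    · simp [GMap.comp, GMap.tensor, GMap.id, rightUnitor, mul, unit]
    · simp [GMap.comp, GMap.tensor, GMap.id, rightUnitor, mul, unit]
    · simp [GMap.comp, GMap.tensor, GMap.id, rightUnitor, mul, unit, r_tmul, D.ε_one]
  unit_mul := by
    refine GMap.ext (LinearMap.prod_ext (TensorProduct.ext' fun a b => ?_)
      (TensorProduct.ext' fun g w => ?_)) (LinearMap.prod_ext (TensorProduct.ext' fun a b => ?_)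
      (TensorProduct.ext' fun a b => ?_))
    · simp [GMap.comp, GMap.tensor, GMap.id, leftUnitor, mul, unit, ← TensorProduct.smul_tmul', D.one_p]
    · simp [GMap.comp, GMap.tensor, GMap.id, leftUnitor, mul, unit]
    · simp [GMap.comp, GMap.tensor, GMap.id, leftUnitor, mul, unit, l_tmul, D.ε_one]
    · simp [GMap.comp, GMap.tensor, GMap.id, leftUnitor, mul, unit]

end Datum
end datumAlg

/-! ### The Frobenius pairing of the constructed algebra -/

section datumGood

variable {V : Type u} [AddCommGroup V] [Module ℂ V] [FiniteDimensional ℂ V]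

local notation "ι" => ExteriorAlgebra.ι ℂ

variable {B : SymplecticForm V} (D : Datum B)

namespace Datum

/-- The map `A → A*` given by the Frobenius form. -/
def toDual : D.A.carrier →ₗ[ℂ] Module.Dual ℂ D.A.carrier :=
  (TensorProduct.curry (D.κ ∘ₗ D.p)).flip

theorem toDual_injective : Function.Injective D.toDual :=
  (injective_iff_map_eq_zero _).mpr fun a ha => D.nondeg a fun b => LinearMap.congr_fun ha b

/-- The isomorphism `A ⊗ A → Hom(A, A)`, `x ⊗ y ↦ (b ↦ κ(b x) y)`. -/
def homEquiv : D.A.carrier ⊗[ℂ] D.A.carrier ≃ₗ[ℂ] (D.A.carrier →ₗ[ℂ] D.A.carrier) :=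
  TensorProduct.congr (LinearEquiv.ofInjectiveOfFinrankEq D.toDual D.toDual_injective
    (Subspace.dual_finrank_eq).symm) (LinearEquiv.refl ℂ _) ≪≫ₗ dualTensorHomEquiv ℂ _ _

theorem homEquiv_tmul (x y b) : D.homEquiv (x ⊗ₜ y) b = D.κ (D.p (b ⊗ₜ x)) • y := by
  simp [homEquiv]
  rfl

/-- The copairing in `A ⊗ A`. -/
def copair : D.A.carrier ⊗[ℂ] D.A.carrier := D.homEquiv.symm LinearMap.id

theorem homEquiv_par (z b) :
    D.homEquiv ((D.A.tensor D.A).par z) b = D.A.par (D.homEquiv z (D.A.par b)) := by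
  induction z using TensorProduct.induction_on with
  | zero => simp
  | tmul x y =>
    have h := D.κ_par (D.p (D.A.par b ⊗ₜ x))
    rw [D.par_p, D.A.par_par_apply] at h
    rw [TensorProduct.map_tmul, homEquiv_tmul, homEquiv_tmul, map_smul, h]
  | add y z hy hz => simp only [map_add, LinearMap.add_apply, hy, hz]

theorem homEquiv_act (v : V) (z b) : D.homEquiv ((D.A.tensor D.A).act v z) b =
    D.A.act v (D.homEquiv z (D.A.par b)) - D.homEquiv z (D.A.act v (D.A.par b)) := by
  induction z using TensorProduct.induction_on with
  | zero => simp
  | tmul x y =>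
    have h := D.κ_act v (D.p (D.A.par b ⊗ₜ x))
    rw [D.act_p, D.A.par_par_apply, map_add, add_comm] at h
    have h' := D.κ_par (D.p (D.A.par b ⊗ₜ x))
    rw [D.par_p, D.A.par_par_apply] at h'
    simp [homEquiv_tmul, h', eq_neg_of_add_eq_zero_left h]
    abel
  | add y z hy hz => rw [map_add, map_add, LinearMap.add_apply, hy, hz]
                     simp only [map_add, LinearMap.add_apply]
                     abel

/-- Under `homEquiv` the copairing is the identity operator, which is even; `act_copair` uses in the
same way that it is equivariant. -/
theorem par_copair : (D.A.tensor D.A).par D.copair = D.copair := by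
  apply D.homEquiv.injective
  ext b
  rw [homEquiv_par, copair, LinearEquiv.apply_symm_apply, LinearMap.id_apply, LinearMap.id_apply,
    D.A.par_par_apply]

theorem act_copair (v : V) : (D.A.tensor D.A).act v D.copair = 0 := by
  apply D.homEquiv.injective
  ext b
  rw [homEquiv_act, copair, LinearEquiv.apply_symm_apply, LinearMap.id_apply, LinearMap.id_apply,
    sub_self, map_zero, LinearMap.zero_apply]

/-- For `z = ∑ c' ⊗ c''`, the operator `homEquiv z` is `x ↦ ∑ κ(x c') c''`. -/
theorem lid_map_assoc (x : D.A.carrier) (z : D.A.carrier ⊗[ℂ] D.A.carrier) :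
    TensorProduct.lid ℂ D.A.carrier (TensorProduct.map (D.κ ∘ₗ D.p) LinearMap.id
      ((TensorProduct.assoc ℂ D.A.carrier D.A.carrier D.A.carrier).symm (x ⊗ₜ z))) =
      D.homEquiv z x := by
  induction z using TensorProduct.induction_on with
  | zero => simp
  | tmul y z => simp [homEquiv_tmul]
  | add y z hy hz => simp only [map_add, TensorProduct.tmul_add, LinearMap.add_apply, hy, hz]

/-- The copairing is defined by the other zig-zag. Testing this one against `b` under the
non-degenerate form and using associativity reduces it to that definition. -/
theorem rid_map_assoc (x : D.A.carrier) :
    TensorProduct.rid ℂ D.A.carrier (TensorProduct.map LinearMap.id (D.κ ∘ₗ D.p)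
      (TensorProduct.assoc ℂ D.A.carrier D.A.carrier D.A.carrier (D.copair ⊗ₜ x))) = x := by
  rw [← sub_eq_zero]
  refine D.nondeg _ fun b => ?_
  have key : ∀ z : D.A.carrier ⊗[ℂ] D.A.carrier,
      D.κ (D.p (b ⊗ₜ (TensorProduct.rid ℂ D.A.carrier (TensorProduct.map LinearMap.id (D.κ ∘ₗ D.p)
        (TensorProduct.assoc ℂ D.A.carrier D.A.carrier D.A.carrier (z ⊗ₜ x)))))) =
      D.κ (D.p (D.homEquiv z b ⊗ₜ x)) := by
    intro z
    induction z using TensorProduct.induction_on with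
    | zero => simp
    | tmul y z => simp [homEquiv_tmul, ← TensorProduct.smul_tmul', mul_comm]
    | add y z hy hz => simp only [map_add, TensorProduct.add_tmul, TensorProduct.tmul_add,
        LinearMap.add_apply, hy, hz]
  rw [TensorProduct.tmul_sub, map_sub, map_sub, key, copair, LinearEquiv.apply_symm_apply,
    LinearMap.id_apply, sub_self]

/-- The Frobenius form. -/
def frob : GMap D.obj (Obj.one V) := ⟨ULift.moduleEquiv.symm.toLinearMap ∘ₗ D.κ, 0⟩

theorem frob_mor : D.frob.IsMor where
  even0 := LinearMap.ext fun a => by simp [frob, D.κ_par]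
  even1 := by simp [frob]
  equivariant := fun v => LinearMap.ext fun a => by simp [frob, D.κ_act]; rfl

/-- The copairing; `t` is a generator of the top degree of `S`. -/
def copairing (t : ExteriorAlgebra ℂ V) : GMap (Obj.one V) (D.obj.tensor D.obj) :=
  ⟨LinearMap.toSpanSingleton ℂ _ (D.copair, ((D.κ D.s)⁻¹ • t) ⊗ₜ (ULift.up 1 ⊗ₜ ULift.up 1)) ∘ₗ
    ULift.moduleEquiv.toLinearMap, 0⟩

theorem copairing_mor {t : ExteriorAlgebra ℂ V} (h1 : ∀ v, ι v * t = 0) (h2 : invol t = t) :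
    (D.copairing t).IsMor where
  even0 := LinearMap.ext fun a => by
    have h2' : ExteriorAlgebra.map (-LinearMap.id) t = t := h2
    have h3 := D.par_copair
    simp [copairing, h2', h3]
  even1 := by simp [copairing]
  equivariant := fun v => LinearMap.ext fun a => by
    have h3 := D.act_copair v
    simp [copairing] at h3 ⊢
    simp [h1, ← smul_add, h3]
    rfl

theorem line_tensor_ext {X M : Type*} [AddCommGroup X] [Module ℂ X] [AddCommGroup M] [Module ℂ M]
    {p q : (ULift.{u} ℂ) ⊗[ℂ] X →ₗ[ℂ] M} (h : ∀ x, p (ULift.up 1 ⊗ₜ x) = q (ULift.up 1 ⊗ₜ x)) : p = q := by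
  refine TensorProduct.ext' fun c x => ?_
  have hc : c = c.down • ULift.up 1 := by ext; simp
  rw [hc, ← TensorProduct.smul_tmul', map_smul, map_smul, h]

theorem frob_comp_inl : (ULift.moduleEquiv.{0, 0, u} (R := ℂ) (M := ℂ)).toLinearMap ∘ₗ
    (((ULift.moduleEquiv.{0, 0, u} (R := ℂ) (M := ℂ)).symm.toLinearMap ∘ₗ D.κ) ∘ₗ
      D.p.coprod D.q) ∘ₗ LinearMap.inl ℂ _ _ = D.κ ∘ₗ D.p := by
  refine LinearMap.ext fun z => ?_
  simp

theorem frob_comp_inr : (ULift.moduleEquiv.{0, 0, u} (R := ℂ) (M := ℂ)).toLinearMap ∘ₗ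
    (((ULift.moduleEquiv.{0, 0, u} (R := ℂ) (M := ℂ)).symm.toLinearMap ∘ₗ D.κ) ∘ₗ
      D.p.coprod D.q) ∘ₗ LinearMap.inr ℂ _ _ = D.κ ∘ₗ D.q := by
  refine LinearMap.ext fun z => ?_
  simp

theorem κ_q_inv (x : ULift.{u} ℂ) :
    D.κ (D.q (((D.κ D.s)⁻¹ • 1) ⊗ₜ (ULift.up 1 ⊗ₜ x))) = x.down := by
  have := D.κ_s
  rw [q_tmul, lineMul_tmul]
  simp
  field_simp

variable [Nontrivial V]

/-- In the untwisted sector this is the defining property of `copair`. In the twisted sector the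
associator turns `t` into `φ(t) = 1`, and the factor `κ(s)⁻¹` of the copairing cancels the value
`κ(s)` of the pairing. -/
theorem zigzag_left {t : ExteriorAlgebra ℂ V} (h3 : B.phi 1 t = 1) :
    (leftUnitor D.obj).comp (((D.frob.comp D.mul).tensor (GMap.id D.obj)).comp
      ((associator B 1 D.obj D.obj D.obj).comp ((GMap.id D.obj).tensor (D.copairing t)))) =
      rightUnitor D.obj := by
  refine GMap.ext (LinearMap.prod_ext (TensorProduct.ext' fun x c => ?_) (TensorProduct.ext' fun x c => ?_))
    (LinearMap.prod_ext (TensorProduct.ext' fun x c => ?_) (TensorProduct.ext' fun x c => ?_))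
  · simp [GMap.comp, GMap.tensor, GMap.id, associator, mul, leftUnitor, rightUnitor, copairing, frob]
    rw [frob_comp_inl]
    refine congrArg (c.down • ·) ((D.lid_map_assoc x D.copair).trans ?_)
    rw [copair, LinearEquiv.apply_symm_apply, LinearMap.id_apply]
  · simp [GMap.comp, GMap.tensor, GMap.id, associator, mul, leftUnitor, rightUnitor, copairing, frob]
  · simp [GMap.comp, GMap.tensor, GMap.id, associator, mul, leftUnitor, rightUnitor, copairing, frob]
  · have h5 : (SuperSpace.swap SuperSpace.evenLine (reg V).toSuperSpace) (x ⊗ₜ t) = t ⊗ₜ x :=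
      swap_line_left (reg V).toSuperSpace x t
    simp [GMap.comp, GMap.tensor, GMap.id, associator, mul, leftUnitor, rightUnitor, copairing, frob]
    rw [frob_comp_inr]
    simp [assoc111, h5, h3, q_tmul, lineMul_tmul, D.κ_s, ← TensorProduct.smul_tmul',
      TensorProduct.tmul_smul]
    congr 1
    ext
    simp
    field_simp [D.κ_s]

/-- Only the component in sector 000 is needed, as the pairing vanishes on the twisted sector; a
preimage in sector 110 is therefore merely chosen. -/
theorem associator_symm_f0 (τ : ExteriorAlgebra ℂ V ⊗[ℂ] ((ULift.{u} ℂ) ⊗[ℂ] (ULift.{u} ℂ)))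
    (e0 : (D.obj.tensor (D.obj.tensor D.obj)).s0.carrier ≃ₗ[ℂ]
      ((D.obj.tensor D.obj).tensor D.obj).s0.carrier)
    (he : ∀ z, e0 z = (associator B 1 D.obj D.obj D.obj).f0 z) (x : D.A.carrier) :
    (e0.symm ((D.copair, τ) ⊗ₜ x, 0)).1 = LinearMap.lTensor D.A.carrier (LinearMap.inl ℂ _ _)
      (TensorProduct.assoc ℂ D.A.carrier D.A.carrier D.A.carrier (D.copair ⊗ₜ x)) := by
  obtain ⟨w, hw⟩ := assoc110_surjective D.obj.s0 D.obj.s1 D.obj.s1 (τ ⊗ₜ x)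
  have ha := LinearMap.congr_fun (associator_000 B 1 D.obj D.obj D.obj)
    (TensorProduct.assoc ℂ D.A.carrier D.A.carrier D.A.carrier (D.copair ⊗ₜ x))
  have hb := (LinearMap.congr_fun (associator_110 B 1 D.obj D.obj D.obj) w).trans
    ((LinearMap.comp_apply _ _ _).trans (congrArg _ hw))
  have hc : e0 (LinearMap.lTensor D.A.carrier (LinearMap.inl ℂ _ _)
      (TensorProduct.assoc ℂ D.A.carrier D.A.carrier D.A.carrier (D.copair ⊗ₜ x)),
      LinearMap.lTensor (ExteriorAlgebra ℂ V)
        (LinearMap.lTensor (ULift.{u} ℂ) (LinearMap.inr ℂ _ _)) w) = ((D.copair, τ) ⊗ₜ x, 0) := by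
    refine (congrArg e0 (Prod.fst_add_snd _).symm).trans ((map_add e0 _ _).trans
      ((congrArg₂ (· + ·) ((he _).trans ha) ((he _).trans hb)).trans ?_))
    simp [← TensorProduct.add_tmul]
  rw [← hc, e0.symm_apply_apply]

/-- Here the relevant block is `φ`, and `φ(1) = t` provides the explicit preimage. -/
theorem associator_symm_f1 {t : ExteriorAlgebra ℂ V} (h4 : B.phi 1 1 = t)
    {τ : ExteriorAlgebra ℂ V ⊗[ℂ] ((ULift.{u} ℂ) ⊗[ℂ] (ULift.{u} ℂ))}
    (hτ : τ = ((D.κ D.s)⁻¹ • t) ⊗ₜ (ULift.up 1 ⊗ₜ ULift.up 1))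
    (e1 : (D.obj.tensor (D.obj.tensor D.obj)).s1.carrier ≃ₗ[ℂ]
      ((D.obj.tensor D.obj).tensor D.obj).s1.carrier)
    (he : ∀ z, e1 z = (associator B 1 D.obj D.obj D.obj).f1 z) (x : ULift.{u} ℂ) :
    (e1.symm ((D.copair, τ) ⊗ₜ x, 0)).2 =
        ULift.up 1 ⊗ₜ (0, ((D.κ D.s)⁻¹ • 1) ⊗ₜ (ULift.up 1 ⊗ₜ x)) := by
  have ha := LinearMap.congr_fun (associator_001 B 1 D.obj D.obj D.obj)
    (TensorProduct.assoc ℂ D.A.carrier D.A.carrier (ULift.{u} ℂ) (D.copair ⊗ₜ x))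
  have hc : e1 (LinearMap.lTensor D.A.carrier (LinearMap.inl ℂ _ _)
      (TensorProduct.assoc ℂ D.A.carrier D.A.carrier (ULift.{u} ℂ) (D.copair ⊗ₜ x)),
      ULift.up 1 ⊗ₜ (0, ((D.κ D.s)⁻¹ • 1) ⊗ₜ (ULift.up 1 ⊗ₜ x))) = ((D.copair, τ) ⊗ₜ x, 0) := by
    have h5 : (SuperSpace.swap SuperSpace.evenLine (reg V).toSuperSpace)
        (ULift.up 1 ⊗ₜ 1) = 1 ⊗ₜ ULift.up 1 := swap_line_left (reg V).toSuperSpace _ _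
    have hb : (associator B 1 D.obj D.obj D.obj).f1
        (0, ULift.up 1 ⊗ₜ (0, ((D.κ D.s)⁻¹ • 1) ⊗ₜ (ULift.up 1 ⊗ₜ x))) = ((0, τ) ⊗ₜ x, 0) := by
      simp [associator, assoc111, h5, h4, hτ, ← TensorProduct.smul_tmul', TensorProduct.tmul_smul]
      rw [TensorProduct.smul_tmul', Prod.smul_mk, smul_zero]
    refine (congrArg e1 (Prod.fst_add_snd _).symm).trans ((map_add e1 _ _).trans
      ((congrArg₂ (· + ·) ((he _).trans ha) ((he _).trans hb)).trans ?_))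
    simp [← TensorProduct.add_tmul]
  rw [← hc, e1.symm_apply_apply]

theorem isNondegeneratePairing {t : ExteriorAlgebra ℂ V} (h1 : ∀ v, ι v * t = 0) (h2 : invol t = t)
    (h3 : B.phi 1 t = 1) (h4 : B.phi 1 1 = t) :
    IsNondegeneratePairing B 1 D.obj (D.frob.comp D.mul) := by
  refine ⟨D.frob_mor.comp D.mul_mor, D.copairing t, D.copairing_mor h1 h2, D.zigzag_left h3, ?_⟩
  obtain ⟨hb0, hb1⟩ := associator_bijective B D.obj D.obj D.obj (β := 1) (by norm_num)
  obtain ⟨e0, he0⟩ : ∃ e0 : _ ≃ₗ[ℂ] _, ∀ z, e0 z = (associator B 1 D.obj D.obj D.obj).f0 z :=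
    ⟨LinearEquiv.ofBijective _ hb0, fun _ => rfl⟩
  obtain ⟨e1, he1⟩ : ∃ e1 : _ ≃ₗ[ℂ] _, ∀ z, e1 z = (associator B 1 D.obj D.obj D.obj).f1 z :=
    ⟨LinearEquiv.ofBijective _ hb1, fun _ => rfl⟩
  obtain ⟨τ, hτ⟩ : ∃ τ : ExteriorAlgebra ℂ V ⊗[ℂ] ((ULift.{u} ℂ) ⊗[ℂ] (ULift.{u} ℂ)),
    τ = ((D.κ D.s)⁻¹ • t) ⊗ₜ (ULift.up 1 ⊗ₜ ULift.up 1) := ⟨_, rfl⟩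
  have hF0 := D.associator_symm_f0 τ e0 he0
  have hF1 := D.associator_symm_f1 h4 hτ e1 he1
  refine ⟨⟨e0.symm, e1.symm⟩, GMap.ext (LinearMap.ext fun z => ?_) (LinearMap.ext fun z => ?_),
    GMap.ext (LinearMap.ext fun z => ?_) (LinearMap.ext fun z => ?_), ?_⟩
  · exact (congrArg e0.symm (he0 z).symm).trans (e0.symm_apply_apply z)
  · exact (congrArg e1.symm (he1 z).symm).trans (e1.symm_apply_apply z)
  · exact (he0 _).symm.trans (e0.apply_symm_apply z)
  · exact (he1 _).symm.trans (e1.apply_symm_apply z)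
  refine GMap.ext (LinearMap.prod_ext (line_tensor_ext fun x => ?_) (TensorProduct.ext' fun x c => ?_))
    (LinearMap.prod_ext (line_tensor_ext fun x => ?_) (TensorProduct.ext' fun x c => ?_))
  · have h := hF0 x
    simp [GMap.comp, GMap.tensor, GMap.id, mul, leftUnitor, rightUnitor, copairing, frob, ← hτ]
    rw [h, LinearMap.lTensor, ← LinearMap.comp_apply (TensorProduct.map _ _), ← TensorProduct.map_comp]
    refine Eq.trans ?_ (D.rid_map_assoc x)
    rw [← frob_comp_inl]
    rfl
  · simp [GMap.comp, GMap.tensor, GMap.id, mul, leftUnitor, rightUnitor, copairing, frob]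
    rw [show e0.symm (0, 0) = 0 from map_zero _]
    exact map_zero _
  · have h := hF1 x
    simp [GMap.comp, GMap.tensor, GMap.id, mul, leftUnitor, rightUnitor, copairing, frob, ← hτ]
    rw [h]
    simp
    rw [D.κ_q_inv]
    ext
    simp
  · simp [GMap.comp, GMap.tensor, GMap.id, mul, leftUnitor, rightUnitor, copairing, frob]
    rw [show e1.symm (0, 0) = 0 from map_zero _]
    exact map_zero _

end Datum
end datumGood

/-! ### Commutativity, twist and simplicity of the constructed algebra -/

section datumGood

variable {V : Type u} [AddCommGroup V] [Module ℂ V] [FiniteDimensional ℂ V] [Nontrivial V]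

local notation "ι" => ExteriorAlgebra.ι ℂ

variable {B : SymplecticForm V} (D : Datum B)

namespace Datum

theorem s_ne_zero : D.s ≠ 0 := fun h => D.κ_s (by rw [h, map_zero])

theorem commutative : D.mul.comp (braiding B 1 D.obj D.obj) = D.mul := by
  refine GMap.ext (LinearMap.prod_ext (LinearMap.ext fun z => ?_)
      (TensorProduct.ext' fun g w => ?_)) (LinearMap.prod_ext (TensorProduct.ext' fun a y => ?_)
      (TensorProduct.ext' fun y a => ?_))
  · simp [GMap.comp, mul, braiding, braid00, D.expC_eq, D.p_swap]
  · induction w using TensorProduct.induction_on with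
    | zero => exact (congrArg (fun z => (D.mul.comp (braiding B 1 D.obj D.obj)).f0 (0, z))
        (TensorProduct.tmul_zero _ g)).trans ((map_zero _).trans
          ((congrArg (fun z => D.mul.f0 (0, z)) (TensorProduct.tmul_zero _ g)).trans (map_zero _)).symm)
    | add y z hy hz => simp only [TensorProduct.tmul_add, map_add, hy, hz]
    | tmul y z =>
      have h1 := swap_line_left SuperSpace.evenLine.{u} y z
      simp [GMap.comp, mul, braiding, braid11, h1, q_tmul, D.actS_expHatC, lineMul_tmul]
      rw [mul_comm]
  · have h1 := swap_line_right D.A.toSuperSpace y a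
    simp [GMap.comp, mul, braiding, braid01, D.actS_expHatC, h1, l_tmul, r_tmul]
  · have h1 := fun a => swap_line_left D.A.toSuperSpace y a
    simp [GMap.comp, mul, braiding, braid10, D.actS_expHatC, h1, l_tmul, r_tmul, D.ε_par]

theorem trivial_twist : twist B 1 D.obj = GMap.id D.obj := by
  refine GMap.ext (D.actS_expHatC (-1)) ?_
  simp [twist, GMap.id]

theorem mul_f0_left (z : D.A.carrier ⊗[ℂ] D.A.carrier) : D.mul.f0 (z, 0) = D.p z := by
  refine (LinearMap.coprod_apply D.p D.q (z, 0)).trans ?_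
  rw [map_zero, add_zero]

theorem mul_f0_right (z : ExteriorAlgebra ℂ V ⊗[ℂ] ((ULift.{u} ℂ) ⊗[ℂ] (ULift.{u} ℂ))) :
    D.mul.f0 (0, z) = D.q z := by
  refine (LinearMap.coprod_apply D.p D.q (0, z)).trans ?_
  rw [map_zero, zero_add]

theorem mul_f1_right (z : (ULift.{u} ℂ) ⊗[ℂ] D.A.carrier) : D.mul.f1 (0, z) = D.r z := by
  refine (LinearMap.coprod_apply D.l D.r (0, z)).trans ?_
  rw [map_zero, zero_add]

/-- The untwisted part of a submodule is zero or everything. If zero, a twisted element `n` vanishes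
because its product with the generator is a multiple of `s ≠ 0`; if everything, it contains the unit
and hence generates the twisted sector. -/
theorem isSimple : D.alg.IsSimple := by
  refine ⟨Or.inr (inferInstanceAs (Nontrivial (ULift.{u} ℂ))),
    fun (N0 : Submodule ℂ D.A.carrier) (N1 : Submodule ℂ (ULift.{u} ℂ)) hN => ?_⟩
  rcases D.simple N0 hN.act (fun l n hn =>
      (congrArg (· ∈ N0) (D.mul_f0_left (l ⊗ₜ n))).mp (hN.mul00 l n hn)) with h | h
  · refine Or.inl ⟨h, (Submodule.eq_bot_iff N1).mpr fun n hn => ?_⟩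
    have h1 : D.q (1 ⊗ₜ (ULift.up 1 ⊗ₜ n)) ∈ N0 :=
      (congrArg (· ∈ N0) (D.mul_f0_right (1 ⊗ₜ (ULift.up 1 ⊗ₜ n)))).mp (hN.mul11 1 (ULift.up 1) n hn)
    rw [h, Submodule.mem_bot, q_tmul, lineMul_tmul, map_one, Module.End.one_apply] at h1
    have h2 := (smul_eq_zero.mp h1).resolve_right D.s_ne_zero
    rw [one_mul] at h2
    exact ULift.ext _ _ h2
  · refine Or.inr ⟨h, (Submodule.eq_top_iff' (p := N1)).mpr fun n => ?_⟩
    have h1 : D.one ∈ N0 := h ▸ Submodule.mem_top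
    have h1 : D.r (n ⊗ₜ D.one) ∈ N1 :=
      (congrArg (· ∈ N1) (D.mul_f1_right (n ⊗ₜ D.one))).mp (hN.mul10 n D.one h1)
    rwa [r_tmul, D.ε_one, one_smul] at h1

theorem isGood {t : ExteriorAlgebra ℂ V} (h1 : ∀ v, ι v * t = 0) (h2 : invol t = t)
    (h3 : B.phi 1 t = 1) (h4 : B.phi 1 1 = t) : D.alg.IsGood where
  twisted := inferInstanceAs (Nontrivial (ULift.{u} ℂ))
  trivial_twist := D.trivial_twist
  commutative := D.commutative
  frobenius := ⟨D.frob, D.frob_mor, D.isNondegeneratePairing h1 h2 h3 h4⟩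
  simple := D.isSimple

end Datum
end datumGood

section lagrangianModel

variable {V : Type u} [AddCommGroup V] [Module ℂ V] [FiniteDimensional ℂ V]

local notation "ι" => ExteriorAlgebra.ι ℂ
local notation "ϵ" => ExteriorAlgebra.algebraMapInv (R := ℂ)

/-! ### The exterior algebra of a Lagrangian subspace -/

/-- The product of an exterior algebra is super-commutative. -/
theorem superCommutative {W : Type u} [AddCommGroup W] [Module ℂ W] (x y : ExteriorAlgebra ℂ W) :
    (1 / 2 : ℂ) • (y * x + y * invol x + invol y * x - invol y * invol x) = x * y := by
  induction x using ext_induction generalizing y with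
  | h1 => simp only [map_one, mul_one, one_mul]; module
  | hs c x hx => rw [smul_mul_assoc, ← hx]; simp only [map_smul, mul_smul_comm]; module
  | ha x z hx hz => rw [add_mul, ← hx, ← hz]; simp only [map_add, mul_add]; module
  | hm v x hx =>
    have h1 : ∀ z w : ExteriorAlgebra ℂ W, z * (ι v * w) = ι v * (invol z * w) := fun z w => by
      rw [← mul_assoc, mul_ι, mul_assoc]
    rw [mul_assoc, ← hx, invol_ι_mul]
    simp only [mul_neg, h1, invol_invol, mul_smul_comm, mul_add, mul_sub]
    module

variable (B : SymplecticForm V) (f : Submodule ℂ V)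

/-- The form `(v, -)` restricted to `f`. -/
def SymplecticForm.res : V →ₗ[ℂ] Module.Dual ℂ f := f.subtype.dualMap ∘ₗ B.formSF

variable {f}

theorem SymplecticForm.res_apply (v : V) (x : f) : B.res f v x = B.formSF v x := rfl

theorem SymplecticForm.res_surjective : Function.Surjective (B.res f) := fun θ => by
  obtain ⟨η, hη⟩ := LinearMap.exists_extend θ
  obtain ⟨v, hv⟩ := B.exists_formSF_eq η
  exact ⟨v, LinearMap.ext fun x => (hv x).trans (LinearMap.congr_fun hη x)⟩

variable {B} in
theorem SymplecticForm.IsLagrangian.res_eq_zero_iff (hf : B.IsLagrangian f) (v : V) :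
    B.res f v = 0 ↔ v ∈ f := by
  rw [(B.isLagrangian_iff f).mp hf]
  exact ⟨fun h y hy => LinearMap.congr_fun h ⟨y, hy⟩, fun h => LinearMap.ext fun y => h y y.2⟩

variable (f) in
/-- The exterior algebra of `f`, on which `v` acts by contraction with `(v, -)`. -/
abbrev extRep : Rep V where
  carrier := ExteriorAlgebra ℂ f
  par := invol.toLinearMap
  par_par := LinearMap.ext invol_invol
  act := CliffordAlgebra.contractLeft ∘ₗ B.res f
  act_par := fun v => LinearMap.ext fun g => contract_invol (B.res f v) g
  act_act := fun v w => LinearMap.ext fun g => contract_comm (B.res f v) (B.res f w) g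

theorem extRep_act (v : V) (x : ExteriorAlgebra ℂ f) :
    (extRep B f).act v x = contract (B.res f v) x := rfl

variable {B}

theorem extRep_act_eq_zero (hf : B.IsLagrangian f) {w : V} (hw : w ∈ f) : (extRep B f).act w = 0 := by
  have h := (hf.res_eq_zero_iff w).mpr hw
  exact (congrArg (fun θ => contract θ) h).trans (map_zero CliffordAlgebra.contractLeft)

theorem extRep_ann (hf : B.IsLagrangian f) : (extRep B f).ann = f := by
  ext v
  refine ⟨fun hv => (hf.res_eq_zero_iff v).mp ?_, fun hv => extRep_act_eq_zero hf hv⟩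
  refine LinearMap.ext fun x => ?_
  have h := LinearMap.congr_fun (show (extRep B f).act v = 0 from hv) (ι x)
  rw [extRep_act, contract_ι] at h
  exact (ExteriorAlgebra.algebraMap_eq_zero_iff _ _).mp h

/-- In an adapted basis every summand of `C` has a leg in `f`, and `f` acts as zero by isotropy. -/
theorem extRep_actC (hf : B.IsLagrangian f) : B.actC (extRep B f) (extRep B f) = 0 := by
  obtain ⟨n, e, g, h⟩ := hf.exists_adapted
  refine TensorProduct.ext' fun x y => ?_
  have h1 := B.sum_b_a h ((TensorProduct.mk ℂ (ExteriorAlgebra ℂ f) (ExteriorAlgebra ℂ f)).compl₁₂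
    ((extRep B f).act.flip (invol x)) ((extRep B f).act.flip y))
  refine (B.actC_tmul _ _ x y).trans (h1.trans (Finset.sum_eq_zero fun k _ => ?_))
  have h2 := extRep_act_eq_zero hf (h.mem k)
  simp only [LinearMap.compl₁₂_apply, LinearMap.flip_apply, h2, LinearMap.zero_apply, map_zero, sub_zero]

theorem extRep_hatC (hf : B.IsLagrangian f) : (extRep B f).actS B.hatC = 0 := by
  obtain ⟨n, e, g, h⟩ := hf.exists_adapted
  have h1 : ∀ k, (extRep B f).actS (ι (e k)) = 0 := fun k => by
    rw [Rep.actS_ι]; exact extRep_act_eq_zero hf (h.mem k)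
  rw [h.hatC_eq, map_smul, map_sum, Finset.sum_eq_zero, smul_zero]
  intro k _
  rw [map_mul, h1, mul_zero]

/-- Elements of `S` act by iterated contractions, so moving them past a vector `w` of `f` produces,
besides the super-commuted term, their own contraction with `(w,-)_SF`. -/
theorem extRep_actS_ι_mul (g : ExteriorAlgebra ℂ V) (w : f) (x : ExteriorAlgebra ℂ f) :
    (extRep B f).actS g (ι w * x) =
      (extRep B f).actS (contract (B.formSF w) (invol g)) x + ι w * (extRep B f).actS (invol g) x := by
  induction g using ext_induction generalizing x with
  | h1 => simp
  | hs c g hg => simp only [map_smul, LinearMap.smul_apply, hg, smul_add, mul_smul_comm]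
  | ha g h hg hh => simp only [map_add, LinearMap.add_apply, hg, hh, mul_add]; abel
  | hm v g hg =>
    have h1 := B.formSF_neg v w
    rw [Rep.actS_ι_mul, hg, map_add, extRep_act, extRep_act, contract_ι_mul, invol_ι_mul, map_neg,
      contract_ι_mul, map_neg, map_neg, map_sub, map_smul, LinearMap.neg_apply, LinearMap.sub_apply,
      LinearMap.neg_apply, LinearMap.smul_apply, Rep.actS_ι_mul, Rep.actS_ι_mul, extRep_act, extRep_act,
      mul_neg, B.res_apply, ← h1]
    module

/-- The form `g ↦ ϵ(g.s)` vanishes on products with `f`, and on contractions by `f` because `w s =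
0`. Since `φ` exchanges these conditions, its composite with `φ` satisfies them as well; the two
agree on `wedge g' n`, which `φ` fixes, hence everywhere. -/
theorem counit_actS_phi (hf : B.IsLagrangian f) {s : ExteriorAlgebra ℂ f} (hs : ∀ w : f, ι w * s = 0)
    (g : ExteriorAlgebra ℂ V) :
    ϵ ((extRep B f).actS (B.phi 1 g) s) = ϵ ((extRep B f).actS g s) := by
  obtain ⟨n, e, g', h⟩ := hf.exists_adapted
  let F : ExteriorAlgebra ℂ V →ₗ[ℂ] ℂ :=
    (AlgHom.toLinearMap ϵ) ∘ₗ LinearMap.applyₗ s ∘ₗ (extRep B f).actS.toLinearMap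
  have hF : ∀ g, F g = ϵ ((extRep B f).actS g s) := fun g => rfl
  have h1 : ∀ w ∈ f, ∀ g, F (ι w * g) = 0 := fun w hw g => by
    rw [hF, Rep.actS_ι_mul, extRep_act_eq_zero hf hw, LinearMap.zero_apply]; exact map_zero _
  have h2 : ∀ w ∈ f, ∀ g, F (contract (B.formSF w) g) = 0 := fun w hw g => by
    have := congrArg ϵ (extRep_actS_ι_mul (B := B) (invol g) ⟨w, hw⟩ s)
    rw [hs, map_zero, map_zero, map_add, counit_ι_mul, add_zero, invol_invol] at this
    exact this.symm
  have h3 : F ∘ₗ B.phi 1 - F = 0 := by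
    refine h.eq_zero (fun w hw x => ?_) (fun w hw x => ?_) ?_
    · rw [LinearMap.sub_apply, LinearMap.comp_apply, B.phi_ι_mul, map_neg, h2 w hw, h1 w hw]; simp
    · rw [LinearMap.sub_apply, LinearMap.comp_apply, B.phi_contract, h2 w hw, h1 w hw]; simp
    · rw [LinearMap.sub_apply, LinearMap.comp_apply, SymplecticForm.Adapted.phi_wedge (by norm_num) h, sub_self]
  exact sub_eq_zero.mp (LinearMap.congr_fun h3 g)

theorem topForm_invol {W : Type u} [AddCommGroup W] [Module ℂ W] [FiniteDimensional ℂ W]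
    (h : Even (Module.finrank ℂ W)) (g : ExteriorAlgebra ℂ W) :
    SymplecticForm.topForm W (invol g) = SymplecticForm.topForm W g := by
  obtain ⟨x, θ, hx, hs⟩ := exists_dual_family W
  refine sub_eq_zero.mp (LinearMap.congr_fun (show SymplecticForm.topForm W ∘ₗ invol.toLinearMap
    - SymplecticForm.topForm W = 0 from ?_) g)
  refine eq_zero_of_comp_contract hx (fun i _ y => ?_) fun y => ?_
  · rw [LinearMap.sub_apply, LinearMap.comp_apply, AlgHom.toLinearMap_apply, topForm_contract, sub_zero,
      ← neg_eq_zero, ← map_neg, ← contract_invol, topForm_contract]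
  · rw [mul_eq_counit_smul' fun v => wedge_mul_ι (hs ▸ Submodule.mem_top), map_smul, LinearMap.sub_apply,
      LinearMap.comp_apply, AlgHom.toLinearMap_apply, invol_wedge, h.neg_one_pow, one_smul, sub_self,
      smul_zero]

/-- The radical of the top form is stable under multiplication and contraction, so it is zero or
everything, and the latter would make the top form zero. -/
theorem eq_zero_of_topForm_mul {W : Type u} [AddCommGroup W] [Module ℂ W] [FiniteDimensional ℂ W]
    {a : ExteriorAlgebra ℂ W} (h : ∀ b, SymplecticForm.topForm W (b * a) = 0) : a = 0 := by
  let J : Submodule ℂ (ExteriorAlgebra ℂ W) :=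
    { carrier := {a | ∀ b, SymplecticForm.topForm W (b * a) = 0}
      add_mem' := fun {x y} hx hy b => by rw [mul_add, map_add, hx, hy, add_zero]
      zero_mem' := fun b => by simp
      smul_mem' := fun c x hx b => by rw [mul_smul_comm, map_smul, hx, smul_zero] }
  have hJ := eq_bot_or_eq_top J (fun v x hx b => by rw [← mul_assoc]; exact hx _) fun θ x hx b => by
    have h1 := topForm_contract θ (invol b * x)
    rwa [contract_mul, invol_invol, map_add, hx, zero_add] at h1
  rcases hJ with hJ | hJ
  · exact (Submodule.mem_bot ℂ).mp (hJ ▸ (h : a ∈ J))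
  · refine absurd (LinearMap.ext fun y => ?_) (topForm_ne_zero W)
    have h2 : y ∈ J := hJ ▸ Submodule.mem_top
    rw [← one_mul y]
    exact h2 1

/-- The data defining the algebra which corresponds to the Lagrangian subspace `f`. -/
def lagrangianDatum (hf : B.IsLagrangian f) (hn : Even (Module.finrank ℂ f)) {s : ExteriorAlgebra ℂ f}
    (hs : ∀ w : f, ι w * s = 0) (hs' : invol s = s) (h0 : SymplecticForm.topForm f s ≠ 0) : Datum B where
  A := extRep B f
  p := LinearMap.mul' ℂ _
  one := 1
  ε := AlgHom.toLinearMap ϵ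
  κ := SymplecticForm.topForm f
  s := s
  p_assoc := fun a b c => (mul_assoc a b c).symm
  one_p := fun a => one_mul (M := ExteriorAlgebra ℂ f) a
  p_one := fun a => mul_one (M := ExteriorAlgebra ℂ f) a
  p_swap := fun z => by
    induction z using TensorProduct.induction_on with
    | zero => simp
    | add y z hy hz => rw [map_add, map_add, hy, hz, map_add]
    | tmul x y =>
      rw [SuperSpace.swap_tmul, map_smul]
      simp only [map_add, map_sub]
      exact superCommutative x y
  act_p := fun v a b => contract_mul (θ := B.res f v) a b
  par_p := fun a b => map_mul invol a b
  act_one := fun v => contract_one (θ := B.res f v)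
  par_one := map_one invol
  ε_p := fun a b => map_mul ϵ a b
  ε_one := map_one ϵ
  ε_par := fun a => counit_invol a
  p_s := fun a => mul_eq_counit_smul hs a
  s_p := fun a => mul_eq_counit_smul' (fun v => by rw [mul_ι, hs', hs]) a
  par_s := hs'
  actC_eq := extRep_actC hf
  actS_hatC := extRep_hatC hf
  ε_phi := counit_actS_phi hf hs
  κ_act := fun v a => topForm_contract (B.res f v) a
  κ_par := topForm_invol hn
  κ_s := h0
  nondeg := fun a ha => eq_zero_of_topForm_mul ha
  simple := fun N h1 h2 => eq_bot_or_eq_top N (fun v x hx => h2 (ι v) x hx) fun θ x hx => by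
    obtain ⟨v, rfl⟩ := B.res_surjective θ
    exact h1 v x hx

theorem exists_top_element {W : Type u} [AddCommGroup W] [Module ℂ W] [FiniteDimensional ℂ W]
    (h : Even (Module.finrank ℂ W)) : ∃ s : ExteriorAlgebra ℂ W, (∀ w, ι w * s = 0) ∧ invol s = s ∧
      SymplecticForm.topForm W s ≠ 0 := by
  obtain ⟨x, θ, hx, hs⟩ := exists_dual_family W
  have h1 : ∀ w, ι w * wedge x (Module.finrank ℂ W) = 0 := fun w =>
    ι_mul_wedge (hs ▸ Submodule.mem_top)
  have h2 : invol (wedge x (Module.finrank ℂ W)) = wedge x (Module.finrank ℂ W) := by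
    rw [invol_wedge, h.neg_one_pow, one_smul]
  refine ⟨_, h1, h2, fun h0 => wedge_ne_zero hx (eq_zero_of_topForm_mul fun b => ?_)⟩
  rw [mul_eq_counit_smul h1, map_smul, h0, smul_zero]

/-- Each Lagrangian subspace is the annihilator of an algebra satisfying the five conditions. -/
theorem exists_isGood [Nontrivial V] (hf : B.IsLagrangian f) (hn : Even (Module.finrank ℂ f)) :
    ∃ H : Alg B 1, H.IsGood ∧ H.obj = ⟨extRep B f, SuperSpace.evenLine⟩ := by
  obtain ⟨s, hs, hs', h0⟩ := exists_top_element hn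
  obtain ⟨n, e, g, h⟩ := hf.exists_adapted
  -- Evenness of `dim f` removes the sign in `φ(1) = (-1)^n top`, so that `φ` exchanges `1` and
  -- `top`.
  have hn' : (-1 : ℂ) ^ n = 1 := by rw [← h.finrank_f]; exact hn.neg_one_pow
  refine ⟨(lagrangianDatum hf hn hs hs' h0).alg, Datum.isGood _ (t := SymplecticForm.top n e g) h.ι_mul_top
    (SymplecticForm.Adapted.invol_top n e g) ?_ ?_, rfl⟩
  · rw [SymplecticForm.Adapted.phi_top h, one_pow, one_smul]
  · rw [SymplecticForm.Adapted.phi_one (by norm_num) h, hn', one_smul]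

end lagrangianModel

section grothendieck

variable {V : Type u} [AddCommGroup V] [Module ℂ V] [FiniteDimensional ℂ V]

local notation "ι" => ExteriorAlgebra.ι ℂ

/-! ### Classes in the Grothendieck group -/

theorem IsShortExact.cls_eq {X Y Z : Obj V} {f : GMap X Y} {g : GMap Y Z} (h : IsShortExact f g) :
    Y.cls = X.cls + Z.cls := by
  have h1 : (QuotientAddGroup.mk (FreeAbelianGroup.of Y - FreeAbelianGroup.of X
      - FreeAbelianGroup.of Z) : K0 V) = 0 :=
    (QuotientAddGroup.eq_zero_iff _).mpr (AddSubgroup.subset_closure ⟨X, Y, Z, f, g, h, rfl⟩)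
  rw [QuotientAddGroup.mk_sub, QuotientAddGroup.mk_sub, sub_sub, sub_eq_zero] at h1
  exact h1

theorem Obj.cls_eq_zero (X : Obj V) (h0 : Subsingleton X.s0.carrier) (h1 : Subsingleton X.s1.carrier) :
    X.cls = 0 := by
  have h : IsShortExact (GMap.id X) (GMap.id X) :=
    ⟨GMap.IsMor.id X, GMap.IsMor.id X, fun _ _ _ => Subsingleton.elim _ _,
      fun _ _ _ => Subsingleton.elim _ _, fun y => ⟨fun _ => ⟨y, rfl⟩, fun _ => Subsingleton.elim _ _⟩,
      fun y => ⟨fun _ => ⟨y, rfl⟩, fun _ => Subsingleton.elim _ _⟩, fun y => ⟨y, rfl⟩, fun y => ⟨y, rfl⟩⟩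
  simpa using h.cls_eq

/-- The zero object. -/
abbrev Obj.zero (V : Type u) [AddCommGroup V] [Module ℂ V] [FiniteDimensional ℂ V] : Obj V :=
  ⟨SuperSpace.zero.triv, SuperSpace.zero⟩

theorem Obj.cls_eq_of_bijective {X Y : Obj V} {f : GMap X Y} (hf : f.IsMor)
    (h0 : Function.Bijective f.f0) (h1 : Function.Bijective f.f1) : X.cls = Y.cls := by
  have h : IsShortExact f (⟨0, 0⟩ : GMap Y (Obj.zero V)) :=
    ⟨hf, ⟨by simp, by simp, by simp⟩, h0.1, h1.1,
      fun y => ⟨fun _ => h0.2 y, fun _ => rfl⟩, fun y => ⟨fun _ => h1.2 y, fun _ => rfl⟩,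
      fun y => ⟨0, rfl⟩, fun y => ⟨0, rfl⟩⟩
  have hz : (Obj.zero V).cls = 0 :=
    Obj.cls_eq_zero _ (inferInstanceAs (Subsingleton PUnit)) (inferInstanceAs (Subsingleton PUnit))
  rw [h.cls_eq, hz, add_zero]

theorem Alg.Iso.cls_eq {B : SymplecticForm V} {β : ℂ} {H K : Alg B β} (h : H.Iso K) :
    H.obj.cls = K.obj.cls := by
  obtain ⟨f, g, hf, -, hgf, hfg, -, -⟩ := h
  refine Obj.cls_eq_of_bijective hf ?_ ?_
  · exact ⟨Function.LeftInverse.injective fun x => LinearMap.congr_fun (congrArg GMap.f0 hgf) x,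
      Function.RightInverse.surjective fun x => LinearMap.congr_fun (congrArg GMap.f0 hfg) x⟩
  · exact ⟨Function.LeftInverse.injective fun x => LinearMap.congr_fun (congrArg GMap.f1 hgf) x,
      Function.RightInverse.surjective fun x => LinearMap.congr_fun (congrArg GMap.f1 hfg) x⟩

theorem Alg.Iso.ann_eq {B : SymplecticForm V} {β : ℂ} {H K : Alg B β} (h : H.Iso K) :
    H.obj.s0.ann = K.obj.s0.ann := by
  have key : ∀ {H K : Alg B β}, H.Iso K → H.obj.s0.ann ≤ K.obj.s0.ann := by
    rintro H K ⟨f, g, hf, -, -, hfg, -, -⟩ v hv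
    refine LinearMap.ext fun x => ?_
    have h1 : f.f0 (g.f0 x) = x := LinearMap.congr_fun (congrArg GMap.f0 hfg) x
    have h2 : H.obj.s0.act v = 0 := hv
    rw [← h1, ← LinearMap.comp_apply (K.obj.s0.act v), ← hf.equivariant, LinearMap.comp_apply, h2]
    simp
  exact le_antisymm (key h) (key h.symm)

/-- An object of the untwisted sector. -/
abbrev Rep.toObj (X : Rep V) : Obj V := ⟨X, SuperSpace.zero⟩

theorem Obj.cls_eq_add (X : Rep V) (Y : SuperSpace.{u}) :
    (⟨X, Y⟩ : Obj V).cls = X.toObj.cls + (Obj.inr V Y).cls := by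
  have h : IsShortExact (⟨LinearMap.id, 0⟩ : GMap X.toObj ⟨X, Y⟩)
      (⟨0, LinearMap.id⟩ : GMap ⟨X, Y⟩ (Obj.inr V Y)) :=
    ⟨⟨rfl, by simp, fun _ => rfl⟩, ⟨by simp, rfl, by simp⟩, fun _ _ h => h,
      fun _ _ _ => Subsingleton.elim _ _,
      fun y => ⟨fun _ => ⟨y, rfl⟩, fun _ => rfl⟩,
      fun y => ⟨fun hy => ⟨0, hy.symm⟩, by rintro ⟨x, rfl⟩; rfl⟩, fun y => ⟨0, rfl⟩, fun y => ⟨y, rfl⟩⟩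
  exact h.cls_eq

/-- The quotient of a representation. -/
def Rep.quot (X : Rep V) (N : Submodule ℂ X.carrier) (hp : N ≤ N.comap X.par)
    (ha : ∀ v, N ≤ N.comap (X.act v)) : Rep V where
  carrier := X.carrier ⧸ N
  par := N.mapQ N X.par hp
  par_par := by
    ext x
    simp [X.par_par_apply]
  act :=
    { toFun := fun v => N.mapQ N (X.act v) (ha v)
      map_add' := fun v w => by ext x; simp
      map_smul' := fun c v => by ext x; simp }
  act_par := fun v => by
    ext x
    simp [X.par_act_apply]
  act_act := fun v w => by
    ext x
    have := LinearMap.congr_fun (X.act_act v w) x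
    simp only [Module.End.mul_apply, LinearMap.neg_apply] at this
    simp [this]

/-- Splits off an invariant subspace. The dimension and the quotient map are recorded alongside the
class so that both dimension and trace can be followed in the induction. -/
theorem Rep.cls_eq_add_quot (X : Rep V) {L : SuperSpace.{u}} {i : L.carrier →ₗ[ℂ] X.carrier}
    (hi : Function.Injective i) (hp : i ∘ₗ L.par = X.par ∘ₗ i) (ha : ∀ v, X.act v ∘ₗ i = 0) :
    ∃ Q : Rep V, X.toObj.cls = (Obj.inl V L).cls + Q.toObj.cls ∧
      Module.finrank ℂ X.carrier = Module.finrank ℂ L.carrier + Module.finrank ℂ Q.carrier ∧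
      ∃ q : X.carrier →ₗ[ℂ] Q.carrier, Function.Exact i q ∧ Function.Surjective q ∧
        q ∘ₗ X.par = Q.par ∘ₗ q := by
  have h1 : LinearMap.range i ≤ (LinearMap.range i).comap X.par := by
    rintro _ ⟨z, rfl⟩
    exact ⟨L.par z, LinearMap.congr_fun hp z⟩
  have h2 : ∀ v, LinearMap.range i ≤ (LinearMap.range i).comap (X.act v) := by
    rintro v _ ⟨z, rfl⟩
    exact ⟨0, by rw [map_zero]; exact (LinearMap.congr_fun (ha v) z).symm⟩
  have hex : Function.Exact i (LinearMap.range i).mkQ := fun x => by simp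
  refine ⟨X.quot (LinearMap.range i) h1 h2, ?_, ?_, (LinearMap.range i).mkQ, hex,
    Submodule.mkQ_surjective _, rfl⟩
  · have h : IsShortExact (⟨i, LinearMap.id⟩ : GMap (Obj.inl V L) X.toObj)
      (⟨(LinearMap.range i).mkQ, LinearMap.id⟩ : GMap X.toObj (X.quot (LinearMap.range i) h1 h2).toObj) :=
      ⟨⟨hp, rfl, fun v => by simp [ha v]⟩, ⟨rfl, rfl, fun v => rfl⟩, hi,
        fun _ _ _ => Subsingleton.elim _ _, hex, fun y => ⟨fun _ => ⟨y, rfl⟩, fun _ => rfl⟩,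
        Submodule.mkQ_surjective _, fun y => ⟨y, rfl⟩⟩
    exact h.cls_eq
  · rw [← LinearMap.finrank_range_of_inj hi, add_comm]
    exact (Submodule.finrank_quotient_add_finrank _).symm

/-- With a retraction `r` of `i` and a section `s` of `q`, the operator `p'` is `(p' i) r` plus `(p'
(s - i r s)) q`. Cyclicity of the trace turns the two terms into `p` and `p''`. -/
theorem trace_eq_add_of_exact {X Y Z : Type u} [AddCommGroup X] [Module ℂ X] [FiniteDimensional ℂ X]
    [AddCommGroup Y] [Module ℂ Y] [FiniteDimensional ℂ Y] [AddCommGroup Z] [Module ℂ Z]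
    [FiniteDimensional ℂ Z] {i : X →ₗ[ℂ] Y} {q : Y →ₗ[ℂ] Z} (hi : Function.Injective i)
    (hex : Function.Exact i q) (hq : Function.Surjective q) {p : X →ₗ[ℂ] X} {p' : Y →ₗ[ℂ] Y}
    {p'' : Z →ₗ[ℂ] Z} (hp : i ∘ₗ p = p' ∘ₗ i) (hp' : q ∘ₗ p' = p'' ∘ₗ q) :
    LinearMap.trace ℂ Y p' = LinearMap.trace ℂ X p + LinearMap.trace ℂ Z p'' := by
  obtain ⟨r, hr⟩ := i.exists_leftInverse_of_injective (LinearMap.ker_eq_bot.mpr hi)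
  obtain ⟨s, hs⟩ := q.exists_rightInverse_of_surjective (LinearMap.range_eq_top.mpr hq)
  have hr' := fun x => LinearMap.congr_fun hr x
  have hs' := fun x => LinearMap.congr_fun hs x
  simp only [LinearMap.comp_apply, LinearMap.id_apply] at hr' hs'
  have h1 : p' = (p' ∘ₗ i) ∘ₗ r + (p' ∘ₗ (s - i ∘ₗ r ∘ₗ s)) ∘ₗ q := by
    refine LinearMap.ext fun y => ?_
    obtain ⟨x, hx⟩ := (hex (y - s (q y))).mp (by rw [map_sub, hs', sub_self])
    have hy : y = i x + s (q y) := by rw [hx, sub_add_cancel]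
    have hy' : y = i (r y) + (s (q y) - i (r (s (q y)))) := by
      have h2 : r y = x + r (s (q y)) := by
        conv_lhs => rw [hy]
        rw [map_add, hr']
      rw [h2, map_add]
      nth_rewrite 1 [hy]
      abel
    conv_lhs => rw [hy', map_add]
    simp
  have h3 : q ∘ₗ p' ∘ₗ (s - i ∘ₗ r ∘ₗ s) = p'' := by
    rw [← LinearMap.comp_assoc, hp', LinearMap.comp_assoc, LinearMap.comp_sub, hs]
    have : q ∘ₗ i = 0 := LinearMap.ext fun x => (hex _).mpr ⟨x, rfl⟩
    rw [← LinearMap.comp_assoc _ i q, this, LinearMap.zero_comp, sub_zero, LinearMap.comp_id]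
  rw [h1, map_add, LinearMap.trace_comp_comm' r, LinearMap.trace_comp_comm' q, h3, ← hp,
    ← LinearMap.comp_assoc, hr, LinearMap.id_comp]

/-- A basis of `h` acts by anticommuting square-zero operators, which have a common kernel vector
`x`. Either `x + par x` is non-zero and even, or `x` is odd. -/
theorem Rep.exists_invariant (X : Rep V) (h : Nontrivial X.carrier) :
    ∃ x : X.carrier, x ≠ 0 ∧ (∀ v, X.act v x = 0) ∧ (X.par x = x ∨ X.par x = -x) := by
  obtain ⟨x, -, hx, hs⟩ := exists_common_kernel (fun i => X.act (SymplecticForm.b i))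
    (fun i x => LinearMap.congr_fun (X.act_sq _) x) (fun i j x => LinearMap.congr_fun (X.act_act _ _) x)
    ⊤ (fun _ _ _ => Submodule.mem_top) top_ne_bot Finset.univ
  have h1 : X.act.flip x = 0 := SymplecticForm.b.ext fun i => hs i (Finset.mem_univ i)
  have h2 : ∀ v, X.act v x = 0 := fun v => LinearMap.congr_fun h1 v
  have h3 : ∀ v, X.act v (X.par x) = 0 := fun v => by
    have := X.par_act_apply v x
    rw [h2, map_zero, eq_comm, neg_eq_zero] at this
    exact this
  by_cases h4 : x + X.par x = 0
  · refine ⟨x, hx, h2, Or.inr (eq_neg_of_add_eq_zero_right h4)⟩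
  · exact ⟨x + X.par x, h4, fun v => by rw [map_add, h2, h3, add_zero], Or.inl (by
      rw [map_add, X.par_par_apply, add_comm])⟩

/-- The class of a representation is determined by its dimension and by the trace of the parity. -/
theorem Rep.exists_cls_eq (m : ℕ) : ∀ X : Rep V, Module.finrank ℂ X.carrier = m →
    ∃ a b : ℕ, X.toObj.cls = a • (Obj.one V).cls + b • (Obj.piOne V).cls ∧ a + b = m ∧
      LinearMap.trace ℂ X.carrier X.par = a - b := by
  induction m with
  | zero =>
    intro X hX
    have h := Module.finrank_zero_iff.mp hX
    refine ⟨0, 0, ?_, rfl, ?_⟩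
    · rw [Obj.cls_eq_zero _ h (inferInstanceAs (Subsingleton PUnit))]; simp
    · rw [Subsingleton.elim X.par 0, map_zero]; simp
  | succ m ih =>
    intro X hX
    obtain ⟨x, hx, hv, hpar⟩ := X.exists_invariant (Module.nontrivial_of_finrank_pos (R := ℂ) (by omega))
    let i : ULift.{u} ℂ →ₗ[ℂ] X.carrier := LinearMap.toSpanSingleton ℂ _ x ∘ₗ ULift.moduleEquiv.toLinearMap
    have hi : Function.Injective i := fun y z h => ULift.ext _ _ (smul_left_injective ℂ hx h)
    have hi0 : ∀ v, X.act v ∘ₗ i = 0 := fun v => LinearMap.ext fun z => by simp [i, hv]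
    have h1 : Module.finrank ℂ (ULift.{u} ℂ) = 1 := by
      rw [LinearEquiv.finrank_eq ULift.moduleEquiv, Module.finrank_self]
    rcases hpar with hpar | hpar
    · obtain ⟨Q, hQ, hfin, q, hex, hq, hqp⟩ := X.cls_eq_add_quot (L := SuperSpace.evenLine) hi
        (LinearMap.ext fun z => by simp [i, hpar]) hi0
      obtain ⟨a, b, h2, h3, h4⟩ := ih Q (by rw [hX, h1] at hfin; omega)
      refine ⟨a + 1, b, ?_, by omega, ?_⟩
      · rw [hQ, h2, succ_nsmul']; abel
      · rw [trace_eq_add_of_exact (p := LinearMap.id) hi hex hq (LinearMap.ext fun z => by simp [i, hpar]) hqp,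
          h4, LinearMap.trace_id, h1]
        push_cast
        ring
    · obtain ⟨Q, hQ, hfin, q, hex, hq, hqp⟩ := X.cls_eq_add_quot (L := SuperSpace.oddLine) hi
        (LinearMap.ext fun z => by simp [i, hpar]) hi0
      obtain ⟨a, b, h2, h3, h4⟩ := ih Q (by rw [hX, h1] at hfin; omega)
      refine ⟨a, b + 1, ?_, by omega, ?_⟩
      · rw [hQ, h2, succ_nsmul']; abel
      · rw [trace_eq_add_of_exact (p := -LinearMap.id) hi hex hq (LinearMap.ext fun z => by simp [i, hpar]) hqp,
          h4, map_neg, LinearMap.trace_id, h1]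
        push_cast
        ring

/-- For `θ w = 1` the operator `J`, multiplication by `w` plus contraction with `θ`, satisfies `J² =
1` and anticommutes with parity, so the trace of parity equals its negative. -/
theorem trace_invol (W : Type u) [AddCommGroup W] [Module ℂ W] [FiniteDimensional ℂ W] [Nontrivial W] :
    LinearMap.trace ℂ (ExteriorAlgebra ℂ W) invol.toLinearMap = 0 := by
  obtain ⟨w, θ, hθ⟩ : ∃ (w : W) (θ : Module.Dual ℂ W), θ w = 1 := by
    obtain ⟨x, θ, hx, -⟩ := exists_dual_family W
    exact ⟨x 0, θ 0, (hx 0 Module.finrank_pos 0 Module.finrank_pos).trans (if_pos rfl)⟩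
  let J : Module.End ℂ (ExteriorAlgebra ℂ W) := LinearMap.mulLeft ℂ (ι w) + contract θ
  let P : Module.End ℂ (ExteriorAlgebra ℂ W) := invol.toLinearMap
  have h1 : J * J = 1 := LinearMap.ext fun x => by
    simp [J, contract_ι_mul, ι_mul_self_mul, contract_contract, hθ, mul_add]
  have h2 : J * P = -(P * J) := LinearMap.ext fun x => by
    simp [J, P, contract_invol, invol_ι_mul]
    abel
  have h3 : LinearMap.trace ℂ _ (P * J * J) = LinearMap.trace ℂ _ (J * (P * J)) :=
    LinearMap.trace_mul_comm ℂ _ _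
  have h4 : -(P * J) * J = -(P * J * J) := LinearMap.ext fun x => rfl
  rw [← mul_assoc, h2, h4, map_neg, mul_assoc, h1, mul_one] at h3
  exact self_eq_neg.mp h3

theorem finrank_exteriorAlgebra (W : Type u) [AddCommGroup W] [Module ℂ W] [FiniteDimensional ℂ W] :
    Module.finrank ℂ (ExteriorAlgebra ℂ W) = 2 ^ Module.finrank ℂ W := by
  rw [Module.finrank_eq_card_basis (Module.finBasis ℂ W).ExteriorAlgebra]
  simp

/-- Vanishing of the trace of parity makes the two multiplicities equal, and their sum is `2^(dim
f)`. -/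
theorem cls_extRep (B : SymplecticForm V) (f : Submodule ℂ V) [Nontrivial f] :
    (extRep B f).toObj.cls =
      2 ^ (Module.finrank ℂ f - 1) • ((Obj.one V).cls + (Obj.piOne V).cls) := by
  obtain ⟨a, b, h1, h2, h3⟩ := Rep.exists_cls_eq _ (extRep B f) (finrank_exteriorAlgebra f)
  have h4 : (a : ℂ) = b := by
    rw [← sub_eq_zero, ← h3]
    exact trace_invol f
  have h5 : a = b := by exact_mod_cast h4
  subst h5
  have h6 : 0 < Module.finrank ℂ f := Module.finrank_pos
  obtain ⟨k, hk⟩ : ∃ k, Module.finrank ℂ f = k + 1 := ⟨Module.finrank ℂ f - 1, by omega⟩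
  rw [hk, pow_succ] at h2
  rw [h1, hk, Nat.add_sub_cancel, ← nsmul_add]
  congr 1
  omega

end grothendieck
end SF
end

namespace SF
universe u

/-! ### The classification -/

section classification

variable {V : Type u} [AddCommGroup V] [Module ℂ V] [FiniteDimensional ℂ V] [Nontrivial V]
  {B : SymplecticForm V}

theorem IsLagrangian.two_mul_finrank {f : Submodule ℂ V} (hf : B.IsLagrangian f) :
    Module.finrank ℂ V = 2 * Module.finrank ℂ f := by
  obtain ⟨n, e, g, h⟩ := SymplecticForm.IsLagrangian.exists_adapted hf
  rw [h.finrank_eq, h.finrank_f]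

/-- The class of an algebra satisfying the five conditions. -/
theorem Alg.IsGood.cls_eq {H : Alg B 1} (hH : H.IsGood) {f : Submodule ℂ V} (hf : B.IsLagrangian f)
    (hn : Even (Module.finrank ℂ f)) (h : H.obj.s0.ann = f) :
    H.obj.cls = 2 ^ (Module.finrank ℂ V / 2 - 1) • ((Obj.one V).cls + (Obj.piOne V).cls)
      + (Obj.T V).cls := by
  obtain ⟨K, hK, hobj⟩ := exists_isGood hf hn
  have h1 : K.obj.s0.ann = f := by rw [hobj]; exact extRep_ann hf
  have h2 := IsLagrangian.two_mul_finrank hf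
  have h3 : 0 < Module.finrank ℂ V := Module.finrank_pos
  have : Nontrivial f := Module.nontrivial_of_finrank_pos (R := ℂ) (by omega)
  rw [(hH.iso_of_ann_eq hK (h.trans h1.symm)).cls_eq, hobj, Obj.cls_eq_add, cls_extRep,
    show Module.finrank ℂ V / 2 = Module.finrank ℂ f by omega]

/-- The bijection of isomorphism classes of algebras with Lagrangian subspaces. -/
theorem exists_equiv (h : ∀ f : Submodule ℂ V, B.IsLagrangian f → Even (Module.finrank ℂ f)) :
    ∃ Φ : Quotient (goodSetoid B 1) ≃ {f : Submodule ℂ V // B.IsLagrangian f},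
      ∀ H : {H : Alg B 1 // H.IsGood},
        (Φ (Quotient.mk (goodSetoid B 1) H) : Submodule ℂ V) = H.1.obj.s0.ann := by
  let F : Quotient (goodSetoid B 1) → {f : Submodule ℂ V // B.IsLagrangian f} :=
    Quotient.lift (fun H => ⟨H.1.obj.s0.ann, H.2.isLagrangian_ann⟩)
      fun _ _ hHK => Subtype.ext (Alg.Iso.ann_eq hHK)
  refine ⟨Equiv.ofBijective F ⟨?_, ?_⟩, fun H => rfl⟩
  · rintro ⟨H⟩ ⟨K⟩ hHK
    exact Quotient.sound (H.2.iso_of_ann_eq K.2 (congrArg Subtype.val hHK))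
  · rintro ⟨f, hf⟩
    obtain ⟨K, hK, hobj⟩ := exists_isGood hf (h f hf)
    refine ⟨Quotient.mk _ ⟨K, hK⟩, Subtype.ext ?_⟩
    change K.obj.s0.ann = f
    rw [hobj]
    exact extRep_ann hf

end classification
end SF

theorem theorem4p1 {V : Type*} [AddCommGroup V] [Module ℂ V] [FiniteDimensional ℂ V] [Nontrivial V]
    (B : SF.SymplecticForm V) (β : ℂ) (hβ : β ^ 4 = (-1) ^ (Module.finrank ℂ V / 2)) :
    (β = 1 →
      (∃ Φ : Quotient (SF.goodSetoid B β) ≃ {f : Submodule ℂ V // B.IsLagrangian f},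
        ∀ H : {H : SF.Alg B β // H.IsGood},
          (Φ (Quotient.mk (SF.goodSetoid B β) H) : Submodule ℂ V) = H.1.obj.s0.ann) ∧
      ∀ H : SF.Alg B β, H.IsGood →
        H.obj.cls = (2 : ℕ) ^ (Module.finrank ℂ V / 2 - 1) • ((SF.Obj.one V).cls + (SF.Obj.piOne V).cls)
          + (SF.Obj.T V).cls) ∧
    (β ≠ 1 → ¬ ∃ H : SF.Alg B β, H.IsGood) := by
  refine ⟨?_, fun h ⟨H, hH⟩ => h hH.beta_eq_one⟩
  rintro rfl
  -- For `β = 1` the condition on `β` reads `(-1)^(d/2) = 1`, and `d/2` is the dimension of a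
  -- Lagrangian subspace.
  have h : ∀ f : Submodule ℂ V, B.IsLagrangian f → Even (Module.finrank ℂ f) := fun f hf => by
    have h1 := SF.IsLagrangian.two_mul_finrank hf
    rw [h1, Nat.mul_div_cancel_left _ two_pos, one_pow] at hβ
    rcases Nat.even_or_odd (Module.finrank ℂ f) with h2 | h2
    · exact h2
    · rw [h2.neg_one_pow] at hβ
      norm_num at hβ
  exact ⟨SF.exists_equiv h, fun H hH => hH.cls_eq hH.isLagrangian_ann (h _ hH.isLagrangian_ann) rfl⟩
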